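/- **Setting.** Let $\Omega\subset\mathbb R^2$ be a bounded domain with smooth boundary $\Gamma$ (a finite disjoint union of smooth simple closed curves), outward unit normal $\nu=(\nu_1,\nu_2)^\top$ and arc length derivative $\frac{d}{ds}$ in the direction $(-\nu_2,\nu_1)^\top$; put $A=\begin{bmatrix}0&-1\\1&0\end{bmatrix}$. Let $\lambda,\mu,\nu_p,\nu_u,B,\rho_s,\rho_f,\rho_a,\phi,\kappa,\omega$ be real, with $\mu,\lambda+\mu,\rho_f,\phi,\kappa,\omega>0$, $B\ne0$, $\nu_p,\nu_u\neq\frac12$, $\nu_u\ne-1$, $\nu_p\neq\nu_u$, and set $$\rho=(1-\phi)\rho_s+\phi\rho_f,\quad \alpha=\tfrac{3(\nu_u-\nu_p)}{B(1-2\nu_p)(1+\nu_u)},\quad R=\tfrac{2\phi^2\mu B^2(1-2\nu_p)(1+\nu_u)^2}{9(\nu_u-\nu_p)(1-2\nu_u)},\quad \beta=\tfrac{\omega\phi^2\rho_f\kappa}{i\phi^2+\omega\kappa(\rho_a+\phi\rho_f)},$$ $$q=\tfrac{\omega^2\phi^2\rho_f}{\beta R},\quad \gamma=-\tfrac{i\omega\rho_f(\alpha-\beta)}{\beta},\quad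 k_p=\omega\sqrt{\tfrac{\rho-\beta\rho_f}{\lambda+2\mu}},\quad k_s=\omega\sqrt{\tfrac{\rho-\beta\rho_f}{\mu}},\quad \epsilon=\tfrac{i\omega\gamma(\alpha-\beta)}{q(\lambda+2\mu)}.$$ Let $k_1,k_2\in\mathbb C$ with $\operatorname{Im}k_1,\operatorname{Im}k_2\ge0$ satisfy $k_1^2+k_2^2=q(1+\epsilon)+k_p^2$, $k_1^2k_2^2=qk_p^2$, and assume $k_1^2\ne k_2^2$. For $x\neq y$ let $\gamma_k(x,y)=\frac i4H^{(1)}_0(k|x-y|)$ and $$E=\begin{bmatrix}E_{11}&E_{12}\\E_{21}^\top&E_{22}\end{bmatrix},\qquad E_{11}=\tfrac1\mu\gamma_{k_s}I+\tfrac1{(\rho-\beta\rho_f)\omega^2}\nabla_x\nabla_x^\top\Big[\gamma_{k_s}-\tfrac{k_p^2-k_2^2}{k_1^2-k_2^2}\gamma_{k_1}+\tfrac{k_p^2-k_1^2}{k_1^2-k_2^2}\gamma_{k_2}\Big],$$ $$E_{12}=\tfrac{i\omega\gamma}{(\lambda+2\mu)(k_1^2-k_2^2)}\nabla_x[\gamma_{k_1}-\gamma_{k_2}],\quad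 E_{21}=-\tfrac{\gamma}{(\lambda+2\mu)(k_1^2-k_2^2)}\nabla_x[\gamma_{k_1}-\gamma_{k_2}],$$ $$E_{22}=\tfrac{i\rho_f\omega}{\beta(k_1^2-k_2^2)}\big[(k_p^2-k_1^2)\gamma_{k_1}-(k_p^2-k_2^2)\gamma_{k_2}\big].$$ With $T(\partial,\nu)u=2\mu\partial_\nu u+\lambda\nu\nabla\cdot u+\mu\,(-\nu_2,\nu_1)^\top(\partial_2u_1-\partial_1u_2)$ let $$\widetilde T=\begin{bmatrix}T&-\alpha\nu\\-i\omega\beta\nu^\top&\frac{i\beta}{\omega\rho_f}\partial_\nu\end{bmatrix},\qquad \widetilde T^*=\begin{bmatrix}T&-i\omega\alpha\nu\\-\beta\nu^\top&\frac{i\beta}{\omega\rho_f}\partial_\nu\end{bmatrix}.$$ The hypersingular operator is $$N(\psi)(x)=\int_\Gamma \widetilde T(\partial_x,\nu_x)\big(\widetilde T^*(\partial_y,\nu_y)E(x,y)\big)^\top\psi(y)\,ds_y,\qquad x\in\Gamma,$$ in the sense of the Hadamard finite part: the constant term $L$ in $\int_{\Gamma,\,|x-y|>r}=\frac cr+L+o(1)$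 as $r\to0^+$. Let $N_4$ be its scalar $(2,2)$ block, in the splitting $\psi=(u^\top,p)^\top$. **Lemma.** Let $C_4=\dfrac{i\beta}{\rho_f\omega(k_1^2-k_2^2)}$ and $$\begin{aligned} N_4^1(p)(x)&=i\omega\beta^2\int_\Gamma\nu_x^\top E_{11}(x,y)\nu_y\,p(y)\,ds_y+\tfrac{2i\beta\gamma\omega}{\lambda+2\mu}C_4\int_\Gamma\big[k_1^2\gamma_{k_1}-k_2^2\gamma_{k_2}\big]\nu_x^\top\nu_y\,p(y)\,ds_y\\ &\quad-C_4\int_\Gamma\big[(k_p^2-k_1^2)k_1^2\gamma_{k_1}-(k_p^2-k_2^2)k_2^2\gamma_{k_2}\big]\nu_x^\top\nu_y\,p(y)\,ds_y,\\ N_4^2(p)(x)&=\tfrac{i\beta\gamma\omega}{\lambda+2\mu}C_4\int_\Gamma\big[\gamma_{k_1}-\gamma_{k_2}\big]p(y)\,ds_y-C_4\int_\Gamma\big[(k_p^2-k_1^2)\gamma_{k_1}-(k_p^2-k_2^2)\gamma_{k_2}\big]p(y)\,ds_y,\\ N_4^3(p)(x)&=\tfrac{i\beta\gamma\omega}{\lambda+2\mu}C_4\int_\Gamma\nabla_x^\top\big[\gamma_{k_1}-\gamma_{k_2}\big]A\nu_y\,p(y)\,ds_y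 . \end{aligned}$$ The kernels of $N_4^1,N_4^2,N_4^3$ are weakly singular: continuous for $x\ne y$ on $\Gamma$ and bounded by $C|x-y|^{-a}$ for some $a<1$. For every $p\in C^{1,a}(\Gamma)$, $a>0$, the functions $N_4^2\frac{dp}{ds}$ and $N_4^3p$ are differentiable along $\Gamma$, the finite part defining $N_4(p)(x)$ exists for every $x\in\Gamma$, and $$N_4(p)=N_4^1(p)+\frac{d}{ds}N_4^2\Big(\frac{dp}{ds}\Big)+\frac{d}{ds}N_4^3(p)\qquad\text{on }\Gamma .$$ -/

import Mathlib

open Filter Topology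
open scoped ContDiff

noncomputable section

namespace Poro

/-- The Euclidean plane. -/
abbrev Plane := EuclideanSpace ℝ (Fin 2)

/-! ### Hankel function and Helmholtz fundamental solution -/

/-- Bessel function `J₀`. -/
def besselJ0 (z : ℂ) : ℂ :=
  ∑' m : ℕ, (-1) ^ m * (z ^ 2 / 4) ^ m / ((m.factorial : ℂ) ^ 2)

/-- Bessel function of the second kind `Y₀`, principal branch of the logarithm. -/
def besselY0 (z : ℂ) : ℂ :=
  2 / (Real.pi : ℂ) *
    ((Complex.log (z / 2) + (Real.eulerMascheroniConstant : ℂ)) * besselJ0 z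
      - ∑' m : ℕ, (-1) ^ m * ((harmonic m : ℚ) : ℂ) * (z ^ 2 / 4) ^ m
          / ((m.factorial : ℂ) ^ 2))

/-- Hankel function `H₀⁽¹⁾ = J₀ + i Y₀`. -/
def hankel0 (z : ℂ) : ℂ := besselJ0 z + Complex.I * besselY0 z

/-- `γ_k(x,y) = (i/4) H₀⁽¹⁾(k |x - y|)`, `x ≠ y`. -/
def helmholtz (k : ℂ) (x y : Plane) : ℂ :=
  Complex.I / 4 * hankel0 (k * ((‖x - y‖ : ℝ) : ℂ))

/-! ### The poroelastic medium -/

/-- Material parameters and frequency. The conditions say that `λ, μ` are admissible, that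
`ω, ρ_f, φ, κ` are positive, and that the quotients defining `α` and `R` make sense, `R ≠ 0`. -/
structure Medium where
  lam : ℝ
  mu : ℝ
  nu_p : ℝ
  nu_u : ℝ
  B : ℝ
  rho_s : ℝ
  rho_f : ℝ
  rho_a : ℝ
  phi : ℝ
  kappa : ℝ
  omega : ℝ
  mu_pos : 0 < mu
  lam_add_mu_pos : 0 < lam + mu
  omega_pos : 0 < omega
  rho_f_pos : 0 < rho_f
  phi_pos : 0 < phi
  kappa_pos : 0 < kappa
  B_ne : B ≠ 0
  nu_p_ne_half : nu_p ≠ 1 / 2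
  nu_u_ne_half : nu_u ≠ 1 / 2
  nu_u_ne_neg_one : nu_u ≠ -1
  nu_p_ne_nu_u : nu_p ≠ nu_u

namespace Medium

variable (P : Medium)

/-- Bulk density `ρ`. -/
def rho : ℝ := (1 - P.phi) * P.rho_s + P.phi * P.rho_f

/-- Compressibility `α`. -/
def alpha : ℝ := 3 * (P.nu_u - P.nu_p) / (P.B * (1 - 2 * P.nu_p) * (1 + P.nu_u))

/-- Constitutive coefficient `R`. -/
def R : ℝ :=
  2 * P.phi ^ 2 * P.mu * P.B ^ 2 * (1 - 2 * P.nu_p) * (1 + P.nu_u) ^ 2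
    / (9 * (P.nu_u - P.nu_p) * (1 - 2 * P.nu_u))

/-- `β = ω φ² ρ_f κ / (i φ² + ω κ (ρ_a + φ ρ_f))`. -/
def beta : ℂ :=
  (P.omega * P.phi ^ 2 * P.rho_f * P.kappa : ℂ)
    / (Complex.I * P.phi ^ 2 + P.omega * P.kappa * (P.rho_a + P.phi * P.rho_f))

/-- `q = ω² φ² ρ_f / (β R)`. -/
def q : ℂ := (P.omega ^ 2 * P.phi ^ 2 * P.rho_f : ℂ) / (P.beta * P.R)

/-- `γ = - i ω ρ_f (α - β) / β`. -/
def gam : ℂ := -(Complex.I * P.omega * P.rho_f * (P.alpha - P.beta)) / P.beta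

/-- `ρ - β ρ_f`. -/
def rhoEff : ℂ := P.rho - P.beta * P.rho_f

/-- Compressional wave number `k_p = ω √((ρ - β ρ_f)/(λ + 2μ))`. -/
def kp : ℂ := P.omega * (P.rhoEff / (P.lam + 2 * P.mu)) ^ (1 / 2 : ℂ)

/-- Shear wave number `k_s = ω √((ρ - β ρ_f)/μ)`. -/
def ks : ℂ := P.omega * (P.rhoEff / P.mu) ^ (1 / 2 : ℂ)

/-- `ε = i ω γ (α - β) / (q (λ + 2μ))`. -/
def eps : ℂ :=
  Complex.I * P.omega * P.gam * (P.alpha - P.beta) / (P.q * (P.lam + 2 * P.mu))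

/-- `k₁, k₂` are wave numbers of the medium: the roots, with nonnegative imaginary part, of the
characteristic system. -/
structure IsWaveNumbers (k₁ k₂ : ℂ) : Prop where
  im_nonneg₁ : 0 ≤ k₁.im
  im_nonneg₂ : 0 ≤ k₂.im
  sum_eq : k₁ ^ 2 + k₂ ^ 2 = P.q * (1 + P.eps) + P.kp ^ 2
  prod_eq : k₁ ^ 2 * k₂ ^ 2 = P.q * P.kp ^ 2

end Medium

/-! ### Differential operators in the plane -/

/-- `∂_j f`. -/
def pd (j : Fin 2) (f : Plane → ℂ) (x : Plane) : ℂ :=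
  fderiv ℝ f x (EuclideanSpace.single j 1)

/-- `∇ f`. -/
def grad (f : Plane → ℂ) (x : Plane) : Fin 2 → ℂ := fun j => pd j f x

/-- `∂_n f = n · ∇ f`. -/
def dn (n : Plane) (f : Plane → ℂ) (x : Plane) : ℂ := ∑ j, (n j : ℂ) * pd j f x

/-- A real vector as a complex one. -/
def cvec (n : Plane) : Fin 2 → ℂ := fun j => (n j : ℂ)

/-- The rotation matrix `A`. -/
def rotA : Matrix (Fin 2) (Fin 2) ℂ := !![0, -1; 1, 0]

/-- The index set of a vector `(u₁, u₂, p)`, with blocks `u` and `p`. -/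
abbrev Idx := Fin 2 ⊕ Unit

namespace Medium

variable (P : Medium)

/-- The traction operator
`T(∂,n) u = 2μ ∂_n u + λ n (∇·u) + μ n^⊥ (∂₂ u₁ - ∂₁ u₂)`, `n^⊥ = (-n₂, n₁)`. -/
def traction (n : Plane) (u : Plane → Fin 2 → ℂ) (x : Plane) : Fin 2 → ℂ := fun i =>
  2 * P.mu * dn n (fun z => u z i) x
    + P.lam * (n i : ℂ) * (∑ j, pd j (fun z => u z j) x)
    + P.mu * (![-(n 1 : ℂ), (n 0 : ℂ)] i)
        * (pd 1 (fun z => u z 0) x - pd 0 (fun z => u z 1) x)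

/-- The Neumann boundary operator `T̃(∂,n)`. -/
def neumann (n : Plane) (U : Plane → Idx → ℂ) (x : Plane) : Idx → ℂ :=
  Sum.elim
    (fun i => P.traction n (fun z j => U z (Sum.inl j)) x i
      - P.alpha * (n i : ℂ) * U x (Sum.inr ()))
    (fun _ => -(Complex.I * P.omega * P.beta) * (∑ j, (n j : ℂ) * U x (Sum.inl j))
      + Complex.I * P.beta / (P.omega * P.rho_f) * dn n (fun z => U z (Sum.inr ())) x)

/-- The adjoint Neumann boundary operator `T̃*(∂,n)`. -/
def neumannAdj (n : Plane) (U : Plane → Idx → ℂ) (x : Plane) : Idx → ℂ :=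
  Sum.elim
    (fun i => P.traction n (fun z j => U z (Sum.inl j)) x i
      - Complex.I * P.omega * P.alpha * (n i : ℂ) * U x (Sum.inr ()))
    (fun _ => -P.beta * (∑ j, (n j : ℂ) * U x (Sum.inl j))
      + Complex.I * P.beta / (P.omega * P.rho_f) * dn n (fun z => U z (Sum.inr ())) x)

/-! ### The fundamental solution -/

variable (k₁ k₂ : ℂ)

/-- `E₁₁`. -/
def E11 (x y : Plane) : Matrix (Fin 2) (Fin 2) ℂ := fun i j =>
  1 / P.mu * helmholtz P.ks x y * (1 : Matrix (Fin 2) (Fin 2) ℂ) i j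
    + 1 / (P.rhoEff * P.omega ^ 2)
      * pd i (pd j (fun z => helmholtz P.ks z y
          - (P.kp ^ 2 - k₂ ^ 2) / (k₁ ^ 2 - k₂ ^ 2) * helmholtz k₁ z y
          + (P.kp ^ 2 - k₁ ^ 2) / (k₁ ^ 2 - k₂ ^ 2) * helmholtz k₂ z y)) x

/-- `E₁₂`. -/
def E12 (x y : Plane) : Fin 2 → ℂ := fun i =>
  Complex.I * P.omega * P.gam / ((P.lam + 2 * P.mu) * (k₁ ^ 2 - k₂ ^ 2))
    * grad (fun z => helmholtz k₁ z y - helmholtz k₂ z y) x i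

/-- `E₂₁`. -/
def E21 (x y : Plane) : Fin 2 → ℂ := fun i =>
  -(P.gam / ((P.lam + 2 * P.mu) * (k₁ ^ 2 - k₂ ^ 2)))
    * grad (fun z => helmholtz k₁ z y - helmholtz k₂ z y) x i

/-- `E₂₂`. -/
def E22 (x y : Plane) : ℂ :=
  Complex.I * P.rho_f * P.omega / (P.beta * (k₁ ^ 2 - k₂ ^ 2))
    * ((P.kp ^ 2 - k₁ ^ 2) * helmholtz k₁ x y - (P.kp ^ 2 - k₂ ^ 2) * helmholtz k₂ x y)

/-- The fundamental solution `E = [E₁₁, E₁₂; E₂₁ᵀ, E₂₂]`. -/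
def E (x y : Plane) : Matrix Idx Idx ℂ :=
  Matrix.fromBlocks (P.E11 k₁ k₂ x y) (fun i _ => P.E12 k₁ k₂ x y i)
    (fun _ j => P.E21 k₁ k₂ x y j) (fun _ _ => P.E22 k₁ k₂ x y)

/-- `T̃*(∂_y, m) E(x,y)`, the operator acting on the columns of `E(x,·)`. -/
def adjE (m : Plane) (x y : Plane) : Matrix Idx Idx ℂ := fun i j =>
  P.neumannAdj m (fun w l => P.E k₁ k₂ x w l j) y i

/-- The kernel `T̃(∂_x, n) (T̃*(∂_y, m) E(x,y))ᵀ` of the hypersingular operator `N`, where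
`n = ν_x` and `m = ν_y`; the operator acts on the columns. -/
def hyperKernel (n m : Plane) (x y : Plane) : Matrix Idx Idx ℂ := fun i j =>
  P.neumann n (fun z l => (P.adjE k₁ k₂ m z y).transpose l j) x i

/-- `C₄ = iβ / (ρ_f ω (k₁² - k₂²))`. -/
def C4 : ℂ := Complex.I * P.beta / (P.rho_f * P.omega * (k₁ ^ 2 - k₂ ^ 2))

end Medium

/-- `k` is a weakly singular kernel on the curve `S`: continuous off the diagonal and bounded by
`C |x - y|^{-a}` with `a < 1`. -/
def IsWeaklySingular (S : Set Plane) (k : Plane → Plane → ℂ) : Prop :=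
  ContinuousOn (fun z : Plane × Plane => k z.1 z.2)
      {z | z.1 ∈ S ∧ z.2 ∈ S ∧ z.1 ≠ z.2} ∧
    ∃ C a : ℝ, 0 ≤ a ∧ a < 1 ∧ ∀ x ∈ S, ∀ y ∈ S, x ≠ y →
      ‖k x y‖ ≤ C * dist x y ^ (-a)

/-! ### Smooth boundaries -/

/-- The unit vector `(v₂, -v₁)/|v|`: for a counterclockwise curve with velocity `v`, the
outward normal. -/
def normalOf (v : Plane) : Plane := ‖v‖⁻¹ • !₂[v 1, -v 0]

/-- A parametrization of the boundary of a set `Ω` as a finite disjoint union of smooth regular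
simple closed curves, oriented so that `(x₂', -x₁')/|x'|` is the unit normal pointing out of `Ω`
and `Ω` lies locally on one side of its boundary. -/
structure SmoothBoundary (Ω : Set Plane) (ι : Type*) where
  curve : ι → ℝ → Plane
  smooth : ∀ i, ContDiff ℝ ∞ (curve i)
  periodic : ∀ i, Function.Periodic (curve i) (2 * Real.pi)
  regular : ∀ i t, deriv (curve i) t ≠ 0
  simple : ∀ i j s t, curve i s = curve j t → i = j ∧ ∃ n : ℤ, s = t + n * (2 * Real.pi)
  range_eq : ⋃ i, Set.range (curve i) = frontier Ω
  outward : ∀ i t, ∀ᶠ h : ℝ in 𝓝[>] 0,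
    curve i t + h • normalOf (deriv (curve i) t) ∉ closure Ω ∧
    curve i t - h • normalOf (deriv (curve i) t) ∈ Ω

namespace SmoothBoundary

variable {Ω : Set Plane} {ι : Type*} (Γ : SmoothBoundary Ω ι)

open Classical in
/-- The outward unit normal `ν_x`, `x ∈ Γ` (`0` off `Γ`). -/
def normal (x : Plane) : Plane :=
  if h : ∃ a : ι × ℝ, Γ.curve a.1 a.2 = x then
    normalOf (deriv (Γ.curve h.choose.1) h.choose.2) else 0

open Classical in
/-- The tangential (arc length) derivative `df/ds` at `x ∈ Γ` (`0` off `Γ`). -/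
def ds (f : Plane → ℂ) (x : Plane) : ℂ :=
  if h : ∃ a : ι × ℝ, Γ.curve a.1 a.2 = x then
    deriv (fun t => f (Γ.curve h.choose.1 t)) h.choose.2
      / ((‖deriv (Γ.curve h.choose.1) h.choose.2‖ : ℝ) : ℂ)
  else 0

theorem periodic_int (i : ι) (n : ℤ) : Function.Periodic (Γ.curve i) (n * (2 * Real.pi)) :=
  (Γ.periodic i).int_mul n

theorem deriv_periodic {F : Type*} [NormedAddCommGroup F] [NormedSpace ℝ F] {g : ℝ → F} {c : ℝ}
    (hg : Function.Periodic g c) (t : ℝ) : deriv g (t + c) = deriv g t := by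
  rw [← deriv_comp_add_const]
  congr 1
  funext s
  exact hg s

/-- In a parametrization, `ν` is the normalized rotated velocity. -/
theorem normal_curve (i : ι) (t : ℝ) :
    Γ.normal (Γ.curve i t) = normalOf (deriv (Γ.curve i) t) := by
  have h : ∃ a : ι × ℝ, Γ.curve a.1 a.2 = Γ.curve i t := ⟨(i, t), rfl⟩
  rw [normal, dif_pos h]
  obtain ⟨h1, n, h2⟩ := Γ.simple _ _ _ _ h.choose_spec
  rw [h1, h2, deriv_periodic (Γ.periodic_int i n)]

/-- In a parametrization, `df/ds = |x'|⁻¹ (d/dt) f(x(t))`. -/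
theorem ds_curve (f : Plane → ℂ) (i : ι) (t : ℝ) :
    Γ.ds f (Γ.curve i t) =
      deriv (fun s => f (Γ.curve i s)) t / ((‖deriv (Γ.curve i) t‖ : ℝ) : ℂ) := by
  have h : ∃ a : ι × ℝ, Γ.curve a.1 a.2 = Γ.curve i t := ⟨(i, t), rfl⟩
  rw [ds, dif_pos h]
  obtain ⟨h1, n, h2⟩ := Γ.simple _ _ _ _ h.choose_spec
  have hp : Function.Periodic (fun s => f (Γ.curve i s)) (n * (2 * Real.pi)) :=
    fun s => congrArg f (Γ.periodic_int i n s)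
  rw [h1, h2, deriv_periodic (Γ.periodic_int i n), deriv_periodic hp]

/-- The arc length integral `∫_Γ f ds`. -/
def integral [Fintype ι] (f : Plane → ℂ) : ℂ :=
  ∑ i, ∫ t in (0 : ℝ)..(2 * Real.pi), f (Γ.curve i t) * ((‖deriv (Γ.curve i) t‖ : ℝ) : ℂ)

/-- `f` is differentiable along `Γ`. -/
def DiffAlong (f : Plane → ℂ) : Prop := ∀ i, Differentiable ℝ (fun t => f (Γ.curve i t))

/-- `f ∈ C^{1,a}(Γ)` for some `a > 0`. -/
def IsC1Holder (f : Plane → ℂ) : Prop :=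
  Γ.DiffAlong f ∧ ∃ (C a : NNReal), 0 < a ∧
    ∀ i, HolderWith C a (deriv (fun t => f (Γ.curve i t)))

/-- The integral operator with kernel `k`. -/
def op [Fintype ι] (k : Plane → Plane → ℂ) (f : Plane → ℂ) (x : Plane) : ℂ :=
  Γ.integral (fun y => k x y * f y)

/-- `L` is the Hadamard finite part of `∫_Γ g(y) ds_y` at the singular point `x`:
`∫_{Γ, |x - y| > r} g ds = c / r + L + o(1)` as `r → 0+`, for some constant `c`. -/
def HasFinitePart [Fintype ι] (x : Plane) (g : Plane → ℂ) (L : ℂ) : Prop :=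
  ∃ c : ℂ, Tendsto
    (fun r : ℝ => Γ.integral (Set.indicator {y | r < dist x y} g) - c / (r : ℂ))
    (𝓝[>] 0) (𝓝 L)

/-- The finite part is unique. -/
theorem HasFinitePart.unique [Fintype ι] {x : Plane} {g : Plane → ℂ} {L L' : ℂ}
    (h : Γ.HasFinitePart x g L) (h' : Γ.HasFinitePart x g L') : L = L' := by
  obtain ⟨c, hc⟩ := h
  obtain ⟨c', hc'⟩ := h'
  have h1 : Tendsto (fun r : ℝ => (c' - c) / (r : ℂ)) (𝓝[>] 0) (𝓝 (L - L')) := by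
    refine (hc.sub hc').congr fun r => ?_
    ring
  have h0 : Tendsto (fun r : ℝ => (r : ℂ)) (𝓝[>] 0) (𝓝 0) := by
    have := (Complex.continuous_ofReal.tendsto 0).mono_left (nhdsWithin_le_nhds (s := Set.Ioi 0))
    simpa using this
  have h2 : Tendsto (fun _ : ℝ => c' - c) (𝓝[>] (0 : ℝ)) (𝓝 ((L - L') * 0)) := by
    refine (h1.mul h0).congr' ?_
    filter_upwards [self_mem_nhdsWithin] with r hr
    have : (r : ℂ) ≠ 0 := by exact_mod_cast (ne_of_gt hr)
    field_simp
  have h3 : c' - c = 0 := by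
    simpa using tendsto_nhds_unique tendsto_const_nhds h2
  simp only [h3, zero_div] at h1
  exact sub_eq_zero.mp (tendsto_nhds_unique h1 tendsto_const_nhds)

/-! ### The (2,2) block of the hypersingular operator, and its regularized form -/

variable (P : Medium) (k₁ k₂ : ℂ)

/-- `L` is the value at `x ∈ Γ` of `N₄ p`, where `N₄` is the (2,2) block of the hypersingular
operator `N`. -/
def HasN4Value [Fintype ι] (p : Plane → ℂ) (x : Plane) (L : ℂ) : Prop :=
  Γ.HasFinitePart x
    (fun y => (P.hyperKernel k₁ k₂ (Γ.normal x) (Γ.normal y) x y).toBlocks₂₂ () () * p y) L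

/-- `ν_xᵀ ν_y`. -/
def normalDot (x y : Plane) : ℂ := cvec (Γ.normal x) ⬝ᵥ cvec (Γ.normal y)

/-- Kernel of `N₄¹`. -/
def kerN41 (x y : Plane) : ℂ :=
  Complex.I * P.omega * P.beta ^ 2
      * (cvec (Γ.normal x) ⬝ᵥ (P.E11 k₁ k₂ x y).mulVec (cvec (Γ.normal y)))
    + 2 * Complex.I * P.beta * P.gam * P.omega / (P.lam + 2 * P.mu) * P.C4 k₁ k₂
      * (k₁ ^ 2 * helmholtz k₁ x y - k₂ ^ 2 * helmholtz k₂ x y) * Γ.normalDot x y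
    - P.C4 k₁ k₂
      * ((P.kp ^ 2 - k₁ ^ 2) * k₁ ^ 2 * helmholtz k₁ x y
          - (P.kp ^ 2 - k₂ ^ 2) * k₂ ^ 2 * helmholtz k₂ x y) * Γ.normalDot x y

/-- Kernel of `N₄²`. -/
def kerN42 (x y : Plane) : ℂ :=
  Complex.I * P.beta * P.gam * P.omega / (P.lam + 2 * P.mu) * P.C4 k₁ k₂
      * (helmholtz k₁ x y - helmholtz k₂ x y)
    - P.C4 k₁ k₂
      * ((P.kp ^ 2 - k₁ ^ 2) * helmholtz k₁ x y - (P.kp ^ 2 - k₂ ^ 2) * helmholtz k₂ x y)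

/-- Kernel of `N₄³`. -/
def kerN43 (x y : Plane) : ℂ :=
  Complex.I * P.beta * P.gam * P.omega / (P.lam + 2 * P.mu) * P.C4 k₁ k₂
    * (grad (fun z => helmholtz k₁ z y - helmholtz k₂ z y) x
        ⬝ᵥ rotA.mulVec (cvec (Γ.normal y)))

end SmoothBoundary

end Poro

end

noncomputable section

namespace Poro

/-! ### Entire power series -/

/-! In the variable `ρ = |x-y|²` every Helmholtz solution has the form `A(ρ) log ρ + B(ρ)` with `A`,
`B` entire, and `A(0) = -1/(4π)` does not depend on `k`. Combinations whose coefficients sum to zero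
therefore lose their leading logarithm; this gives the weak singularity of `E₁₁` and of the kernel
of `N₄³`.

For a radial function with Hessian `H`, and `J` the quarter turn, the plane identity `n·Hm + Jn·HJm
= tr(H) n·m` holds, and the Helmholtz equation replaces `tr H` by `-k²` times the function. Applied
to the (2,2) entry of the hypersingular kernel, this leaves exactly the kernel of `N₄¹` plus a form
in the tangents `Jν_x`, `Jν_y` (`Medium.hyperKernel_split`). In parameters that form is `-∂_t ∂_s
F(|Y(s)-X(t)|²)` for one profile `F = profTot`.

What remains is one-dimensional: the finite part of `∫ -∂_t∂_s F · Q(s) ds` is `d/dt ∫ F Q'(s) ds`.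
With `s = t + τ` the singularity stays at `τ = 0`. Integrating by parts with `Q(t+τ) - Q(t)` gives a
form that can be differentiated under the integral, thanks to the Hölder bound on `Q'`
(`ChordPair.hasDerivAt_pot`). The hypersingular integrand plus the resulting `t`-derivative is an
exact `τ`-derivative (`hasDerivAt_prim`), so cutting at distance `r` leaves two boundary values.
Their logarithms cancel because both lie at distance `r`, their first order terms cancel because
they lie on opposite sides, and only `c/r` survives (`finitePart_of_eq`). Distinct components stay
apart and give no pole.

Finally `profTot = prof2 + cD · profD`. The potential of the first is `N₄²(dp/ds)`; that of the
second, times `cD`, is `N₄³ p` after an integration by parts without extra terms (`op_kerN42`,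
`op_kerN43`). -/

/-- The power series with coefficients `c`. -/
def powSeries (c : ℕ → ℂ) (z : ℂ) : ℂ := ∑' m, c m * z ^ m

/-- Coefficients of exponential type, which makes the power series entire. -/
def ExpBound (c : ℕ → ℂ) : Prop := ∃ C K : ℝ, 0 ≤ C ∧ 0 ≤ K ∧ ∀ m, ‖c m‖ ≤ C * K ^ m / m.factorial

/-- Coefficients of the derivative. -/
def shiftCoeff (c : ℕ → ℂ) (m : ℕ) : ℂ := (m + 1) * c (m + 1)

theorem ExpBound.shift {c : ℕ → ℂ} (h : ExpBound c) : ExpBound (shiftCoeff c) := by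
  obtain ⟨C, K, hC, hK, h⟩ := h
  refine ⟨C * K, K, by positivity, hK, fun m => ?_⟩
  have h1 := h (m + 1)
  have h2 : ‖((m : ℂ) + 1)‖ = (m : ℝ) + 1 := by
    have : ((m : ℂ) + 1) = ((m + 1 : ℕ) : ℂ) := by push_cast; ring
    rw [this, Complex.norm_natCast]; push_cast; ring
  rw [shiftCoeff, norm_mul, h2]
  calc ((m : ℝ) + 1) * ‖c (m + 1)‖ ≤ ((m : ℝ) + 1) * (C * K ^ (m + 1) / (m + 1).factorial) := by gcongr
    _ = C * K * K ^ m / m.factorial := by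
        rw [Nat.factorial_succ]; push_cast
        have : (m.factorial : ℝ) ≠ 0 := by positivity
        field_simp
        ring

theorem ExpBound.summable_norm {c : ℕ → ℂ} (h : ExpBound c) (R : ℝ) (hR : 0 ≤ R) :
    Summable fun m => ‖c m‖ * R ^ m := by
  obtain ⟨C, K, hC, hK, h⟩ := h
  refine Summable.of_nonneg_of_le (fun m => by positivity) (fun m => ?_)
    ((Real.summable_pow_div_factorial (K * R)).mul_left C)
  calc ‖c m‖ * R ^ m ≤ C * K ^ m / m.factorial * R ^ m := by gcongr; exact h m
    _ = _ := by rw [mul_pow]; ring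

theorem ExpBound.summable {c : ℕ → ℂ} (h : ExpBound c) (z : ℂ) :
    Summable fun m => c m * z ^ m :=
  Summable.of_norm (by simpa using h.summable_norm ‖z‖ (norm_nonneg z))

theorem ExpBound.hasDerivAt {c : ℕ → ℂ} (h : ExpBound c) (z : ℂ) :
    HasDerivAt (powSeries c) (powSeries (shiftCoeff c) z) z := by
  set R := ‖z‖ + 1 with hR
  have hR0 : 0 ≤ R := by positivity
  have hz : z ∈ Metric.ball (0 : ℂ) R := by simp [hR]
  have hsum : Summable fun m : ℕ => ‖c m‖ * (m * R ^ (m - 1)) := by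
    rw [← summable_nat_add_iff 1]
    refine (h.shift.summable_norm R hR0).congr fun m => ?_
    have h2 : ‖((m : ℂ) + 1)‖ = (m : ℝ) + 1 := by
      have : ((m : ℂ) + 1) = ((m + 1 : ℕ) : ℂ) := by push_cast; ring
      rw [this, Complex.norm_natCast]; push_cast; ring
    rw [shiftCoeff, norm_mul, h2, Nat.add_sub_cancel]; push_cast; ring
  have key := hasDerivAt_tsum_of_isPreconnected (𝕜 := ℂ) (g := fun m (y : ℂ) => c m * y ^ m)
    (g' := fun m y => c m * (m * y ^ (m - 1))) hsum Metric.isOpen_ball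
    (convex_ball (0 : ℂ) R).isPreconnected
    (fun m y _ => by simpa using (hasDerivAt_pow m y).const_mul (c m))
    (fun m y hy => by
      have hy' : ‖y‖ ≤ R := by simpa using (Metric.mem_ball.1 hy).le
      rw [norm_mul, norm_mul, norm_pow, Complex.norm_natCast]
      gcongr)
    hz (h.summable z) hz
  convert! key using 1
  have hs : Summable fun m : ℕ => c m * (m * z ^ (m - 1)) := by
    rw [← summable_nat_add_iff 1]
    refine (h.shift.summable z).congr fun m => ?_
    simp [shiftCoeff]; ring
  rw [hs.tsum_eq_zero_add, powSeries]
  simp only [shiftCoeff]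
  simp
  exact tsum_congr fun m => by ring

/-- The Bessel operator `4 (z g')'` acting on coefficients. -/
theorem ExpBound.bessel {c : ℕ → ℂ} (h : ExpBound c) (z : ℂ) :
    z * powSeries (shiftCoeff (shiftCoeff c)) z + powSeries (shiftCoeff c) z
      = powSeries (fun m => ((m : ℂ) + 1) ^ 2 * c (m + 1)) z := by
  have h1 := h.shift.summable z
  have h2 : Summable fun m : ℕ => (m : ℂ) * shiftCoeff c m * z ^ m := by
    rw [← summable_nat_add_iff 1]
    refine ((h.shift.shift.summable z).mul_left z).congr fun m => ?_
    simp only [shiftCoeff]; push_cast; ring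
  have h3 : z * powSeries (shiftCoeff (shiftCoeff c)) z
      = ∑' m : ℕ, (m : ℂ) * shiftCoeff c m * z ^ m := by
    rw [h2.tsum_eq_zero_add, powSeries, ← tsum_mul_left]
    simp only [Nat.cast_zero, zero_mul, zero_add]
    exact tsum_congr fun m => by rw [shiftCoeff]; push_cast; ring
  rw [h3, powSeries, powSeries, ← h2.tsum_add h1]
  exact tsum_congr fun m => by rw [shiftCoeff]; ring

/-! ### The Hankel function as a logarithmic profile -/

/-- Coefficients of `J₀(k √ρ)` in powers of `ρ`. -/
def besselCoeff (k : ℂ) (m : ℕ) : ℂ := (-1) ^ m * (k ^ 2 / 4) ^ m / ((m.factorial : ℂ) ^ 2)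

/-- Coefficients of the harmonic number series of `Y₀(k √ρ)`. -/
def harmCoeff (k : ℂ) (m : ℕ) : ℂ := ((harmonic m : ℚ) : ℂ) * besselCoeff k m

theorem norm_besselCoeff (k : ℂ) (m : ℕ) :
    ‖besselCoeff k m‖ = ‖k ^ 2 / 4‖ ^ m / (m.factorial : ℝ) ^ 2 := by
  simp [besselCoeff]

/-- A crude bound suffices: one of the two factorials in the denominator of the `Y₀` series absorbs
the harmonic number, and the other still makes the series entire. -/
theorem harmonic_le_factorial (m : ℕ) : (harmonic m : ℚ) ≤ (m.factorial : ℚ) := by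
  have h1 : (harmonic m : ℚ) ≤ m := by
    induction m with
    | zero => simp
    | succ n ih =>
      rw [harmonic_succ]
      have : ((n + 1 : ℕ) : ℚ)⁻¹ ≤ 1 := by
        apply inv_le_one_of_one_le₀
        push_cast; have : (0 : ℚ) ≤ n := by positivity
        linarith
      push_cast at *; linarith
  exact h1.trans (by exact_mod_cast Nat.self_le_factorial m)

theorem expBound_besselCoeff (k : ℂ) : ExpBound (besselCoeff k) := by
  refine ⟨1, ‖k ^ 2 / 4‖, zero_le_one, norm_nonneg _, fun m => ?_⟩
  rw [norm_besselCoeff, one_mul]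
  have : (1 : ℝ) ≤ m.factorial := by exact_mod_cast Nat.one_le_iff_ne_zero.2 m.factorial_ne_zero
  gcongr
  nlinarith

theorem expBound_harmCoeff (k : ℂ) : ExpBound (harmCoeff k) := by
  refine ⟨1, ‖k ^ 2 / 4‖, zero_le_one, norm_nonneg _, fun m => ?_⟩
  have h0 : ‖((harmonic m : ℚ) : ℂ)‖ ≤ (m.factorial : ℝ) := by
    have h1 : (0 : ℚ) ≤ harmonic m := by
      unfold harmonic; exact Finset.sum_nonneg fun i _ => by positivity
    have h2 : ((harmonic m : ℚ) : ℂ) = (((harmonic m : ℚ) : ℝ) : ℂ) := by push_cast; rfl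
    rw [h2, Complex.norm_real, Real.norm_of_nonneg (by exact_mod_cast h1)]
    exact_mod_cast harmonic_le_factorial m
  have h3 : (0 : ℝ) < m.factorial := by positivity
  rw [harmCoeff, norm_mul, norm_besselCoeff, one_mul]
  calc _ ≤ (m.factorial : ℝ) * (‖k ^ 2 / 4‖ ^ m / (m.factorial : ℝ) ^ 2) := by gcongr
    _ = _ := by field_simp

theorem besselCoeff_succ (k : ℂ) (m : ℕ) :
    ((m : ℂ) + 1) ^ 2 * besselCoeff k (m + 1) = -(k ^ 2 / 4) * besselCoeff k m := by
  have h1 : (m.factorial : ℂ) ≠ 0 := by exact_mod_cast m.factorial_ne_zero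
  have h2 : (m : ℂ) + 1 ≠ 0 := by exact_mod_cast m.succ_ne_zero
  simp only [besselCoeff, Nat.factorial_succ]
  push_cast
  field_simp
  ring

/-- The increment `1/(m+1)` of the harmonic number turns the Bessel recurrence into an inhomogeneous
one, whose forcing is the coefficient of the derivative of the `J₀` series. -/
theorem harmCoeff_succ (k : ℂ) (m : ℕ) :
    ((m : ℂ) + 1) ^ 2 * harmCoeff k (m + 1)
      = -(k ^ 2 / 4) * harmCoeff k m + shiftCoeff (besselCoeff k) m := by
  have h2 : (m : ℂ) + 1 ≠ 0 := by exact_mod_cast m.succ_ne_zero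
  have h := besselCoeff_succ k m
  simp only [harmCoeff, harmonic_succ, shiftCoeff]
  push_cast
  linear_combination (((harmonic m : ℚ) : ℂ)) * h + besselCoeff k (m + 1) * (m + 1) * (mul_inv_cancel₀ h2)

theorem powSeries_const_mul (a : ℂ) (c : ℕ → ℂ) (z : ℂ) :
    powSeries (fun m => a * c m) z = a * powSeries c z := by
  simp only [powSeries, ← tsum_mul_left, mul_assoc]

/-- Bessel's equation for `J₀(k √z)`. -/
theorem powSeries_bessel (k z : ℂ) :
    z * powSeries (shiftCoeff (shiftCoeff (besselCoeff k))) z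
      + powSeries (shiftCoeff (besselCoeff k)) z = -(k ^ 2 / 4) * powSeries (besselCoeff k) z := by
  rw [(expBound_besselCoeff k).bessel, ← powSeries_const_mul]
  simp only [besselCoeff_succ]

/-- The forcing term is what makes `J₀ log ρ` and the harmonic series combine into a solution of the
homogeneous equation. -/
theorem powSeries_harm (k z : ℂ) :
    z * powSeries (shiftCoeff (shiftCoeff (harmCoeff k))) z
      + powSeries (shiftCoeff (harmCoeff k)) z
      = -(k ^ 2 / 4) * powSeries (harmCoeff k) z + powSeries (shiftCoeff (besselCoeff k)) z := by
  rw [(expBound_harmCoeff k).bessel, ← powSeries_const_mul]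
  simp only [harmCoeff_succ]
  rw [powSeries, powSeries, powSeries, ← Summable.tsum_add]
  · exact tsum_congr fun m => by ring
  · simpa only [mul_assoc] using ((expBound_harmCoeff k).summable z).mul_left (-(k ^ 2 / 4))
  · exact (expBound_besselCoeff k).shift.summable z

theorem powSeries_zero (c : ℕ → ℂ) : powSeries c 0 = c 0 := by
  rw [powSeries, tsum_eq_single 0]
  · simp
  · intro m hm; simp [hm]

/-- A real entire function with complex values. -/
theorem ExpBound.hasDerivAt_real {c : ℕ → ℂ} (h : ExpBound c) (r : ℝ) :
    HasDerivAt (fun r : ℝ => powSeries c r) (powSeries (shiftCoeff c) r) r :=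
  (h.hasDerivAt r).comp_ofReal

/-! ### Logarithmic profiles -/

/-- A function of the form `A(ρ) log ρ + B(ρ)` with `A, B` twice continuously differentiable. The
first and second derivatives of `A, B` are part of the data. -/
structure LogProfile where
  A : ℝ → ℂ
  A' : ℝ → ℂ
  A'' : ℝ → ℂ
  B : ℝ → ℂ
  B' : ℝ → ℂ
  B'' : ℝ → ℂ
  hA : ∀ r, HasDerivAt A (A' r) r
  hA' : ∀ r, HasDerivAt A' (A'' r) r
  hA'' : Continuous A''
  hB : ∀ r, HasDerivAt B (B' r) r
  hB' : ∀ r, HasDerivAt B' (B'' r) r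
  hB'' : Continuous B''

namespace LogProfile

variable (F : LogProfile)

/-- The profile itself. -/
def val (r : ℝ) : ℂ := F.A r * Real.log r + F.B r

/-- The derivative of the profile. -/
def d1 (r : ℝ) : ℂ := F.A' r * Real.log r + F.A r * (r : ℂ)⁻¹ + F.B' r

/-- The second derivative of the profile. -/
def d2 (r : ℝ) : ℂ :=
  F.A'' r * Real.log r + 2 * F.A' r * (r : ℂ)⁻¹ - F.A r * ((r : ℂ) ^ 2)⁻¹ + F.B'' r

/-- Linear combination of profiles. -/
def lin (a : ℂ) (F : LogProfile) (b : ℂ) (G : LogProfile) : LogProfile where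
  A := fun r => a * F.A r + b * G.A r
  A' := fun r => a * F.A' r + b * G.A' r
  A'' := fun r => a * F.A'' r + b * G.A'' r
  B := fun r => a * F.B r + b * G.B r
  B' := fun r => a * F.B' r + b * G.B' r
  B'' := fun r => a * F.B'' r + b * G.B'' r
  hA := fun r => ((F.hA r).const_mul a).add ((G.hA r).const_mul b)
  hA' := fun r => ((F.hA' r).const_mul a).add ((G.hA' r).const_mul b)
  hA'' := (continuous_const.mul F.hA'').add (continuous_const.mul G.hA'')
  hB := fun r => ((F.hB r).const_mul a).add ((G.hB r).const_mul b)
  hB' := fun r => ((F.hB' r).const_mul a).add ((G.hB' r).const_mul b)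
  hB'' := (continuous_const.mul F.hB'').add (continuous_const.mul G.hB'')

theorem lin_val (a b : ℂ) (F G : LogProfile) (r : ℝ) :
    (lin a F b G).val r = a * F.val r + b * G.val r := by
  simp only [lin, val]; ring

theorem lin_d1 (a b : ℂ) (F G : LogProfile) (r : ℝ) :
    (lin a F b G).d1 r = a * F.d1 r + b * G.d1 r := by
  simp only [lin, d1]; ring

theorem lin_d2 (a b : ℂ) (F G : LogProfile) (r : ℝ) :
    (lin a F b G).d2 r = a * F.d2 r + b * G.d2 r := by
  simp only [lin, d2]; ring

theorem lin_A (a b : ℂ) (F G : LogProfile) (r : ℝ) :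
    (lin a F b G).A r = a * F.A r + b * G.A r := rfl

theorem cA : Continuous F.A := continuous_iff_continuousAt.2 fun r => (F.hA r).continuousAt
theorem cA' : Continuous F.A' := continuous_iff_continuousAt.2 fun r => (F.hA' r).continuousAt
theorem cB : Continuous F.B := continuous_iff_continuousAt.2 fun r => (F.hB r).continuousAt
theorem cB' : Continuous F.B' := continuous_iff_continuousAt.2 fun r => (F.hB' r).continuousAt

theorem hasDerivAt_log_cast {r : ℝ} (hr : r ≠ 0) :
    HasDerivAt (fun r : ℝ => ((Real.log r : ℝ) : ℂ)) ((r : ℂ)⁻¹) r := by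
  simpa using (Real.hasDerivAt_log hr).ofReal_comp

theorem hasDerivAt_inv_cast {r : ℝ} (hr : r ≠ 0) :
    HasDerivAt (fun r : ℝ => ((r : ℂ))⁻¹) (-((r : ℂ) ^ 2)⁻¹) r := by
  simpa using (hasDerivAt_inv hr).ofReal_comp

theorem hasDerivAt_val {r : ℝ} (hr : r ≠ 0) : HasDerivAt F.val (F.d1 r) r :=
  ((F.hA r).mul (hasDerivAt_log_cast hr)).add (F.hB r)

theorem hasDerivAt_d1 {r : ℝ} (hr : r ≠ 0) : HasDerivAt F.d1 (F.d2 r) r := by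
  refine ((((F.hA' r).mul (hasDerivAt_log_cast hr)).add
    ((F.hA r).mul (hasDerivAt_inv_cast hr))).add (F.hB' r)).congr_deriv ?_
  simp only [d2]; ring

theorem continuousOn_d2 : ContinuousOn F.d2 {0}ᶜ := by
  have h1 : ContinuousOn (fun r : ℝ => ((Real.log r : ℝ) : ℂ)) {0}ᶜ :=
    fun r hr => (hasDerivAt_log_cast hr).continuousAt.continuousWithinAt
  have h2 : ContinuousOn (fun r : ℝ => ((r : ℂ))⁻¹) {0}ᶜ :=
    fun r hr => (hasDerivAt_inv_cast hr).continuousAt.continuousWithinAt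
  have h3 : ContinuousOn (fun r : ℝ => (((r : ℂ)) ^ 2)⁻¹) {0}ᶜ := by
    exact (h2.pow 2).congr fun r _ => by simp
  have := F.hA''.continuousOn (s := {0}ᶜ)
  have := F.cA'.continuousOn (s := {0}ᶜ)
  have := F.cA.continuousOn (s := {0}ᶜ)
  have := F.hB''.continuousOn (s := {0}ᶜ)
  unfold d2
  fun_prop

theorem continuousOn_val : ContinuousOn F.val {0}ᶜ :=
  fun _ hr => (F.hasDerivAt_val hr).continuousAt.continuousWithinAt

theorem continuousOn_d1 : ContinuousOn F.d1 {0}ᶜ :=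
  fun _ hr => (F.hasDerivAt_d1 hr).continuousAt.continuousWithinAt

end LogProfile

/-- The profile of the Helmholtz fundamental solution `γ_k`. -/
def helmProfile (k : ℂ) : LogProfile :=
  let a := besselCoeff k
  let b := harmCoeff k
  let ha := expBound_besselCoeff k
  let hb := expBound_harmCoeff k
  -- The constants come from `(i/4)(J₀ + iY₀)` with `log(k√ρ/2) = ½ log ρ + log(k/2)`; the half
  -- logarithm produces the factor `-1/(4π)` in `A`.
  let c₀ : ℂ := Complex.I / 4
    - (Complex.log (k / 2) + (Real.eulerMascheroniConstant : ℂ)) / (2 * (Real.pi : ℂ))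
  let c₁ : ℂ := 1 / (2 * (Real.pi : ℂ))
  { A := fun r => -(1 / (4 * (Real.pi : ℂ))) * powSeries a r
    A' := fun r => -(1 / (4 * (Real.pi : ℂ))) * powSeries (shiftCoeff a) r
    A'' := fun r => -(1 / (4 * (Real.pi : ℂ))) * powSeries (shiftCoeff (shiftCoeff a)) r
    B := fun r => c₀ * powSeries a r + c₁ * powSeries b r
    B' := fun r => c₀ * powSeries (shiftCoeff a) r + c₁ * powSeries (shiftCoeff b) r
    B'' := fun r => c₀ * powSeries (shiftCoeff (shiftCoeff a)) r
      + c₁ * powSeries (shiftCoeff (shiftCoeff b)) r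
    hA := fun r => (ha.hasDerivAt_real r).const_mul _
    hA' := fun r => (ha.shift.hasDerivAt_real r).const_mul _
    hA'' := continuous_iff_continuousAt.2 fun r =>
      ((ha.shift.shift.hasDerivAt_real r).const_mul _).continuousAt
    hB := fun r => ((ha.hasDerivAt_real r).const_mul _).add ((hb.hasDerivAt_real r).const_mul _)
    hB' := fun r => ((ha.shift.hasDerivAt_real r).const_mul _).add
      ((hb.shift.hasDerivAt_real r).const_mul _)
    hB'' := continuous_iff_continuousAt.2 fun r =>
      (((ha.shift.shift.hasDerivAt_real r).const_mul _).add
        ((hb.shift.shift.hasDerivAt_real r).const_mul _)).continuousAt }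

/-- The strength of the singularity is the same for all wave numbers, which is the source of every
cancellation below. -/
theorem helmProfile_A_zero (k : ℂ) : (helmProfile k).A 0 = -(1 / (4 * (Real.pi : ℂ))) := by
  simp [helmProfile, powSeries_zero, besselCoeff]

/-- The Helmholtz equation for the profile. -/
theorem helmProfile_ode (k : ℂ) {r : ℝ} (hr : r ≠ 0) :
    4 * (r : ℂ) * (helmProfile k).d2 r + 4 * (helmProfile k).d1 r
      = -k ^ 2 * (helmProfile k).val r := by
  have h1 := powSeries_bessel k r
  have h2 := powSeries_harm k r
  have hr' : (r : ℂ) ≠ 0 := by exact_mod_cast hr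
  have hpi : (Real.pi : ℂ) ≠ 0 := by exact_mod_cast Real.pi_ne_zero
  simp only [helmProfile, LogProfile.d2, LogProfile.d1, LogProfile.val]
  generalize Complex.log (k / 2) = l
  generalize (Real.eulerMascheroniConstant : ℂ) = e
  generalize ((Real.log r : ℝ) : ℂ) = lg
  generalize powSeries (shiftCoeff (shiftCoeff (besselCoeff k))) r = a2 at *
  generalize powSeries (shiftCoeff (shiftCoeff (harmCoeff k))) r = b2 at *
  generalize powSeries ((shiftCoeff (besselCoeff k))) r = a1 at *
  generalize powSeries ((shiftCoeff (harmCoeff k))) r = b1 at *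
  generalize powSeries (((besselCoeff k))) r = a0 at *
  generalize powSeries (((harmCoeff k))) r = b0 at *
  generalize (Real.pi : ℂ) = p at *
  field_simp
  -- `h1` serves both the coefficient of the logarithm and the `J₀` part of `B`; the forcing in `h2`
  -- cancels the `8 A'` left over from differentiating the logarithm.
  linear_combination (-8 * lg + 8 * Complex.I * p - 16 * (l + e)) * (r : ℂ) * h1 + 16 * (r : ℂ) * h2

theorem helmholtz_eq_profile {k : ℂ} (hk : k ≠ 0) {x y : Plane} (hxy : x ≠ y) :
    helmholtz k x y = (helmProfile k).val (‖x - y‖ ^ 2) := by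
  have hr : 0 < ‖x - y‖ := norm_pos_iff.2 (sub_ne_zero.2 hxy)
  set r := ‖x - y‖
  have hpi : (Real.pi : ℂ) ≠ 0 := by exact_mod_cast Real.pi_ne_zero
  have hz : ∀ m : ℕ, ((k * (r : ℂ)) ^ 2 / 4) ^ m = (k ^ 2 / 4) ^ m * ((r ^ 2 : ℝ) : ℂ) ^ m := by
    intro m; rw [← mul_pow]; congr 1; push_cast; ring
  have hJ : besselJ0 (k * (r : ℂ)) = powSeries (besselCoeff k) ((r ^ 2 : ℝ) : ℂ) := by
    rw [besselJ0, powSeries]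
    refine tsum_congr fun m => ?_
    rw [hz, besselCoeff]; ring
  have hH : (∑' m : ℕ, (-1) ^ m * ((harmonic m : ℚ) : ℂ) * ((k * (r : ℂ)) ^ 2 / 4) ^ m
          / ((m.factorial : ℂ) ^ 2)) = powSeries (harmCoeff k) ((r ^ 2 : ℝ) : ℂ) := by
    rw [powSeries]
    refine tsum_congr fun m => ?_
    rw [hz, harmCoeff, besselCoeff]; ring
  have hlog : Complex.log (k * (r : ℂ) / 2) = (Real.log r : ℂ) + Complex.log (k / 2) := by
    -- Multiplying by a positive real does not cross the branch cut, so the logarithm splits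
    -- exactly; `k ≠ 0` is needed here.
    rw [show k * (r : ℂ) / 2 = (r : ℂ) * (k / 2) by ring,
      Complex.log_ofReal_mul hr (div_ne_zero hk two_ne_zero)]
  have hlog2 : Real.log (r ^ 2) = 2 * Real.log r := by rw [Real.log_pow]; norm_num
  rw [helmholtz, hankel0, besselY0, hJ, hH, hlog, LogProfile.val, hlog2]
  simp only [helmProfile]
  push_cast
  field_simp
  linear_combination (4 * ((Real.log r : ℂ) + Complex.log (k / 2) + (Real.eulerMascheroniConstant : ℂ)) * powSeries (besselCoeff k) ((r : ℂ) ^ 2) - 4 * powSeries (harmCoeff k) ((r : ℂ) ^ 2)) * Complex.I_sq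

end Poro

namespace Poro

/-! ### Bounds for logarithmic profiles -/

/-- The variable is a squared distance, so `r^(-1/4)` stands for `|x-y|^(-1/2)`, an integrable
majorant of the logarithm. One constant serves all four estimates. -/
theorem exists_log_bound (R : ℝ) : ∃ L : ℝ, 0 < L ∧ ∀ r : ℝ, 0 < r → r ≤ R →
    1 ≤ L * r ^ (-(1 / 4) : ℝ) ∧ |Real.log r| ≤ L * r ^ (-(1 / 4) : ℝ) ∧
      r * r ^ (-(1 / 4) : ℝ) ≤ L ∧ r ≤ L := by
  rcases le_or_gt R 0 with hR | hR
  · exact ⟨1, one_pos, fun r h1 h2 => absurd h1 (by linarith)⟩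
  refine ⟨R + R ^ (1 / 4 : ℝ) + R ^ (3 / 4 : ℝ) + 4 * (R ^ (1 / 2 : ℝ) + 1), by positivity,
    fun r h0 h1 => ?_⟩
  have e1 : r ^ (1 / 4 : ℝ) * r ^ (-(1 / 4) : ℝ) = 1 := by
    rw [← Real.rpow_add h0]; norm_num
  have e2 : r * r ^ (-(1 / 4) : ℝ) = r ^ (3 / 4 : ℝ) := by
    nth_rewrite 1 [← Real.rpow_one r]
    rw [← Real.rpow_add h0]; norm_num
  have e3 : r ^ (1 / 4 : ℝ) = r ^ (1 / 2 : ℝ) * r ^ (-(1 / 4) : ℝ) := by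
    rw [← Real.rpow_add h0]; norm_num
  have i1 : r ^ (1 / 4 : ℝ) ≤ R ^ (1 / 4 : ℝ) := Real.rpow_le_rpow h0.le h1 (by norm_num)
  have i2 : r ^ (3 / 4 : ℝ) ≤ R ^ (3 / 4 : ℝ) := Real.rpow_le_rpow h0.le h1 (by norm_num)
  have i3 : r ^ (1 / 2 : ℝ) ≤ R ^ (1 / 2 : ℝ) := Real.rpow_le_rpow h0.le h1 (by norm_num)
  have w0 : 0 < r ^ (-(1 / 4) : ℝ) := by positivity
  have p1 : 0 ≤ R ^ (1 / 4 : ℝ) := by positivity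
  have p2 : 0 ≤ R ^ (3 / 4 : ℝ) := by positivity
  have p3 : 0 ≤ R ^ (1 / 2 : ℝ) := by positivity
  have l1 : Real.log r ≤ 4 * r ^ (1 / 4 : ℝ) := by
    have := Real.log_le_rpow_div h0.le (show (0 : ℝ) < 1 / 4 by norm_num)
    linarith
  have l2 : -Real.log r ≤ 4 * r ^ (-(1 / 4) : ℝ) := by
    have := Real.log_le_rpow_div (inv_nonneg.2 h0.le) (show (0 : ℝ) < 1 / 4 by norm_num)
    rw [Real.log_inv, Real.inv_rpow h0.le, ← Real.rpow_neg h0.le] at this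
    linarith
  generalize r ^ (-(1 / 4) : ℝ) = w at *
  refine ⟨?_, ?_, ?_, ?_⟩
  · refine e1.symm.le.trans ?_
    apply mul_le_mul_of_nonneg_right _ w0.le
    linarith
  · have : r ^ (1 / 4 : ℝ) ≤ R ^ (1 / 2 : ℝ) * w := by
      rw [e3]; exact mul_le_mul_of_nonneg_right i3 w0.le
    have q1 : 0 ≤ R * w := by positivity
    have q2 : 0 ≤ R ^ (1 / 4 : ℝ) * w := by positivity
    have q3 : 0 ≤ R ^ (3 / 4 : ℝ) * w := by positivity
    have q4 : 0 ≤ R ^ (1 / 2 : ℝ) * w := by positivity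
    rw [abs_le]; constructor <;> nlinarith
  · rw [e2]; linarith
  · linarith

theorem exists_norm_le_Icc {f : ℝ → ℂ} (hf : Continuous f) (R : ℝ) :
    ∃ M : ℝ, 0 ≤ M ∧ ∀ r ∈ Set.Icc 0 R, ‖f r‖ ≤ M := by
  obtain ⟨M, hM⟩ := isCompact_Icc.exists_bound_of_continuousOn (s := Set.Icc 0 R) hf.continuousOn
  exact ⟨max M 0, le_max_right _ _, fun r hr => (hM r hr).trans (le_max_left _ _)⟩

namespace LogProfile

variable (F : LogProfile)

theorem exists_coeff_bound (R : ℝ) : ∃ M : ℝ, 0 ≤ M ∧ ∀ r ∈ Set.Icc 0 R,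
    ‖F.A r‖ ≤ M ∧ ‖F.A' r‖ ≤ M ∧ ‖F.A'' r‖ ≤ M ∧ ‖F.B r‖ ≤ M ∧ ‖F.B' r‖ ≤ M ∧ ‖F.B'' r‖ ≤ M ∧
      ‖F.A r - F.A 0‖ ≤ M * r := by
  obtain ⟨M1, p1, h1⟩ := exists_norm_le_Icc F.cA R
  obtain ⟨M2, p2, h2⟩ := exists_norm_le_Icc F.cA' R
  obtain ⟨M3, p3, h3⟩ := exists_norm_le_Icc F.hA'' R
  obtain ⟨M4, p4, h4⟩ := exists_norm_le_Icc F.cB R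
  obtain ⟨M5, p5, h5⟩ := exists_norm_le_Icc F.cB' R
  obtain ⟨M6, p6, h6⟩ := exists_norm_le_Icc F.hB'' R
  refine ⟨M1 + M2 + M3 + M4 + M5 + M6, by positivity, fun r hr => ?_⟩
  have a1 := h1 r hr
  have a2 := h2 r hr
  have a3 := h3 r hr
  have a4 := h4 r hr
  have a5 := h5 r hr
  have a6 := h6 r hr
  refine ⟨by linarith, by linarith, by linarith, by linarith, by linarith, by linarith, ?_⟩
  have := (convex_Icc (0 : ℝ) R).norm_image_sub_le_of_norm_hasDerivWithin_le (f := F.A)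
    (fun x _ => (F.hA x).hasDerivWithinAt) h2 (Set.left_mem_Icc.2 (hr.1.trans hr.2)) hr
  rw [sub_zero, Real.norm_of_nonneg hr.1] at this
  exact this.trans (mul_le_mul_of_nonneg_right (by linarith) hr.1)

theorem norm_log_cast (r : ℝ) : ‖((Real.log r : ℝ) : ℂ)‖ = |Real.log r| := by
  rw [Complex.norm_real, Real.norm_eq_abs]

theorem norm_inv_cast {r : ℝ} (hr : 0 < r) : ‖((r : ℂ))⁻¹‖ = r⁻¹ := by
  rw [norm_inv, Complex.norm_real, Real.norm_of_nonneg hr.le]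

/-- Growth of a profile and of its derivatives at the singularity. -/
theorem exists_bound (R : ℝ) : ∃ C : ℝ, 0 ≤ C ∧ ∀ r : ℝ, 0 < r → r ≤ R →
    ‖F.val r‖ ≤ C * r ^ (-(1 / 4) : ℝ) ∧ ‖F.d1 r‖ ≤ C / r ∧ ‖F.d2 r‖ ≤ C / r ^ 2 ∧
      ‖(r : ℂ) * F.d1 r - F.A 0‖ ≤ C * (r * r ^ (-(1 / 4) : ℝ)) := by
  obtain ⟨L, L0, hL⟩ := exists_log_bound R
  obtain ⟨M, M0, hM⟩ := F.exists_coeff_bound R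
  refine ⟨M * L * (2 + L) + M * (1 + L) + M * L * L * L + 3 * M + M * L * L, by positivity, fun r h0 h1 => ?_⟩
  obtain ⟨l1, l2, l3, l4⟩ := hL r h0 h1
  obtain ⟨a, a', a'', b, b', b'', a0⟩ := hM r ⟨h0.le, h1⟩
  have w0 : 0 < r ^ (-(1 / 4) : ℝ) := by positivity
  generalize r ^ (-(1 / 4) : ℝ) = w at *
  have hr : (r : ℂ) ≠ 0 := by exact_mod_cast h0.ne'
  have nr : ‖(r : ℂ)‖ = r := by rw [Complex.norm_real, Real.norm_of_nonneg h0.le]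
  have q1 : 0 ≤ M * L * (2 + L) := by positivity
  have q2 : 0 ≤ M * (1 + L) := by positivity
  have q3 : 0 ≤ M * L * L * L := by positivity
  have q4 : 0 ≤ M * L * L := by positivity
  refine ⟨?_, ?_, ?_, ?_⟩
  · have : ‖F.val r‖ ≤ M * (L * w) + M * (L * w) := by
      refine (norm_add_le _ _).trans (add_le_add ?_ (b.trans (le_mul_of_one_le_right M0 l1)))
      rw [norm_mul, norm_log_cast]
      gcongr
    refine this.trans ?_
    rw [show M * (L * w) + M * (L * w) = (2 * (M * L)) * w by ring]
    gcongr
    nlinarith [mul_nonneg (mul_nonneg M0 L0.le) L0.le]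
  · rw [le_div_iff₀ h0, ← nr, ← norm_mul, nr]
    have e : F.d1 r * r = F.A' r * ((r : ℂ) * Real.log r) + F.A r + r * F.B' r := by
      rw [d1]; field_simp
    rw [e]
    have : ‖F.A' r * ((r : ℂ) * Real.log r) + F.A r + r * F.B' r‖ ≤ M * (L * L) + M + L * M := by
      refine (norm_add₃_le).trans (add_le_add (add_le_add ?_ a) ?_)
      · rw [norm_mul, norm_mul, nr, norm_log_cast]
        refine mul_le_mul a' ?_ (by positivity) M0
        calc r * |Real.log r| ≤ r * (L * w) := by gcongr
          _ = L * (r * w) := by ring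
          _ ≤ _ := by gcongr
      · rw [norm_mul, nr]; gcongr
    nlinarith
  · rw [le_div_iff₀ (by positivity)]
    have e : F.d2 r * (r : ℂ) ^ 2 = F.A'' r * ((r : ℂ) * r * Real.log r) + 2 * F.A' r * r
        + (- F.A r) + r * r * F.B'' r := by
      rw [d2]; field_simp; ring
    have e2 : ‖F.d2 r‖ * r ^ 2 = ‖F.d2 r * (r : ℂ) ^ 2‖ := by rw [norm_mul, norm_pow, nr]
    rw [e2, e]
    have : ‖F.A'' r * ((r : ℂ) * r * Real.log r) + 2 * F.A' r * r
        + (- F.A r) + r * r * F.B'' r‖ ≤ M * (L * L * L) + 2 * M * L + M + L * L * M := by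
      refine (norm_add₄_le).trans (add_le_add (add_le_add (add_le_add ?_ ?_) ?_) ?_)
      · rw [norm_mul, norm_mul, norm_mul, nr, norm_log_cast]
        refine mul_le_mul a'' ?_ (by positivity) M0
        calc r * r * |Real.log r| ≤ r * r * (L * w) := by gcongr
          _ = L * r * (r * w) := by ring
          _ ≤ L * L * L := by gcongr
      · rw [norm_mul, norm_mul, nr]
        simp only [Complex.norm_ofNat]
        gcongr
      · rwa [norm_neg]
      · rw [norm_mul, norm_mul, nr]; gcongr
    nlinarith
  · have e : (r : ℂ) * F.d1 r - F.A 0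
        = F.A' r * ((r : ℂ) * Real.log r) + (F.A r - F.A 0) + r * F.B' r := by
      rw [d1]; field_simp; ring
    rw [e]
    have hr1 : r ≤ r * w * L := by nlinarith
    have : ‖F.A' r * ((r : ℂ) * Real.log r) + (F.A r - F.A 0) + r * F.B' r‖
        ≤ M * (L * (r * w)) + M * (r * w * L) + r * w * L * M := by
      refine (norm_add₃_le).trans (add_le_add (add_le_add ?_ ?_) ?_)
      · rw [norm_mul, norm_mul, nr, norm_log_cast]
        refine mul_le_mul a' ?_ (by positivity) M0
        calc r * |Real.log r| ≤ r * (L * w) := by gcongr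
          _ = L * (r * w) := by ring
      · exact a0.trans (by gcongr)
      · rw [norm_mul, nr]; gcongr
    refine this.trans ?_
    rw [show M * (L * (r * w)) + M * (r * w * L) + r * w * L * M = (3 * (M * L)) * (r * w) by ring]
    gcongr
    nlinarith

/-- Growth of a profile without leading singularity. -/
theorem exists_bound_of_zero (hF : F.A 0 = 0) (R : ℝ) : ∃ C : ℝ, 0 ≤ C ∧ ∀ r : ℝ, 0 < r → r ≤ R →
    ‖F.d1 r‖ ≤ C * r ^ (-(1 / 4) : ℝ) ∧ r * ‖F.d2 r‖ ≤ C * r ^ (-(1 / 4) : ℝ) := by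
  obtain ⟨L, L0, hL⟩ := exists_log_bound R
  obtain ⟨M, M0, hM⟩ := F.exists_coeff_bound R
  refine ⟨6 * (M * L) + M * L * L * 2, by positivity, fun r h0 h1 => ?_⟩
  obtain ⟨l1, l2, l3, l4⟩ := hL r h0 h1
  obtain ⟨a, a', a'', b, b', b'', a0⟩ := hM r ⟨h0.le, h1⟩
  rw [hF, sub_zero] at a0
  have w0 : 0 < r ^ (-(1 / 4) : ℝ) := by positivity
  generalize r ^ (-(1 / 4) : ℝ) = w at *
  have hr : (r : ℂ) ≠ 0 := by exact_mod_cast h0.ne'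
  have nr : ‖(r : ℂ)‖ = r := by rw [Complex.norm_real, Real.norm_of_nonneg h0.le]
  have hM1 : M ≤ M * (L * w) := le_mul_of_one_le_right M0 l1
  have q1 : 0 ≤ M * L * w := by positivity
  have q2 : 0 ≤ M * L * L * w := by positivity
  constructor
  · have : ‖F.d1 r‖ ≤ M * (L * w) + M + M := by
      refine (norm_add₃_le).trans (add_le_add (add_le_add ?_ ?_) b')
      · rw [norm_mul, norm_log_cast]; gcongr
      · rw [norm_mul, norm_inv_cast h0, ← div_eq_mul_inv, div_le_iff₀ h0]; exact a0
    nlinarith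
  · have e : (r : ℂ) * F.d2 r = F.A'' r * (r * Real.log r) + 2 * F.A' r
        + (- (F.A r * (r : ℂ)⁻¹)) + r * F.B'' r := by
      rw [d2]; field_simp; ring
    have e2 : r * ‖F.d2 r‖ = ‖(r : ℂ) * F.d2 r‖ := by rw [norm_mul, nr]
    rw [e2, e]
    have : ‖F.A'' r * (r * Real.log r) + 2 * F.A' r + (- (F.A r * (r : ℂ)⁻¹)) + r * F.B'' r‖
        ≤ M * (L * (L * w)) + 2 * M + M + L * M := by
      refine (norm_add₄_le).trans (add_le_add (add_le_add (add_le_add ?_ ?_) ?_) ?_)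
      · rw [norm_mul, norm_mul, nr, norm_log_cast]; gcongr
      · rw [norm_mul]; simp only [Complex.norm_ofNat]; gcongr
      · rw [norm_neg, norm_mul, norm_inv_cast h0, ← div_eq_mul_inv, div_le_iff₀ h0]; exact a0
      · rw [norm_mul, nr]; gcongr
    have : L * M ≤ L * (M * (L * w)) := by gcongr
    nlinarith

/-- A profile without leading singularity is continuous up to the singularity. -/
theorem continuousAt_val_zero (hF : F.A 0 = 0) : ContinuousOn F.val (Set.Ici 0) := by
  intro x hx
  rcases eq_or_lt_of_le (show (0 : ℝ) ≤ x from hx) with rfl | hx0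
  · obtain ⟨M, M0, hM⟩ := F.exists_coeff_bound 1
    refine ContinuousWithinAt.add ?_ F.cB.continuousWithinAt
    have h1 : Tendsto (fun r : ℝ => M * |r * Real.log r|) (𝓝[≥] 0) (𝓝 0) := by
      have hc : Continuous fun r : ℝ => M * |r * Real.log r| :=
        continuous_const.mul Real.continuous_mul_log.abs
      have := hc.tendsto 0
      simp only [zero_mul, abs_zero, mul_zero] at this
      exact this.mono_left nhdsWithin_le_nhds
    -- `|A(r)| ≤ M r` beats the logarithm, since `r log r` tends to `0`.
    have h2 : Tendsto (fun r : ℝ => F.A r * Real.log r) (𝓝[≥] 0) (𝓝 0) := by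
      refine squeeze_zero_norm' ?_ h1
      filter_upwards [Icc_mem_nhdsGE (show (0 : ℝ) < 1 by norm_num)] with r hr
      have := (hM r hr).2.2.2.2.2.2
      rw [hF, sub_zero] at this
      rw [norm_mul, norm_log_cast, abs_mul, abs_of_nonneg hr.1, ← mul_assoc]
      gcongr
    simpa [ContinuousWithinAt] using h2
  · exact (F.hasDerivAt_val hx0.ne').continuousAt.continuousWithinAt

end LogProfile

end Poro

namespace Poro

/-! ### Derivatives of radial functions in the plane -/

theorem pd_eq {f : Plane → ℂ} {x : Plane} {L : Plane →L[ℝ] ℂ} (h : HasFDerivAt f L x) (j : Fin 2) :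
    pd j f x = L (EuclideanSpace.single j 1) := by
  rw [pd, h.fderiv]

theorem pd_congr {f g : Plane → ℂ} {x : Plane} (h : f =ᶠ[𝓝 x] g) (j : Fin 2) :
    pd j f x = pd j g x := by
  rw [pd, pd, h.fderiv_eq]

theorem hasFDerivAt_radial {φ : ℝ → ℂ} {φ' : ℂ} {x y : Plane}
    (h : HasDerivAt φ φ' (‖x - y‖ ^ 2)) :
    HasFDerivAt (fun z => φ (‖z - y‖ ^ 2))
      ((ContinuousLinearMap.toSpanSingleton ℝ φ').comp (2 • (innerSL ℝ (x - y)))) x := by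
  have h1 : HasFDerivAt (fun z : Plane => ‖z - y‖ ^ 2) (2 • (innerSL ℝ (x - y))) x := by
    simpa using ((hasFDerivAt_id x).sub_const y).norm_sq
  exact h.hasFDerivAt.comp x h1

theorem pd_radial {φ : ℝ → ℂ} {φ' : ℂ} {x y : Plane} (h : HasDerivAt φ φ' (‖x - y‖ ^ 2))
    (j : Fin 2) : pd j (fun z => φ (‖z - y‖ ^ 2)) x = 2 * φ' * ((x - y) j : ℂ) := by
  rw [pd_eq (hasFDerivAt_radial h)]
  simp [EuclideanSpace.inner_single_right]
  ring

theorem hasFDerivAt_coord (i : Fin 2) (x y : Plane) :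
    HasFDerivAt (fun z : Plane => (((z - y) i : ℝ) : ℂ))
      (Complex.ofRealCLM.comp (EuclideanSpace.proj i : Plane →L[ℝ] ℝ)) x := by
  have h := Complex.ofRealCLM.hasFDerivAt (x := (x - y) i)
  have h2 : HasFDerivAt (fun z : Plane => (z - y) i) (EuclideanSpace.proj i : Plane →L[ℝ] ℝ) x := by
    exact (EuclideanSpace.proj i : Plane →L[ℝ] ℝ).hasFDerivAt.comp x
      ((hasFDerivAt_id x).sub_const y)
  exact h.comp x h2

theorem hasFDerivAt_radial_coord {φ : ℝ → ℂ} {φ' : ℂ} {x y : Plane}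
    (h : HasDerivAt φ φ' (‖x - y‖ ^ 2)) (i : Fin 2) :
    DifferentiableAt ℝ (fun z => 2 * φ (‖z - y‖ ^ 2) * (((z - y) i : ℝ) : ℂ)) x ∧ ∀ j,
    pd j (fun z => 2 * φ (‖z - y‖ ^ 2) * (((z - y) i : ℝ) : ℂ)) x
      = 4 * φ' * ((x - y) i : ℂ) * ((x - y) j : ℂ)
        + 2 * φ (‖x - y‖ ^ 2) * (1 : Matrix (Fin 2) (Fin 2) ℂ) i j := by
  have h1 := ((hasFDerivAt_radial h).const_mul (2 : ℂ)).fun_mul (hasFDerivAt_coord i x y)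
  refine ⟨h1.differentiableAt, fun j => ?_⟩
  rw [pd_eq h1]
  simp [EuclideanSpace.inner_single_right, Matrix.one_apply]
  by_cases hij : i = j
  · simp [hij]; ring
  · simp [hij]; ring

theorem pd_const_mul {f : Plane → ℂ} {x : Plane} (hf : DifferentiableAt ℝ f x) (a : ℂ)
    (j : Fin 2) : pd j (fun z => a * f z) x = a * pd j f x := by
  rw [pd_eq (hf.hasFDerivAt.const_mul a)]; simp [pd]

theorem pd_add {f g : Plane → ℂ} {x : Plane} (hf : DifferentiableAt ℝ f x)
    (hg : DifferentiableAt ℝ g x) (j : Fin 2) :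
    pd j (fun z => f z + g z) x = pd j f x + pd j g x := by
  rw [pd_eq (hf.hasFDerivAt.fun_add hg.hasFDerivAt)]; simp [pd]

namespace LogProfile

variable (F : LogProfile)

/-- The Hessian of `F(|d|²)`. -/
def hess (d : Plane) (i j : Fin 2) : ℂ :=
  4 * F.d2 (‖d‖ ^ 2) * (d i : ℂ) * (d j : ℂ)
    + 2 * F.d1 (‖d‖ ^ 2) * (1 : Matrix (Fin 2) (Fin 2) ℂ) i j

theorem hess_neg (d : Plane) (i j : Fin 2) : F.hess (-d) i j = F.hess d i j := by
  simp [hess]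

theorem hess_comm (d : Plane) (i j : Fin 2) : F.hess d i j = F.hess d j i := by
  simp only [hess, Matrix.one_apply, eq_comm (a := i)]; ring

theorem sq_ne {x y : Plane} (h : x ≠ y) : ‖x - y‖ ^ 2 ≠ 0 :=
  pow_ne_zero 2 (norm_ne_zero_iff.2 (sub_ne_zero.2 h))

theorem pd_val {x y : Plane} (h : x ≠ y) (j : Fin 2) :
    pd j (fun z => F.val (‖z - y‖ ^ 2)) x = 2 * F.d1 (‖x - y‖ ^ 2) * ((x - y) j : ℂ) :=
  pd_radial (F.hasDerivAt_val (sq_ne h)) j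

theorem differentiableAt_val {x y : Plane} (h : x ≠ y) :
    DifferentiableAt ℝ (fun z => F.val (‖z - y‖ ^ 2)) x :=
  (hasFDerivAt_radial (F.hasDerivAt_val (sq_ne h))).differentiableAt

theorem differentiableAt_grad {x y : Plane} (h : x ≠ y) (i : Fin 2) :
    DifferentiableAt ℝ (fun z => 2 * F.d1 (‖z - y‖ ^ 2) * (((z - y) i : ℝ) : ℂ)) x :=
  (hasFDerivAt_radial_coord (F.hasDerivAt_d1 (sq_ne h)) i).1

theorem pd_grad {x y : Plane} (h : x ≠ y) (i j : Fin 2) :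
    pd j (fun z => 2 * F.d1 (‖z - y‖ ^ 2) * (((z - y) i : ℝ) : ℂ)) x = F.hess (x - y) i j :=
  (hasFDerivAt_radial_coord (F.hasDerivAt_d1 (sq_ne h)) i).2 j

theorem eventually_ne {x y : Plane} (h : x ≠ y) : ∀ᶠ z in 𝓝 x, z ≠ y :=
  isOpen_ne.mem_nhds h

/-- First derivatives of a function which agrees with a profile off the diagonal. -/
theorem pd_of_eq {f : Plane → ℂ} {x y : Plane} (h : x ≠ y)
    (hf : ∀ z, z ≠ y → f z = F.val (‖z - y‖ ^ 2)) (j : Fin 2) :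
    pd j f x = 2 * F.d1 (‖x - y‖ ^ 2) * ((x - y) j : ℂ) := by
  rw [← F.pd_val h j]
  exact pd_congr ((eventually_ne h).mono hf) j

/-- Second derivatives of a function which agrees with a profile off the diagonal. -/
theorem pd_pd_of_eq {f : Plane → ℂ} {x y : Plane} (h : x ≠ y)
    (hf : ∀ z, z ≠ y → f z = F.val (‖z - y‖ ^ 2)) (i j : Fin 2) :
    pd i (pd j f) x = F.hess (x - y) i j := by
  rw [hess_comm, ← F.pd_grad h j i]
  exact pd_congr ((eventually_ne h).mono fun z hz => F.pd_of_eq hz hf j) i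

end LogProfile

/-! ### Nonvanishing of the material constants. -/

namespace Medium

variable (P : Medium)

theorem beta_den_ne : Complex.I * (P.phi : ℂ) ^ 2 + P.omega * P.kappa * (P.rho_a + P.phi * P.rho_f)
    ≠ 0 := by
  intro h
  have := congrArg Complex.im h
  simp [← Complex.ofReal_pow, ← Complex.ofReal_mul, ← Complex.ofReal_add] at this
  exact P.phi_pos.ne' this

theorem beta_ne : P.beta ≠ 0 := by
  refine div_ne_zero ?_ P.beta_den_ne
  have := P.omega_pos.ne'
  have := P.phi_pos.ne'
  have := P.rho_f_pos.ne'
  have := P.kappa_pos.ne'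
  simp [*]

/-- The numerator of `β` is real and its denominator has imaginary part `φ² ≠ 0`, so a real `β`
would satisfy `β φ² = 0`. This is what makes `ρ - βρ_f`, hence `k_p` and `k_s`, nonzero for every
real `ρ`. -/
theorem beta_im_ne : P.beta.im ≠ 0 := by
  intro h
  have h1 : P.beta = (P.beta.re : ℂ) := Complex.ext (by simp) (by simp [h])
  have h2 : P.beta * (Complex.I * (P.phi : ℂ) ^ 2 + P.omega * P.kappa * (P.rho_a + P.phi * P.rho_f))
      = (P.omega * P.phi ^ 2 * P.rho_f * P.kappa : ℂ) := by
    rw [beta, div_mul_cancel₀ _ P.beta_den_ne]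
  rw [h1] at h2
  have := congrArg Complex.im h2
  simp [← Complex.ofReal_pow, ← Complex.ofReal_mul, ← Complex.ofReal_add] at this
  rcases this with h3 | h3
  · exact P.beta_ne (by rw [h1, h3]; simp)
  · exact P.phi_pos.ne' h3

theorem rhoEff_ne : P.rhoEff ≠ 0 := by
  intro h
  have := congrArg Complex.im h
  simp [rhoEff] at this
  rcases this with h3 | h3
  · exact P.beta_im_ne h3
  · exact P.rho_f_pos.ne' h3

theorem mod_pos : 0 < P.lam + 2 * P.mu := by linarith [P.lam_add_mu_pos, P.mu_pos]

theorem mod_ne : (P.lam : ℂ) + 2 * P.mu ≠ 0 := by exact_mod_cast P.mod_pos.ne'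

theorem omega_ne : (P.omega : ℂ) ≠ 0 := by exact_mod_cast P.omega_pos.ne'
theorem rho_f_ne : (P.rho_f : ℂ) ≠ 0 := by exact_mod_cast P.rho_f_pos.ne'
theorem mu_ne : (P.mu : ℂ) ≠ 0 := by exact_mod_cast P.mu_pos.ne'

theorem ks_ne : P.ks ≠ 0 := by
  refine mul_ne_zero P.omega_ne ?_
  rw [Ne, Complex.cpow_eq_zero_iff]
  exact fun h => div_ne_zero P.rhoEff_ne P.mu_ne h.1

theorem kp_ne : P.kp ≠ 0 := by
  refine mul_ne_zero P.omega_ne ?_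
  rw [Ne, Complex.cpow_eq_zero_iff]
  exact fun h => div_ne_zero P.rhoEff_ne P.mod_ne h.1

theorem R_ne : P.R ≠ 0 := by
  have h1 := P.phi_pos.ne'
  have h2 := P.mu_pos.ne'
  have h3 := P.B_ne
  have h4 : 1 - 2 * P.nu_p ≠ 0 := fun h => P.nu_p_ne_half (by linarith)
  have h5 : 1 + P.nu_u ≠ 0 := fun h => P.nu_u_ne_neg_one (by linarith)
  have h6 : P.nu_u - P.nu_p ≠ 0 := fun h => P.nu_p_ne_nu_u (by linarith)
  have h7 : 1 - 2 * P.nu_u ≠ 0 := fun h => P.nu_u_ne_half (by linarith)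
  unfold R
  positivity

theorem q_ne : P.q ≠ 0 := by
  have h1 : (P.phi : ℂ) ≠ 0 := by exact_mod_cast P.phi_pos.ne'
  have h2 : (P.R : ℂ) ≠ 0 := by exact_mod_cast P.R_ne
  exact div_ne_zero (mul_ne_zero (mul_ne_zero (pow_ne_zero 2 P.omega_ne) (pow_ne_zero 2 h1))
    P.rho_f_ne) (mul_ne_zero P.beta_ne h2)

variable {P} {k₁ k₂ : ℂ}

/-- Needed because the logarithmic profile of `γ_k` involves `log(k/2)` and is valid only for `k ≠
0`. -/
theorem IsWaveNumbers.ne_zero (hk : P.IsWaveNumbers k₁ k₂) : k₁ ≠ 0 ∧ k₂ ≠ 0 := by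
  have h := hk.prod_eq
  have h0 : P.q * P.kp ^ 2 ≠ 0 := mul_ne_zero P.q_ne (pow_ne_zero 2 P.kp_ne)
  rw [← h] at h0
  constructor <;> rintro rfl <;> simp at h0

variable (P k₁ k₂)

/-! ### Profiles of the kernels and the entries of the fundamental solution. -/

/-- The profile of `γ_{k₁} - γ_{k₂}`. -/
def profD (k₁ k₂ : ℂ) : LogProfile := .lin 1 (helmProfile k₁) (-1) (helmProfile k₂)

/-- The profile of `(k_p² - k₁²) γ_{k₁} - (k_p² - k₂²) γ_{k₂}`. -/
def profG : LogProfile :=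
  .lin (P.kp ^ 2 - k₁ ^ 2) (helmProfile k₁) (-(P.kp ^ 2 - k₂ ^ 2)) (helmProfile k₂)

/-- The profile whose Hessian appears in `E₁₁`. -/
def profPhi : LogProfile :=
  .lin 1 (helmProfile P.ks) 1
    (.lin (-((P.kp ^ 2 - k₂ ^ 2) / (k₁ ^ 2 - k₂ ^ 2))) (helmProfile k₁)
      ((P.kp ^ 2 - k₁ ^ 2) / (k₁ ^ 2 - k₂ ^ 2)) (helmProfile k₂))

/-- The coefficient `iβγω C₄ / (λ + 2μ)`. -/
def cD : ℂ := Complex.I * P.beta * P.gam * P.omega / (P.lam + 2 * P.mu) * P.C4 k₁ k₂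

/-- The profile of the kernel of `N₄²`. -/
def prof2 : LogProfile := .lin (P.cD k₁ k₂) (profD k₁ k₂) (-P.C4 k₁ k₂) (P.profG k₁ k₂)

/-- The profile of the hypersingular part of the kernel. -/
def profTot : LogProfile := .lin (2 * P.cD k₁ k₂) (profD k₁ k₂) (-P.C4 k₁ k₂) (P.profG k₁ k₂)

theorem profD_A_zero : (profD k₁ k₂).A 0 = 0 := by
  simp [profD, LogProfile.lin_A, helmProfile_A_zero]

/-- The three coefficients `1`, `-(k_p²-k₂²)/(k₁²-k₂²)` and `(k_p²-k₁²)/(k₁²-k₂²)` sum to zero, so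
the Hessian in `E₁₁` is only logarithmically singular. -/
theorem profPhi_A_zero (hne : k₁ ^ 2 ≠ k₂ ^ 2) : (P.profPhi k₁ k₂).A 0 = 0 := by
  have := sub_ne_zero.2 hne
  simp only [profPhi, LogProfile.lin_A, helmProfile_A_zero]
  field_simp
  ring

variable {k₁ k₂}

theorem profD_val (h1 : k₁ ≠ 0) (h2 : k₂ ≠ 0) {x y : Plane} (h : x ≠ y) :
    helmholtz k₁ x y - helmholtz k₂ x y = (profD k₁ k₂).val (‖x - y‖ ^ 2) := by
  rw [helmholtz_eq_profile h1 h, helmholtz_eq_profile h2 h, profD, LogProfile.lin_val]; ring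

theorem profG_val (h1 : k₁ ≠ 0) (h2 : k₂ ≠ 0) {x y : Plane} (h : x ≠ y) :
    (P.kp ^ 2 - k₁ ^ 2) * helmholtz k₁ x y - (P.kp ^ 2 - k₂ ^ 2) * helmholtz k₂ x y
      = (P.profG k₁ k₂).val (‖x - y‖ ^ 2) := by
  rw [helmholtz_eq_profile h1 h, helmholtz_eq_profile h2 h, profG, LogProfile.lin_val]; ring

theorem profPhi_val (h1 : k₁ ≠ 0) (h2 : k₂ ≠ 0) {x y : Plane} (h : x ≠ y) :
    helmholtz P.ks x y - (P.kp ^ 2 - k₂ ^ 2) / (k₁ ^ 2 - k₂ ^ 2) * helmholtz k₁ x y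
          + (P.kp ^ 2 - k₁ ^ 2) / (k₁ ^ 2 - k₂ ^ 2) * helmholtz k₂ x y
      = (P.profPhi k₁ k₂).val (‖x - y‖ ^ 2) := by
  rw [helmholtz_eq_profile h1 h, helmholtz_eq_profile h2 h, helmholtz_eq_profile P.ks_ne h, profPhi,
    LogProfile.lin_val, LogProfile.lin_val]; ring

theorem E11_eq (h1 : k₁ ≠ 0) (h2 : k₂ ≠ 0) {x y : Plane} (h : x ≠ y) (i j : Fin 2) :
    P.E11 k₁ k₂ x y i j
      = 1 / P.mu * (helmProfile P.ks).val (‖x - y‖ ^ 2) * (1 : Matrix (Fin 2) (Fin 2) ℂ) i j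
        + 1 / (P.rhoEff * P.omega ^ 2) * (P.profPhi k₁ k₂).hess (x - y) i j := by
  rw [E11, helmholtz_eq_profile P.ks_ne h,
    (P.profPhi k₁ k₂).pd_pd_of_eq h (fun z hz => P.profPhi_val h1 h2 hz)]

theorem grad_eq (h1 : k₁ ≠ 0) (h2 : k₂ ≠ 0) {x y : Plane} (h : x ≠ y) (i : Fin 2) :
    grad (fun z => helmholtz k₁ z y - helmholtz k₂ z y) x i
      = 2 * (profD k₁ k₂).d1 (‖x - y‖ ^ 2) * ((x - y) i : ℂ) :=
  (profD k₁ k₂).pd_of_eq h (fun _ hz => profD_val h1 h2 hz) i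

/-- The coefficient `γ / ((λ + 2μ)(k₁² - k₂²))`. -/
def gD (k₁ k₂ : ℂ) : ℂ := P.gam / ((P.lam + 2 * P.mu) * (k₁ ^ 2 - k₂ ^ 2))

/-- The profile in the last entry of `T̃* E`. -/
def profAdj (k₁ k₂ : ℂ) : LogProfile :=
  .lin (-P.beta * (Complex.I * P.omega * P.gD k₁ k₂)) (profD k₁ k₂) (1 / (k₁ ^ 2 - k₂ ^ 2))
    (P.profG k₁ k₂)

/-- `E₁₂` and the `y`-gradient of `E₂₂` are both gradients of radial functions, so the entry is the
derivative in direction `m` of a single profile. The sign of `∂_y` against `∂_x` and the `i² = -1`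
of the coefficients compensate each other. -/
theorem adjE_inr_inr (h1 : k₁ ≠ 0) (h2 : k₂ ≠ 0) (hne : k₁ ^ 2 ≠ k₂ ^ 2) (m : Plane) {x y : Plane} (h : x ≠ y) :
    P.adjE k₁ k₂ m x y (Sum.inr ()) (Sum.inr ())
      = ∑ i, (m i : ℂ) * (2 * (P.profAdj k₁ k₂).d1 (‖x - y‖ ^ 2) * ((x - y) i : ℂ)) := by
  have hE : ∀ j, pd j (fun w => P.E k₁ k₂ x w (Sum.inr ()) (Sum.inr ())) y
      = Complex.I * P.rho_f * P.omega / (P.beta * (k₁ ^ 2 - k₂ ^ 2))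
        * (2 * (P.profG k₁ k₂).d1 (‖y - x‖ ^ 2) * ((y - x) j : ℂ)) := by
    intro j
    rw [← LogProfile.pd_val _ h.symm, ← pd_const_mul (LogProfile.differentiableAt_val _ h.symm)]
    refine pd_congr ((LogProfile.eventually_ne h.symm).mono fun w hw => ?_) j
    change P.E22 k₁ k₂ x w = _
    rw [E22, P.profG_val h1 h2 hw.symm, norm_sub_rev]
  have hE12 : ∀ i, P.E k₁ k₂ x y (Sum.inl i) (Sum.inr ()) = Complex.I * P.omega * P.gD k₁ k₂ *
      (2 * (profD k₁ k₂).d1 (‖x - y‖ ^ 2) * ((x - y) i : ℂ)) := by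
    intro i
    change P.E12 k₁ k₂ x y i = _
    rw [E12, grad_eq h1 h2 h, gD]; ring
  simp only [adjE, neumannAdj, Sum.elim_inr, dn, hE, hE12, Fin.sum_univ_two, profAdj,
    LogProfile.lin_d1, norm_sub_rev y x, PiLp.sub_apply]
  push_cast
  have := P.omega_ne
  have := P.rho_f_ne
  have := P.beta_ne
  have := sub_ne_zero.2 hne
  have hI : Complex.I * P.beta / (P.omega * P.rho_f) * (Complex.I * P.rho_f * P.omega
      / (P.beta * (k₁ ^ 2 - k₂ ^ 2))) = - (1 / (k₁ ^ 2 - k₂ ^ 2)) := by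
    field_simp
    linear_combination Complex.I_sq
  linear_combination ((m.ofLp 0 : ℂ) * (2 * (P.profG k₁ k₂).d1 (‖x - y‖ ^ 2) * (y.ofLp 0 - x.ofLp 0))
    + (m.ofLp 1 : ℂ) * (2 * (P.profG k₁ k₂).d1 (‖x - y‖ ^ 2) * (y.ofLp 1 - x.ofLp 1))) * hI

/-- `E₂₁` is already an `x`-gradient, and a further `y`-derivative gives minus the Hessian; this
removes the minus sign in `E₂₁`. -/
theorem adjE_inr_inl (h1 : k₁ ≠ 0) (h2 : k₂ ≠ 0) (m : Plane) {x y : Plane} (h : x ≠ y)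
    (j : Fin 2) :
    P.adjE k₁ k₂ m x y (Sum.inr ()) (Sum.inl j)
      = -P.beta * (∑ i, (m i : ℂ) * P.E11 k₁ k₂ x y i j)
        + Complex.I * P.beta / (P.omega * P.rho_f) *
          ∑ i, (m i : ℂ) * (P.gD k₁ k₂ * (profD k₁ k₂).hess (x - y) j i) := by
  have hE : ∀ i, pd i (fun w => P.E k₁ k₂ x w (Sum.inr ()) (Sum.inl j)) y
      = P.gD k₁ k₂ * (profD k₁ k₂).hess (x - y) j i := by
    intro i
    rw [← neg_sub y x, LogProfile.hess_neg, ← LogProfile.pd_grad _ h.symm,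
      ← pd_const_mul (LogProfile.differentiableAt_grad _ h.symm j)]
    refine pd_congr ((LogProfile.eventually_ne h.symm).mono fun w hw => ?_) i
    change P.E21 k₁ k₂ x w j = _
    rw [E21, grad_eq h1 h2 hw.symm, gD, norm_sub_rev]
    simp only [PiLp.sub_apply]; push_cast; ring
  simp only [adjE, neumannAdj, Sum.elim_inr, dn, hE]
  rfl

theorem hyperKernel_inr_inr (h1 : k₁ ≠ 0) (h2 : k₂ ≠ 0) (hne : k₁ ^ 2 ≠ k₂ ^ 2)
    (n m : Plane) {x y : Plane} (h : x ≠ y) :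
    P.hyperKernel k₁ k₂ n m x y (Sum.inr ()) (Sum.inr ())
      = -(Complex.I * P.omega * P.beta) * (∑ j, (n j : ℂ) *
          (-P.beta * (∑ i, (m i : ℂ) * P.E11 k₁ k₂ x y i j)
        + Complex.I * P.beta / (P.omega * P.rho_f) *
          ∑ i, (m i : ℂ) * (P.gD k₁ k₂ * (profD k₁ k₂).hess (x - y) j i)))
        + Complex.I * P.beta / (P.omega * P.rho_f) *
          ∑ j, (n j : ℂ) * ∑ i, (m i : ℂ) * (P.profAdj k₁ k₂).hess (x - y) i j := by
  have hE : ∀ j, pd j (fun z => P.adjE k₁ k₂ m z y (Sum.inr ()) (Sum.inr ())) x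
      = ∑ i, (m i : ℂ) * (P.profAdj k₁ k₂).hess (x - y) i j := by
    intro j
    rw [pd_congr ((LogProfile.eventually_ne h).mono fun z hz => P.adjE_inr_inr h1 h2 hne m hz) j]
    simp only [Fin.sum_univ_two]
    rw [pd_add, pd_const_mul, pd_const_mul, LogProfile.pd_grad _ h, LogProfile.pd_grad _ h]
    all_goals first
      | exact LogProfile.differentiableAt_grad _ h _
      | exact (LogProfile.differentiableAt_grad _ h _).const_mul _
  simp only [hyperKernel, neumann, Sum.elim_inr, Matrix.transpose_apply, dn, hE,
    P.adjE_inr_inl h1 h2 m h]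

/-! ### Trading normal for tangential derivatives. -/

/-- The quadratic form of the Hessian of `F(|d|²)`. -/
def _root_.Poro.LogProfile.hessForm (F : LogProfile) (d a b : Plane) : ℂ :=
  4 * F.d2 (‖d‖ ^ 2) * (inner ℝ d a : ℝ) * (inner ℝ d b : ℝ)
    + 2 * F.d1 (‖d‖ ^ 2) * (inner ℝ a b : ℝ)

/-- The rotation by a quarter turn. -/
def _root_.Poro.rot (n : Plane) : Plane := !₂[-n 1, n 0]

/-- Splitting of the (2,2) entry of the hypersingular kernel. -/
theorem hyperKernel_split (h1 : k₁ ≠ 0) (h2 : k₂ ≠ 0) (hne : k₁ ^ 2 ≠ k₂ ^ 2)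
    (n m : Plane) {x y : Plane} (h : x ≠ y) :
    P.hyperKernel k₁ k₂ n m x y (Sum.inr ()) (Sum.inr ())
      = (Complex.I * P.omega * P.beta ^ 2 * (cvec n ⬝ᵥ (P.E11 k₁ k₂ x y).mulVec (cvec m))
        + 2 * Complex.I * P.beta * P.gam * P.omega / (P.lam + 2 * P.mu) * P.C4 k₁ k₂
          * (k₁ ^ 2 * helmholtz k₁ x y - k₂ ^ 2 * helmholtz k₂ x y) * (cvec n ⬝ᵥ cvec m)
        - P.C4 k₁ k₂
          * ((P.kp ^ 2 - k₁ ^ 2) * k₁ ^ 2 * helmholtz k₁ x y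
              - (P.kp ^ 2 - k₂ ^ 2) * k₂ ^ 2 * helmholtz k₂ x y) * (cvec n ⬝ᵥ cvec m))
        + (P.profTot k₁ k₂).hessForm (x - y) (rot n) (rot m) := by
  have hr := LogProfile.sq_ne h
  have o1 := helmProfile_ode k₁ hr
  have o2 := helmProfile_ode k₂ hr
  -- The transposition in the kernel produces `mᵀ E₁₁ n`, while `N₄¹` contains `nᵀ E₁₁ m`; symmetry
  -- of `E₁₁` reconciles them.
  have e11 : P.E11 k₁ k₂ x y 1 0 = P.E11 k₁ k₂ x y 0 1 := by
    rw [P.E11_eq h1 h2 h, P.E11_eq h1 h2 h, LogProfile.hess_comm]; simp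
  have hnorm : ((‖x - y‖ ^ 2 : ℝ) : ℂ) = ((x - y) 0 : ℂ) ^ 2 + ((x - y) 1 : ℂ) ^ 2 := by
    rw [EuclideanSpace.norm_sq_eq]; simp
  rw [P.hyperKernel_inr_inr h1 h2 hne n m h, helmholtz_eq_profile h1 h, helmholtz_eq_profile h2 h]
  rw [hnorm] at o1 o2
  have := P.omega_ne
  have := P.rho_f_ne
  have := P.mod_ne
  have := sub_ne_zero.2 hne
  have K1 : Complex.I * P.beta / (P.omega * P.rho_f) * (Complex.I * P.omega * P.beta * P.gD k₁ k₂)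
      = P.cD k₁ k₂ := by
    rw [gD, cD, C4]; field_simp
  have K2 : Complex.I * P.beta / (P.omega * P.rho_f) * (1 / (k₁ ^ 2 - k₂ ^ 2)) = P.C4 k₁ k₂ := by
    rw [C4]; field_simp
  have K3 : 2 * Complex.I * P.beta * P.gam * P.omega / (P.lam + 2 * P.mu) * P.C4 k₁ k₂
      = 2 * P.cD k₁ k₂ := by rw [cD]; ring
  have hin : ∀ a b : Plane, ((inner ℝ a b : ℝ) : ℂ) = (a 0 : ℂ) * b 0 + (a 1 : ℂ) * b 1 := by
    intro a b
    simp [PiLp.inner_apply, Fin.sum_univ_two]; ring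
  rw [K3]
  generalize Complex.I * P.beta / (P.omega * P.rho_f) = s at *
  simp only [Fin.sum_univ_two, profAdj, profTot, LogProfile.hessForm, cvec,
    LogProfile.lin_d1, LogProfile.lin_d2, profD, profG, LogProfile.hess, Matrix.mulVec, dotProduct,
    e11, hin, rot, Matrix.one_apply, PiLp.sub_apply, Complex.ofReal_sub] at o1 o2 ⊢
  generalize 1 / (k₁ ^ 2 - k₂ ^ 2) = δ at *
  generalize ‖x - y‖ ^ 2 = r at *
  simp
  generalize (x.ofLp 0 : ℂ) - y.ofLp 0 = d0 at *
  generalize (x.ofLp 1 : ℂ) - y.ofLp 1 = d1 at *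
  generalize (helmProfile k₁).d1 r = a1 at *
  generalize (helmProfile k₂).d1 r = b1 at *
  generalize (helmProfile k₁).d2 r = a2 at *
  generalize (helmProfile k₂).d2 r = b2 at *
  generalize (helmProfile k₁).val r = a0 at *
  generalize (helmProfile k₂).val r = b0 at *
  generalize (n.ofLp 0 : ℂ) = n0 at *
  generalize (n.ofLp 1 : ℂ) = n1 at *
  generalize (m.ofLp 0 : ℂ) = m0 at *
  generalize (m.ofLp 1 : ℂ) = m1 at *
  -- `K1` and `K2` match the coefficients. The rest is `n·Hm + Jn·HJm = tr(H) n·m` for symmetric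
  -- `H`, where `o1` and `o2` replace `tr H = 4ρF'' + 4F'` by `-k²F`.
  linear_combination
    (-2 * (4 * (a2 - b2) * (d0 * n0 + d1 * n1) * (d0 * m0 + d1 * m1)
      + 2 * (a1 - b1) * (n0 * m0 + n1 * m1))) * K1
    + (4 * ((P.kp ^ 2 - k₁ ^ 2) * a2 - (P.kp ^ 2 - k₂ ^ 2) * b2) * (d0 * n0 + d1 * n1)
        * (d0 * m0 + d1 * m1)
      + 2 * ((P.kp ^ 2 - k₁ ^ 2) * a1 - (P.kp ^ 2 - k₂ ^ 2) * b1) * (n0 * m0 + n1 * m1)) * K2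
    - (2 * P.cD k₁ k₂ - P.C4 k₁ k₂ * (P.kp ^ 2 - k₁ ^ 2)) * (n0 * m0 + n1 * m1) * o1
    + (2 * P.cD k₁ k₂ - P.C4 k₁ k₂ * (P.kp ^ 2 - k₂ ^ 2)) * (n0 * m0 + n1 * m1) * o2

end Medium

end Poro

namespace Poro

open MeasureTheory Real

/-! ### Integrals over a punctured period -/

/-- The period `[-π, π]` without the singular point. -/
def puncPeriod : Set ℝ := Set.Icc (-π) π \ {0}

theorem puncPeriod_ae : puncPeriod =ᵐ[volume] Set.uIoc (-π) π := by
  rw [Set.uIoc_of_le (by linarith [pi_pos])]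
  have h1 : puncPeriod =ᵐ[volume] Set.Icc (-π) π :=
    sdiff_null_ae_eq_self (by simp)
  exact h1.trans Ioc_ae_eq_Icc.symm

theorem measurableSet_puncPeriod : MeasurableSet puncPeriod :=
  measurableSet_Icc.diff (measurableSet_singleton 0)

theorem aesm_of_continuousOn {f : ℝ → ℂ} (hf : ContinuousOn f puncPeriod) :
    AEStronglyMeasurable f (volume.restrict (Set.uIoc (-π) π)) := by
  rw [← Measure.restrict_congr_set puncPeriod_ae]
  exact hf.aestronglyMeasurable measurableSet_puncPeriod

theorem ae_mem_puncPeriod : ∀ᵐ τ : ℝ, τ ∈ Set.uIoc (-π) π → τ ∈ puncPeriod := by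
  filter_upwards [puncPeriod_ae] with τ h1 h2
  exact h1.mpr h2

theorem intervalIntegrable_of_bound {f : ℝ → ℂ} {g : ℝ → ℝ} (hf : ContinuousOn f puncPeriod)
    (hfg : ∀ τ ∈ puncPeriod, ‖f τ‖ ≤ g τ) (hg : IntervalIntegrable g volume (-π) π) :
    IntervalIntegrable f volume (-π) π := by
  refine hg.mono_fun (aesm_of_continuousOn hf) ?_
  rw [EventuallyLE, ae_restrict_iff' measurableSet_uIoc]
  filter_upwards [ae_mem_puncPeriod] with τ h1 h2
  exact (hfg τ (h1 h2)).trans (le_abs_self _)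

theorem intervalIntegrable_abs_rpow {b : ℝ} (hb : -1 < b) :
    IntervalIntegrable (fun τ : ℝ => |τ| ^ b) volume (-π) π := by
  have h1 : IntervalIntegrable (fun τ : ℝ => |τ| ^ b) volume 0 π := by
    refine (intervalIntegral.intervalIntegrable_rpow' (a := 0) (b := π) hb).congr ?_
    intro τ hτ
    rw [Set.uIoc_of_le pi_pos.le] at hτ
    simp [abs_of_pos hτ.1]
  have h2 : IntervalIntegrable (fun τ : ℝ => |τ| ^ b) volume (-π) 0 := by
    have := (IntervalIntegrable.iff_comp_neg (f := fun τ : ℝ => |τ| ^ b) (a := 0) (b := π)).1 h1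
    simpa using this.symm
  exact h2.trans h1

/-! ### Pairs of curves -/

theorem exists_bound_of_periodic {E : Type*} [NormedAddCommGroup E] {f : ℝ → E}
    (hf : Continuous f) (hp : Function.Periodic f (2 * π)) : ∃ M : ℝ, 0 ≤ M ∧ ∀ t, ‖f t‖ ≤ M := by
  obtain ⟨M, hM⟩ := isCompact_Icc.exists_bound_of_continuousOn (s := Set.Icc 0 (2 * π))
    hf.continuousOn
  refine ⟨max M 0, le_max_right _ _, fun t => ?_⟩
  obtain ⟨s, hs, h⟩ := hp.exists_mem_Ico₀ (by positivity) t
  rw [h]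
  exact (hM s ⟨hs.1, hs.2.le⟩).trans (le_max_left _ _)

/-- A pair of smooth closed curves which either coincide or are disjoint, expressed by bounds for
the chords `Y(t+τ) - X(t)`. -/
structure ChordPair where
  X : ℝ → Plane
  Y : ℝ → Plane
  hX : ContDiff ℝ ∞ X
  hY : ContDiff ℝ ∞ Y
  pX : Function.Periodic X (2 * π)
  pY : Function.Periodic Y (2 * π)
  c : ℝ
  C : ℝ
  c_pos : 0 < c
  C_nonneg : 0 ≤ C
  chord_ge : ∀ t τ, |τ| ≤ π → c * |τ| ≤ ‖Y (t + τ) - X t‖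
  -- Moving both end points together changes the chord by at most a multiple of its length. This
  -- keeps the `t`-derivative of the kernel at fixed `τ` no more singular than the kernel.
  deriv_le : ∀ t τ, |τ| ≤ π → ‖deriv Y (t + τ) - deriv X t‖ ≤ C * ‖Y (t + τ) - X t‖

theorem hasDerivAt_of_smooth {X : ℝ → Plane} (h : ContDiff ℝ ∞ X) (t : ℝ) :
    HasDerivAt X (deriv X t) t :=
  (h.differentiable (by simp) t).hasDerivAt

theorem contDiff_deriv {X : ℝ → Plane} (h : ContDiff ℝ ∞ X) : ContDiff ℝ ∞ (deriv X) := by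
  have : ContDiff ℝ (∞ + 1) X := by simpa using h
  exact (contDiff_succ_iff_deriv.1 this).2.2

theorem periodic_deriv {X : ℝ → Plane} (hp : Function.Periodic X (2 * π)) :
    Function.Periodic (deriv X) (2 * π) := fun t => SmoothBoundary.deriv_periodic hp t

namespace ChordPair

variable (S : ChordPair) (F : LogProfile) (t τ : ℝ)

/-- The chord. -/
def d : Plane := S.Y (t + τ) - S.X t
/-- The squared chord length. -/
def sq : ℝ := ‖S.d t τ‖ ^ 2
/-- `∂_τ` of the squared chord length. -/
def sqτ : ℝ := 2 * inner ℝ (S.d t τ) (deriv S.Y (t + τ))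
/-- `∂_t` of the squared chord length. -/
def sqt : ℝ := 2 * inner ℝ (S.d t τ) (deriv S.Y (t + τ) - deriv S.X t)
/-- `∂_t ∂_τ` of the squared chord length. -/
def sqtτ : ℝ := 2 * (inner ℝ (deriv S.Y (t + τ) - deriv S.X t) (deriv S.Y (t + τ))
  + inner ℝ (S.d t τ) (deriv (deriv S.Y) (t + τ)))
/-- `∂_τ²` of the squared chord length. -/
def sqττ : ℝ := 2 * (inner ℝ (deriv S.Y (t + τ)) (deriv S.Y (t + τ))
  + inner ℝ (S.d t τ) (deriv (deriv S.Y) (t + τ)))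

theorem hasDerivAt_Y : HasDerivAt (fun τ => S.Y (t + τ)) (deriv S.Y (t + τ)) τ :=
  (hasDerivAt_of_smooth S.hY (t + τ)).comp_const_add t τ
theorem hasDerivAt_Y' :
    HasDerivAt (fun τ => deriv S.Y (t + τ)) (deriv (deriv S.Y) (t + τ)) τ :=
  (hasDerivAt_of_smooth (contDiff_deriv S.hY) (t + τ)).comp_const_add t τ
theorem hasDerivAt_Yt : HasDerivAt (fun t => S.Y (t + τ)) (deriv S.Y (t + τ)) t :=
  (hasDerivAt_of_smooth S.hY (t + τ)).comp_add_const t τ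
theorem hasDerivAt_Yt' :
    HasDerivAt (fun t => deriv S.Y (t + τ)) (deriv (deriv S.Y) (t + τ)) t :=
  (hasDerivAt_of_smooth (contDiff_deriv S.hY) (t + τ)).comp_add_const t τ

theorem hasDerivAt_d : HasDerivAt (fun τ => S.d t τ) (deriv S.Y (t + τ)) τ :=
  (S.hasDerivAt_Y t τ).sub_const _
theorem hasDerivAt_dt : HasDerivAt (fun t => S.d t τ) (deriv S.Y (t + τ) - deriv S.X t) t :=
  (S.hasDerivAt_Yt t τ).sub (hasDerivAt_of_smooth S.hX t)

theorem hasDerivAt_sq : HasDerivAt (fun τ => S.sq t τ) (S.sqτ t τ) τ :=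
  (S.hasDerivAt_d t τ).norm_sq
theorem hasDerivAt_sq_t : HasDerivAt (fun t => S.sq t τ) (S.sqt t τ) t :=
  (S.hasDerivAt_dt t τ).norm_sq
theorem hasDerivAt_sqτ : HasDerivAt (fun τ => S.sqτ t τ) (S.sqττ t τ) τ := by
  refine (((S.hasDerivAt_d t τ).inner ℝ (S.hasDerivAt_Y' t τ)).const_mul 2).congr_deriv ?_
  rw [sqττ]; ring
theorem hasDerivAt_sqτ_t : HasDerivAt (fun t => S.sqτ t τ) (S.sqtτ t τ) t := by
  refine (((S.hasDerivAt_dt t τ).inner ℝ (S.hasDerivAt_Yt' t τ)).const_mul 2).congr_deriv ?_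
  rw [sqtτ]; ring
theorem hasDerivAt_sqt : HasDerivAt (fun τ => S.sqt t τ) (S.sqtτ t τ) τ := by
  refine (((S.hasDerivAt_d t τ).inner ℝ ((S.hasDerivAt_Y' t τ).sub_const (deriv S.X t))).const_mul
    2).congr_deriv ?_
  rw [sqtτ, real_inner_comm (deriv S.Y (t + τ) - deriv S.X t)]; ring

theorem continuous_d : Continuous fun τ => S.d t τ :=
  continuous_iff_continuousAt.2 fun τ => (S.hasDerivAt_d t τ).continuousAt
theorem continuous_sq : Continuous fun τ => S.sq t τ :=
  continuous_iff_continuousAt.2 fun τ => (S.hasDerivAt_sq t τ).continuousAt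
theorem continuous_sqτ : Continuous fun τ => S.sqτ t τ :=
  continuous_iff_continuousAt.2 fun τ => (S.hasDerivAt_sqτ t τ).continuousAt
theorem continuous_sqt : Continuous fun τ => S.sqt t τ :=
  continuous_iff_continuousAt.2 fun τ => (S.hasDerivAt_sqt t τ).continuousAt
theorem continuous_Y' : Continuous fun τ => deriv S.Y (t + τ) :=
  continuous_iff_continuousAt.2 fun τ => (S.hasDerivAt_Y' t τ).continuousAt
theorem continuous_Y'' : Continuous fun τ => deriv (deriv S.Y) (t + τ) :=
  (contDiff_deriv (contDiff_deriv S.hY)).continuous.comp (continuous_const.add continuous_id)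
theorem continuous_sqtτ : Continuous fun τ => S.sqtτ t τ := by
  have h1 := S.continuous_d t
  have h2 := S.continuous_Y' t
  have h3 := S.continuous_Y'' t
  unfold sqtτ
  fun_prop
variable {t τ}

theorem norm_d_pos (h : τ ∈ puncPeriod) : 0 < ‖S.d t τ‖ :=
  (mul_pos S.c_pos (abs_pos.2 h.2)).trans_le (S.chord_ge t τ (abs_le.2 h.1))

theorem sq_pos (h : τ ∈ puncPeriod) : 0 < S.sq t τ := pow_pos (S.norm_d_pos h) 2

/-- The kernel `∂_τ F(|d|²)`. -/
def ker (t τ : ℝ) : ℂ := F.d1 (S.sq t τ) * S.sqτ t τ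
/-- `∂_t` of `ker`. -/
def kert (t τ : ℝ) : ℂ := F.d2 (S.sq t τ) * S.sqt t τ * S.sqτ t τ + F.d1 (S.sq t τ) * S.sqtτ t τ
/-- `∂_τ` of `ker`. -/
def kerτ (t τ : ℝ) : ℂ := F.d2 (S.sq t τ) * S.sqτ t τ * S.sqτ t τ + F.d1 (S.sq t τ) * S.sqττ t τ

theorem hasDerivAt_val (h : S.sq t τ ≠ 0) :
    HasDerivAt (fun τ => F.val (S.sq t τ)) (S.ker F t τ) τ := by
  refine ((F.hasDerivAt_val h).scomp τ (S.hasDerivAt_sq t τ)).congr_deriv ?_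
  rw [ker, Complex.real_smul, mul_comm]

theorem hasDerivAt_d1 (h : S.sq t τ ≠ 0) :
    HasDerivAt (fun τ => F.d1 (S.sq t τ)) (F.d2 (S.sq t τ) * S.sqτ t τ) τ := by
  refine ((F.hasDerivAt_d1 h).scomp τ (S.hasDerivAt_sq t τ)).congr_deriv ?_
  rw [Complex.real_smul, mul_comm]

theorem hasDerivAt_d1_t (h : S.sq t τ ≠ 0) :
    HasDerivAt (fun t => F.d1 (S.sq t τ)) (F.d2 (S.sq t τ) * S.sqt t τ) t := by
  refine ((F.hasDerivAt_d1 h).scomp t (S.hasDerivAt_sq_t t τ)).congr_deriv ?_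
  rw [Complex.real_smul, mul_comm]

theorem hasDerivAt_ker (h : S.sq t τ ≠ 0) :
    HasDerivAt (fun τ => S.ker F t τ) (S.kerτ F t τ) τ :=
  (S.hasDerivAt_d1 F h).mul (S.hasDerivAt_sqτ t τ).ofReal_comp

theorem hasDerivAt_ker_t (h : S.sq t τ ≠ 0) :
    HasDerivAt (fun t => S.ker F t τ) (S.kert F t τ) t :=
  (S.hasDerivAt_d1_t F h).mul (S.hasDerivAt_sqτ_t t τ).ofReal_comp

theorem mapsTo_sq (t : ℝ) : Set.MapsTo (fun τ => S.sq t τ) puncPeriod {0}ᶜ :=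
  fun _ h => (S.sq_pos h).ne'

theorem continuousOn_val (t : ℝ) : ContinuousOn (fun τ => F.val (S.sq t τ)) puncPeriod :=
  F.continuousOn_val.comp (S.continuous_sq t).continuousOn (S.mapsTo_sq t)
theorem continuousOn_d1 (t : ℝ) : ContinuousOn (fun τ => F.d1 (S.sq t τ)) puncPeriod :=
  F.continuousOn_d1.comp (S.continuous_sq t).continuousOn (S.mapsTo_sq t)
theorem continuousOn_d2 (t : ℝ) : ContinuousOn (fun τ => F.d2 (S.sq t τ)) puncPeriod :=
  F.continuousOn_d2.comp (S.continuous_sq t).continuousOn (S.mapsTo_sq t)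

theorem continuousOn_ker (t : ℝ) : ContinuousOn (fun τ => S.ker F t τ) puncPeriod :=
  (S.continuousOn_d1 F t).mul (Complex.continuous_ofReal.comp (S.continuous_sqτ t)).continuousOn

theorem continuousOn_kert (t : ℝ) : ContinuousOn (fun τ => S.kert F t τ) puncPeriod :=
  (((S.continuousOn_d2 F t).mul
    (Complex.continuous_ofReal.comp (S.continuous_sqt t)).continuousOn).mul
    (Complex.continuous_ofReal.comp (S.continuous_sqτ t)).continuousOn).add
    ((S.continuousOn_d1 F t).mul (Complex.continuous_ofReal.comp (S.continuous_sqtτ t)).continuousOn)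

theorem exists_chord_bound : ∃ D : ℝ, 0 ≤ D ∧ ∀ t τ, ‖S.d t τ‖ ≤ D := by
  obtain ⟨A, A0, hA⟩ := exists_bound_of_periodic S.hX.continuous S.pX
  obtain ⟨B, B0, hB⟩ := exists_bound_of_periodic S.hY.continuous S.pY
  exact ⟨B + A, by positivity, fun t τ => (norm_sub_le _ _).trans (add_le_add (hB _) (hA _))⟩

/-- Any kernel bounded by a multiple of `|d|^{-1/2}` is bounded by a multiple of `|τ|^{-1/2}`. -/
theorem rpow_le (h : τ ∈ puncPeriod) :
    (S.sq t τ) ^ (-(1 / 4) : ℝ) ≤ S.c ^ (-(1 / 2) : ℝ) * |τ| ^ (-(1 / 2) : ℝ) := by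
  have hd := S.norm_d_pos (t := t) h
  have h1 : (S.sq t τ) ^ (-(1 / 4) : ℝ) = ‖S.d t τ‖ ^ (-(1 / 2) : ℝ) := by
    rw [sq, ← Real.rpow_natCast, ← Real.rpow_mul hd.le]; norm_num
  rw [h1, ← Real.mul_rpow S.c_pos.le (abs_nonneg _)]
  exact Real.rpow_le_rpow_of_nonpos (mul_pos S.c_pos (abs_pos.2 h.2))
    (S.chord_ge t τ (abs_le.2 h.1)) (by norm_num)

/-- Bounds for the kernels. -/
theorem exists_ker_bound : ∃ K : ℝ, 0 ≤ K ∧ ∀ t, ∀ τ ∈ puncPeriod,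
    ‖F.val (S.sq t τ)‖ ≤ K * |τ| ^ (-(1 / 2) : ℝ) ∧ ‖S.ker F t τ‖ ≤ K / |τ| ∧
      ‖S.kert F t τ‖ ≤ K / |τ| := by
  obtain ⟨D, D0, hD⟩ := S.exists_chord_bound
  obtain ⟨C, C0, hC⟩ := F.exists_bound (D ^ 2)
  obtain ⟨M, M0, hM⟩ := exists_bound_of_periodic (contDiff_deriv S.hY).continuous
    (periodic_deriv S.pY)
  obtain ⟨N, N0, hN⟩ := exists_bound_of_periodic (contDiff_deriv (contDiff_deriv S.hY)).continuous
    (periodic_deriv (periodic_deriv S.pY))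
  have c0 := S.c_pos
  have SC0 := S.C_nonneg
  refine ⟨C * S.c ^ (-(1 / 2) : ℝ) + 2 * C * M / S.c
    + (4 * C * S.C * M + 2 * C * (S.C * M + N)) / S.c, by positivity, fun t τ h => ?_⟩
  have hd := S.norm_d_pos (t := t) h
  have hs := S.sq_pos (t := t) h
  have hτ : 0 < |τ| := abs_pos.2 h.2
  obtain ⟨b0, b1, b2, -⟩ := hC (S.sq t τ) hs (pow_le_pow_left₀ hd.le (hD t τ) 2)
  have hdτ : (‖S.d t τ‖)⁻¹ ≤ (S.c * |τ|)⁻¹ :=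
    inv_anti₀ (by positivity) (S.chord_ge t τ (abs_le.2 h.1))
  have e1 : |S.sqτ t τ| ≤ 2 * ‖S.d t τ‖ * M := by
    rw [sqτ, abs_mul, abs_two, mul_assoc]
    gcongr
    exact (abs_real_inner_le_norm _ _).trans (by gcongr; exact hM _)
  -- This is second order in the chord, one order better than `sqτ`, and offsets the stronger
  -- singularity of `F.d2` in `kert`.
  have e2 : |S.sqt t τ| ≤ 2 * S.C * ‖S.d t τ‖ ^ 2 := by
    rw [sqt, abs_mul, abs_two, mul_assoc]
    gcongr
    refine (abs_real_inner_le_norm _ _).trans ?_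
    calc _ ≤ ‖S.d t τ‖ * (S.C * ‖S.d t τ‖) := by gcongr; exact S.deriv_le t τ (abs_le.2 h.1)
      _ = _ := by ring
  have e3 : |S.sqtτ t τ| ≤ 2 * (S.C * M + N) * ‖S.d t τ‖ := by
    rw [sqtτ, abs_mul, abs_two, mul_assoc]
    gcongr
    refine (abs_add_le _ _).trans ?_
    rw [add_mul]
    refine add_le_add ((abs_real_inner_le_norm _ _).trans ?_) ((abs_real_inner_le_norm _ _).trans ?_)
    · calc _ ≤ (S.C * ‖S.d t τ‖) * M := by
            gcongr
            · exact S.deriv_le t τ (abs_le.2 h.1)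
            · exact hM _
        _ = _ := by ring
    · rw [mul_comm N]; gcongr; exact hN _
  have n1 : ∀ x : ℝ, ‖(x : ℂ)‖ = |x| := fun x => by rw [Complex.norm_real, Real.norm_eq_abs]
  have k1 : ‖S.ker F t τ‖ ≤ 2 * C * M * (‖S.d t τ‖)⁻¹ := by
    rw [ker, norm_mul, n1]
    calc _ ≤ C / S.sq t τ * (2 * ‖S.d t τ‖ * M) := by gcongr
      _ = _ := by rw [sq]; field_simp
  have k2 : ‖S.kert F t τ‖ ≤ (4 * C * S.C * M + 2 * C * (S.C * M + N)) * (‖S.d t τ‖)⁻¹ := by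
    rw [kert]
    refine (norm_add_le _ _).trans ?_
    rw [norm_mul, norm_mul, norm_mul, n1, n1, n1]
    calc _ ≤ C / S.sq t τ ^ 2 * (2 * S.C * ‖S.d t τ‖ ^ 2) * (2 * ‖S.d t τ‖ * M)
          + C / S.sq t τ * (2 * (S.C * M + N) * ‖S.d t τ‖) := by gcongr
      _ = _ := by rw [sq]; field_simp; ring
  have p1 : 0 ≤ C * S.c ^ (-(1 / 2) : ℝ) := by positivity
  have p2 : 0 ≤ 2 * C * M / S.c := by positivity
  have p3 : 0 ≤ (4 * C * S.C * M + 2 * C * (S.C * M + N)) / S.c := by positivity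
  refine ⟨?_, ?_, ?_⟩
  · calc _ ≤ C * (S.c ^ (-(1 / 2) : ℝ) * |τ| ^ (-(1 / 2) : ℝ)) :=
          b0.trans (by gcongr; exact S.rpow_le h)
      _ = C * S.c ^ (-(1 / 2) : ℝ) * |τ| ^ (-(1 / 2) : ℝ) := by ring
      _ ≤ _ := by gcongr; linarith
  · calc _ ≤ 2 * C * M * (S.c * |τ|)⁻¹ := k1.trans (by gcongr)
      _ = (2 * C * M / S.c) / |τ| := by field_simp
      _ ≤ _ := by gcongr; linarith
  · calc _ ≤ (4 * C * S.C * M + 2 * C * (S.C * M + N)) * (S.c * |τ|)⁻¹ := k2.trans (by gcongr)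
      _ = ((4 * C * S.C * M + 2 * C * (S.C * M + N)) / S.c) / |τ| := by field_simp
      _ ≤ _ := by gcongr; linarith

end ChordPair

end Poro

/-! ### Potentials, integration by parts and the exact derivative. -/

namespace Poro

open MeasureTheory Real

/-- A periodic function with Hölder continuous derivative. -/
structure Density where
  Q : ℝ → ℂ
  q : ℝ → ℂ
  hQ : ∀ t, HasDerivAt Q (q t) t
  pQ : Function.Periodic Q (2 * π)
  pq : Function.Periodic q (2 * π)
  a : ℝ
  H : ℝ
  a_pos : 0 < a
  H_nonneg : 0 ≤ H
  holder : ∀ s t, ‖q s - q t‖ ≤ H * |s - t| ^ a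

namespace Density

variable (f : Density)

theorem continuous_Q : Continuous f.Q :=
  continuous_iff_continuousAt.2 fun t => (f.hQ t).continuousAt

theorem continuous_q : Continuous f.q := by
  refine continuous_iff_continuousAt.2 fun t => ?_
  rw [ContinuousAt, tendsto_iff_norm_sub_tendsto_zero]
  have h : Tendsto (fun s : ℝ => f.H * |s - t| ^ f.a) (𝓝 t) (𝓝 (f.H * |t - t| ^ f.a)) := by
    have : Continuous fun s : ℝ => f.H * |s - t| ^ f.a :=
      continuous_const.mul (((continuous_id.sub continuous_const).abs).rpow_const
        fun _ => Or.inr f.a_pos.le)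
    exact this.tendsto t
  rw [sub_self, abs_zero, Real.zero_rpow f.a_pos.ne', mul_zero] at h
  exact squeeze_zero (fun _ => norm_nonneg _) (fun s => f.holder s t) h

theorem exists_lipschitz : ∃ M : ℝ, 0 ≤ M ∧ (∀ t, ‖f.q t‖ ≤ M) ∧ ∀ t τ, ‖f.Q (t + τ) - f.Q t‖ ≤ M * |τ| := by
  obtain ⟨M, M0, hM⟩ := exists_bound_of_periodic f.continuous_q f.pq
  refine ⟨M, M0, hM, fun t τ => ?_⟩
  have := convex_univ.norm_image_sub_le_of_norm_hasDerivWithin_le (f := f.Q)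
    (fun x _ => (f.hQ x).hasDerivWithinAt) (fun x _ => hM x) (Set.mem_univ t) (Set.mem_univ (t + τ))
  simpa using this

theorem hasDerivAt_shift (t τ : ℝ) : HasDerivAt (fun τ => f.Q (t + τ)) (f.q (t + τ)) τ :=
  (f.hQ (t + τ)).comp_const_add t τ

theorem hasDerivAt_shift_t (t τ : ℝ) : HasDerivAt (fun t => f.Q (t + τ)) (f.q (t + τ)) t :=
  (f.hQ (t + τ)).comp_add_const t τ

theorem holder_shift (t τ : ℝ) : ‖f.q (t + τ) - f.q t‖ ≤ f.H * |τ| ^ f.a := by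
  simpa using f.holder (t + τ) t

theorem continuous_shift_Q (t : ℝ) : Continuous fun τ => f.Q (t + τ) :=
  f.continuous_Q.comp (continuous_const.add continuous_id)

theorem continuous_shift_q (t : ℝ) : Continuous fun τ => f.q (t + τ) :=
  f.continuous_q.comp (continuous_const.add continuous_id)

end Density

/-- A `2π`-periodic function has the same values at `t ± π`. -/
theorem periodic_ends {E : Type*} {g : ℝ → E} (hg : Function.Periodic g (2 * π)) (t : ℝ) :
    g (t + π) = g (t + -π) := by
  rw [← hg (t + -π)]; congr 1; ring

namespace ChordPair

variable (S : ChordPair) (F : LogProfile) (f : Density)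

theorem d_ends (t : ℝ) : S.d t π = S.d t (-π) := by
  rw [d, d, periodic_ends S.pY]

theorem sq_ends (t : ℝ) : S.sq t π = S.sq t (-π) := by rw [sq, sq, S.d_ends]

theorem sqτ_ends (t : ℝ) : S.sqτ t π = S.sqτ t (-π) := by
  rw [sqτ, sqτ, S.d_ends, periodic_ends (periodic_deriv S.pY)]

theorem sqt_ends (t : ℝ) : S.sqt t π = S.sqt t (-π) := by
  rw [sqt, sqt, S.d_ends, periodic_ends (periodic_deriv S.pY)]

/-- The potential of the density `q`. -/
def pot (t : ℝ) : ℂ := ∫ τ in (-π)..π, F.val (S.sq t τ) * f.q (t + τ)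

/-- The integrand of the potential after integration by parts. -/
def parts (t τ : ℝ) : ℂ := S.ker F t τ * (f.Q (t + τ) - f.Q t)

/-- The `t`-derivative of `parts`. -/
def partst (t τ : ℝ) : ℂ :=
  S.kert F t τ * (f.Q (t + τ) - f.Q t) + S.ker F t τ * (f.q (t + τ) - f.q t)

theorem hasDerivAt_parts {t τ : ℝ} (h : S.sq t τ ≠ 0) :
    HasDerivAt (fun t => S.parts F f t τ) (S.partst F f t τ) t :=
  (S.hasDerivAt_ker_t F h).mul ((f.hasDerivAt_shift_t t τ).sub (f.hQ t))

theorem continuousOn_parts (t : ℝ) : ContinuousOn (fun τ => S.parts F f t τ) puncPeriod :=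
  (S.continuousOn_ker F t).mul ((f.continuous_shift_Q t).sub continuous_const).continuousOn

theorem continuousOn_partst (t : ℝ) : ContinuousOn (fun τ => S.partst F f t τ) puncPeriod :=
  ((S.continuousOn_kert F t).mul ((f.continuous_shift_Q t).sub continuous_const).continuousOn).add
    ((S.continuousOn_ker F t).mul ((f.continuous_shift_q t).sub continuous_const).continuousOn)

/-- Subtracting `Q(t)` gains a factor `|τ|` against kernels of size `1/|τ|`. For the term with `q`
the Hölder condition gains only `|τ|^a`, and `|τ|^(a-1)` is integrable because `a > 0`. -/
theorem exists_parts_bound : ∃ K : ℝ, 0 ≤ K ∧ ∀ t, ∀ τ ∈ puncPeriod,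
    ‖S.parts F f t τ‖ ≤ K ∧ ‖S.partst F f t τ‖ ≤ K + K * |τ| ^ (f.a - 1) ∧
      ‖F.val (S.sq t τ) * (f.Q (t + τ) - f.Q t)‖ ≤ K * |τ| ^ (1 / 2 : ℝ) ∧
      ‖F.val (S.sq t τ) * f.q (t + τ)‖ ≤ K * |τ| ^ (-(1 / 2) : ℝ) := by
  obtain ⟨K, K0, hK⟩ := S.exists_ker_bound F
  obtain ⟨M, M0, hM1, hM⟩ := f.exists_lipschitz
  have H0 := f.H_nonneg
  refine ⟨K * M + K * f.H, by positivity, fun t τ h => ?_⟩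
  obtain ⟨h1, h2, h3⟩ := hK t τ h
  have hτ : 0 < |τ| := abs_pos.2 h.2
  have q1 : 0 ≤ K * M := by positivity
  have q2 : 0 ≤ K * f.H := by positivity
  have l1 : ‖S.ker F t τ * (f.Q (t + τ) - f.Q t)‖ ≤ K * M := by
    rw [norm_mul]
    calc _ ≤ K / |τ| * (M * |τ|) := by gcongr; exact hM t τ
      _ = _ := by field_simp
  refine ⟨?_, ?_, ?_, ?_⟩
  · rw [parts]; linarith
  · refine (norm_add_le _ _).trans (add_le_add ?_ ?_)
    · rw [norm_mul]
      calc _ ≤ K / |τ| * (M * |τ|) := by gcongr; exact hM t τ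
        _ = K * M := by field_simp
        _ ≤ _ := by linarith
    · rw [norm_mul]
      calc _ ≤ K / |τ| * (f.H * |τ| ^ f.a) := by gcongr; exact f.holder_shift t τ
        _ = K * f.H * |τ| ^ (f.a - 1) := by rw [Real.rpow_sub_one hτ.ne']; ring
        _ ≤ _ := by gcongr; linarith
  · rw [norm_mul]
    calc _ ≤ (K * |τ| ^ (-(1 / 2) : ℝ)) * (M * |τ|) := by gcongr; exact hM t τ
      _ = K * M * (|τ| ^ (-(1 / 2) : ℝ) * |τ|) := by ring
      _ = K * M * |τ| ^ (1 / 2 : ℝ) := by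
          rw [← Real.rpow_add_one hτ.ne']; norm_num
      _ ≤ _ := by gcongr; linarith
  · rw [norm_mul]
    calc _ ≤ (K * |τ| ^ (-(1 / 2) : ℝ)) * M := by gcongr; exact hM1 _
      _ = K * M * (|τ| ^ (-(1 / 2) : ℝ)) := by ring
      _ ≤ _ := by gcongr; linarith

theorem intervalIntegrable_parts (t : ℝ) : IntervalIntegrable (S.parts F f t) volume (-π) π := by
  obtain ⟨K, K0, hK⟩ := S.exists_parts_bound F f
  exact intervalIntegrable_of_bound (S.continuousOn_parts F f t) (fun τ h => (hK t τ h).1)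
    intervalIntegrable_const

theorem intervalIntegrable_partst (t : ℝ) : IntervalIntegrable (S.partst F f t) volume (-π) π := by
  obtain ⟨K, K0, hK⟩ := S.exists_parts_bound F f
  exact intervalIntegrable_of_bound (S.continuousOn_partst F f t) (fun τ h => (hK t τ h).2.1)
    (intervalIntegrable_const.add
      ((intervalIntegrable_abs_rpow (by linarith [f.a_pos])).const_mul _))

theorem intervalIntegrable_pot (t : ℝ) :
    IntervalIntegrable (fun τ => F.val (S.sq t τ) * f.q (t + τ)) volume (-π) π := by
  obtain ⟨K, K0, hK⟩ := S.exists_parts_bound F f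
  exact intervalIntegrable_of_bound
    ((S.continuousOn_val F t).mul (f.continuous_shift_q t).continuousOn)
    (fun τ h => (hK t τ h).2.2.2) ((intervalIntegrable_abs_rpow (by norm_num)).const_mul _)

/-- Integration by parts in the potential. -/
theorem pot_eq (t : ℝ) : S.pot F f t = -∫ τ in (-π)..π, S.parts F f t τ := by
  obtain ⟨K, K0, hK⟩ := S.exists_parts_bound F f
  -- The constant `Q(t)` may be subtracted since only the derivative of `Q` enters the potential.
  -- The product is then `O(|τ|^(1/2))`, hence continuous at `0` whatever value the profile takes
  -- there.
  have hc : ContinuousOn (fun τ => F.val (S.sq t τ) * (f.Q (t + τ) - f.Q t)) (Set.uIcc (-π) π) := by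
    rw [Set.uIcc_of_le (by linarith [pi_pos])]
    intro τ hτ
    rcases eq_or_ne τ 0 with rfl | h0
    · have h1 : Tendsto (fun τ : ℝ => K * |τ| ^ (1 / 2 : ℝ)) (𝓝[Set.Icc (-π) π] 0) (𝓝 0) := by
        have hc : Continuous fun τ : ℝ => K * |τ| ^ (1 / 2 : ℝ) :=
          continuous_const.mul (continuous_abs.rpow_const fun _ => Or.inr (by norm_num))
        have := hc.tendsto 0
        rw [abs_zero, Real.zero_rpow (by norm_num), mul_zero] at this
        exact this.mono_left nhdsWithin_le_nhds
      rw [ContinuousWithinAt, add_zero, sub_self, mul_zero]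
      refine squeeze_zero_norm' ?_ h1
      filter_upwards [self_mem_nhdsWithin] with s hs
      rcases eq_or_ne s 0 with rfl | hs0
      · simp
      · exact (hK t s ⟨hs, hs0⟩).2.2.1
    · have h1 : ContinuousAt (fun τ => F.val (S.sq t τ)) τ :=
        (S.hasDerivAt_val F (S.sq_pos ⟨hτ, h0⟩).ne').continuousAt
      exact (h1.mul ((f.continuous_shift_Q t).sub continuous_const).continuousAt).continuousWithinAt
  -- The fundamental theorem tolerates the exceptional point `0`, and the values at `±π` cancel by
  -- periodicity.
  have key := integral_eq_of_hasDerivAt_off_countable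
    (fun τ => F.val (S.sq t τ) * (f.Q (t + τ) - f.Q t))
    (fun τ => S.parts F f t τ + F.val (S.sq t τ) * f.q (t + τ)) (s := {0})
    (Set.countable_singleton 0) hc
    (fun τ hτ => by
      rw [min_eq_left (by linarith [pi_pos]), max_eq_right (by linarith [pi_pos])] at hτ
      have h1 := S.hasDerivAt_val F (t := t) (S.sq_pos ⟨Set.Ioo_subset_Icc_self hτ.1, hτ.2⟩).ne'
      exact h1.mul ((f.hasDerivAt_shift t τ).sub_const _))
    ((S.intervalIntegrable_parts F f t).add (S.intervalIntegrable_pot F f t))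
  rw [intervalIntegral.integral_add (S.intervalIntegrable_parts F f t)
    (S.intervalIntegrable_pot F f t), S.sq_ends, periodic_ends f.pQ, sub_self] at key
  rw [pot]
  linear_combination key

/-- Differentiability of the potential. -/
theorem hasDerivAt_pot (t : ℝ) :
    HasDerivAt (S.pot F f) (-∫ τ in (-π)..π, S.partst F f t τ) t := by
  obtain ⟨K, K0, hK⟩ := S.exists_parts_bound F f
  -- Differentiation is applied to the form integrated by parts. Since the singular point is `τ = 0`
  -- for every `t`, one majorant works uniformly in `t`.
  have := (intervalIntegral.hasDerivAt_integral_of_dominated_loc_of_deriv_le (μ := volume)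
    (F := fun t τ => S.parts F f t τ) (F' := fun t τ => S.partst F f t τ) (x₀ := t) (s := Set.univ)
    (a := -π) (b := π) (bound := fun τ => K + K * |τ| ^ (f.a - 1))
    univ_mem (Eventually.of_forall fun x => aesm_of_continuousOn (S.continuousOn_parts F f x))
    (S.intervalIntegrable_parts F f t) (aesm_of_continuousOn (S.continuousOn_partst F f t))
    (by
      filter_upwards [ae_mem_puncPeriod] with τ h1 h2 x _
      exact (hK x τ (h1 h2)).2.1)
    (intervalIntegrable_const.add
      ((intervalIntegrable_abs_rpow (by linarith [f.a_pos])).const_mul _))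
    (by
      filter_upwards [ae_mem_puncPeriod] with τ h1 h2 x _
      exact S.hasDerivAt_parts F f (S.sq_pos (h1 h2)).ne')).2.neg
  rw [show S.pot F f = fun t => -∫ τ in (-π)..π, S.parts F f t τ from
    funext fun t => S.pot_eq F f t]
  exact this

/-- The hypersingular kernel `-∂_t ∂_s F(|Y(s) - X(t)|²)`, `s = t + τ`. -/
def hyper (t τ : ℝ) : ℂ :=
  4 * F.d2 (S.sq t τ) * (inner ℝ (S.d t τ) (deriv S.X t) : ℝ)
      * (inner ℝ (S.d t τ) (deriv S.Y (t + τ)) : ℝ)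
    + 2 * F.d1 (S.sq t τ) * (inner ℝ (deriv S.X t) (deriv S.Y (t + τ)) : ℝ)

/-- At fixed `τ` the `t`-derivative moves both end points, `∂_t + ∂_s`, whereas `∂_τ` is `∂_s`.
Their difference, applied to `∂_s F`, isolates the mixed derivative. -/
theorem hyper_eq (t τ : ℝ) : S.hyper F t τ = S.kerτ F t τ - S.kert F t τ := by
  have h1 : S.sqt t τ = S.sqτ t τ - 2 * inner ℝ (S.d t τ) (deriv S.X t) := by
    rw [sqt, sqτ, inner_sub_right]; ring
  have h2 : S.sqtτ t τ = S.sqττ t τ - 2 * inner ℝ (deriv S.X t) (deriv S.Y (t + τ)) := by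
    rw [sqtτ, sqττ, inner_sub_left]; ring
  rw [hyper, kerτ, kert, h1, h2]
  push_cast
  have h3 : (S.sqτ t τ : ℂ) = 2 * (inner ℝ (S.d t τ) (deriv S.Y (t + τ)) : ℝ) := by
    rw [sqτ]; push_cast; ring
  rw [h3]; ring

/-- The primitive of the regularized hypersingular integrand. -/
def prim (t τ : ℝ) : ℂ :=
  S.ker F t τ * f.Q (t + τ) - f.Q t * (F.d1 (S.sq t τ) * S.sqt t τ) - f.q t * F.val (S.sq t τ)

/-- The terms `kert · Q(t+τ)` cancel. The surviving `Q(t) · kert` and `q(t) · ker` have coefficients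
independent of `τ` and are `τ`-derivatives of `F'·sqt` and `F`, while `kerτ·Q + ker·q` is a product
rule. Hence no singular integral has to be evaluated. -/
theorem hasDerivAt_prim {t τ : ℝ} (h : S.sq t τ ≠ 0) :
    HasDerivAt (fun τ => S.prim F f t τ) (S.hyper F t τ * f.Q (t + τ) + S.partst F f t τ) τ := by
  refine ((((S.hasDerivAt_ker F h).mul (f.hasDerivAt_shift t τ)).sub
    (((S.hasDerivAt_d1 F h).mul (S.hasDerivAt_sqt t τ).ofReal_comp).const_mul (f.Q t))).sub
    ((S.hasDerivAt_val F h).const_mul (f.q t))).congr_deriv ?_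
  rw [hyper_eq, partst, kert]
  ring

theorem prim_ends (t : ℝ) : S.prim F f t π = S.prim F f t (-π) := by
  rw [prim, prim, ker, ker, S.sq_ends, S.sqτ_ends, S.sqt_ends, periodic_ends f.pQ]

end ChordPair

end Poro

/-! ### Cutting out the singular point. -/

namespace Poro

open MeasureTheory Real

/-- The level set of a function with positive derivative to the right of its zero. -/
theorem exists_cut_point {g g' : ℝ → ℝ} {c : ℝ} (hg : ∀ τ, HasDerivAt g (g' τ) τ) (g0 : g 0 = 0)
    (c_pos : 0 < c) (hc : ∀ τ ∈ Set.Ioc 0 π, (c * τ) ^ 2 ≤ g τ) (hpos : ∀ᶠ τ in 𝓝[>] 0, 0 < g' τ) :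
    ∃ r₀ > 0, ∀ r, 0 < r → r < r₀ → ∃ s ∈ Set.Ioo 0 π, g s = r ^ 2 ∧
      ∀ τ ∈ Set.Icc 0 π, r ^ 2 < g τ ↔ s < τ := by
  have hp : ∀ᶠ δ : ℝ in 𝓝[>] 0, δ < π := nhdsWithin_le_nhds (Iio_mem_nhds pi_pos)
  obtain ⟨u, hu0, hu⟩ := mem_nhdsGT_iff_exists_Ioo_subset.1 (hpos.and hp)
  have hu0 : 0 < u := hu0
  set δ := u / 2 with hδ
  have δ0 : 0 < δ := by positivity
  have hδu : δ < u := by rw [hδ]; linarith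
  have hδπ : δ < π := (hu ⟨δ0, hδu⟩).2
  have hmono : StrictMonoOn g (Set.Icc 0 δ) := by
    refine strictMonoOn_of_deriv_pos (convex_Icc 0 δ)
      (fun x _ => (hg x).continuousAt.continuousWithinAt) fun x hx => ?_
    rw [interior_Icc] at hx
    rw [(hg x).deriv]
    exact (hu ⟨hx.1, hx.2.trans hδu⟩).1
  -- For `r < cδ` the lower bound `(cτ)²` keeps `g` above `r²` beyond `δ`, so the only crossing lies
  -- in `[0, δ]`, where `g` is strictly increasing.
  refine ⟨c * δ, by positivity, fun r r0 hr => ?_⟩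
  have hr2 : r ^ 2 < g δ :=
    (pow_lt_pow_left₀ hr r0.le two_ne_zero).trans_le (hc δ ⟨δ0, hδπ.le⟩)
  obtain ⟨s, hs, hsr⟩ := intermediate_value_Ioo δ0.le
    (fun x _ => (hg x).continuousAt.continuousWithinAt)
    (show r ^ 2 ∈ Set.Ioo (g 0) (g δ) from ⟨by rw [g0]; positivity, hr2⟩)
  refine ⟨s, ⟨hs.1, hs.2.trans hδπ⟩, hsr, fun τ hτ => ?_⟩
  rcases le_or_gt τ δ with h | h
  · rw [← hsr]
    exact hmono.lt_iff_lt ⟨hs.1.le, hs.2.le⟩ ⟨hτ.1, h⟩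
  · refine iff_of_true ?_ (hs.2.trans h)
    calc r ^ 2 < (c * δ) ^ 2 := pow_lt_pow_left₀ hr r0.le two_ne_zero
      _ ≤ (c * τ) ^ 2 := by gcongr
      _ ≤ g τ := hc τ ⟨δ0.trans h, hτ.2⟩

/-- The divided difference of a twice differentiable function is differentiable. -/
theorem hasDerivAt_dslope {g g' : ℝ → Plane} {w : Plane} (hg : ∀ τ, HasDerivAt g (g' τ) τ)
    (hg' : HasDerivAt g' w 0) : HasDerivAt (dslope g 0) ((1 / 2 : ℝ) • w) 0 := by
  rw [hasDerivAt_iff_isLittleO, Asymptotics.isLittleO_iff]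
  intro ε hε
  rw [hasDerivAt_iff_isLittleO, Asymptotics.isLittleO_iff] at hg'
  obtain ⟨δ, δ0, hδ⟩ := Metric.eventually_nhds_iff.1 (hg' hε)
  refine Metric.eventually_nhds_iff.2 ⟨δ, δ0, fun τ hτ => ?_⟩
  rcases eq_or_ne τ 0 with rfl | h0
  · simp
  -- The mean value inequality is applied to the second order Taylor remainder; its derivative is
  -- the first order remainder of `g'`, at most `ε|τ|` on this ball.
  have hd : ∀ x ∈ Metric.closedBall (0 : ℝ) |τ|, HasDerivWithinAt
      (fun x => g x - x • g' 0 - (x ^ 2 / 2) • w) (g' x - g' 0 - x • w)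
      (Metric.closedBall (0 : ℝ) |τ|) x := by
    intro x _
    have h1 : HasDerivAt (fun x : ℝ => x ^ 2 / 2) x x := by
      simpa using (hasDerivAt_pow 2 x).div_const 2
    have := ((hg x).fun_sub ((hasDerivAt_id x).smul_const (g' 0))).fun_sub (h1.smul_const w)
    rw [one_smul] at this
    exact this.hasDerivWithinAt
  have hb : ∀ x ∈ Metric.closedBall (0 : ℝ) |τ|, ‖g' x - g' 0 - x • w‖ ≤ ε * |τ| := by
    intro x hx
    rw [mem_closedBall_zero_iff, Real.norm_eq_abs] at hx
    have hx' : dist x 0 < δ := by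
      rw [dist_zero_right, Real.norm_eq_abs]
      rw [dist_zero_right, Real.norm_eq_abs] at hτ
      exact hx.trans_lt hτ
    have := hδ hx'
    rw [sub_zero, Real.norm_eq_abs] at this
    exact this.trans (by gcongr)
  have := (convex_closedBall (0 : ℝ) |τ|).norm_image_sub_le_of_norm_hasDerivWithin_le hd hb
    (show (0 : ℝ) ∈ _ by simp) (show τ ∈ _ by simp)
  rw [dslope_of_ne _ h0, dslope_same, (hg 0).deriv, slope_def_module, sub_zero, Real.norm_eq_abs]
  have e : g τ - τ • g' 0 - (τ ^ 2 / 2) • w - (g 0 - (0 : ℝ) • g' 0 - ((0 : ℝ) ^ 2 / 2) • w)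
      = τ • (τ⁻¹ • (g τ - g 0) - g' 0 - τ • (1 / 2 : ℝ) • w) := by
    rw [smul_sub, smul_sub, smul_inv_smul₀ h0, smul_smul, smul_smul]
    have : τ * τ * (1 / 2) = τ ^ 2 / 2 := by ring
    simp only [mul_assoc] at this ⊢
    rw [this]
    simp
    abel
  rw [e, norm_smul, sub_zero, Real.norm_eq_abs, mul_assoc, mul_comm] at this
  have hτ0 : 0 < |τ| := abs_pos.2 h0
  refine le_of_mul_le_mul_right (this.trans_eq ?_) hτ0
  ring

namespace ChordPair

variable (S : ChordPair) (F : LogProfile) (f : Density)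

/-- Removing the part of the curve near the singularity does not matter in the limit. -/
theorem tendsto_cut (t : ℝ) {g : ℝ → ℂ} (hg : IntervalIntegrable g volume (-π) π) :
    Tendsto (fun r : ℝ => ∫ τ in (-π)..π, Set.indicator {τ | r < ‖S.d t τ‖} g τ) (𝓝[>] 0)
      (𝓝 (∫ τ in (-π)..π, g τ)) := by
  refine intervalIntegral.tendsto_integral_filter_of_dominated_convergence (fun τ => ‖g τ‖) ?_ ?_
    hg.norm ?_
  · refine Eventually.of_forall fun r => ?_
    exact (intervalIntegrable_iff.1 hg).aestronglyMeasurable.indicator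
      (isOpen_lt continuous_const (S.continuous_d t).norm).measurableSet
  · exact Eventually.of_forall fun r => Eventually.of_forall fun τ _ => norm_indicator_le_norm_self _ _
  · filter_upwards [ae_mem_puncPeriod] with τ h1 h2
    have hd := S.norm_d_pos (t := t) (h1 h2)
    refine tendsto_const_nhds.congr' ?_
    filter_upwards [nhdsWithin_le_nhds (Iio_mem_nhds hd)] with r hr
    rw [Set.indicator_of_mem (show τ ∈ {τ | r < ‖S.d t τ‖} from hr)]

/-- The regularized hypersingular integrand. -/
def reg (t τ : ℝ) : ℂ := S.hyper F t τ * f.Q (t + τ) + S.partst F f t τ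

theorem continuousAt_reg {t τ : ℝ} (h : S.sq t τ ≠ 0) : ContinuousAt (fun τ => S.reg F f t τ) τ := by
  have hd := (S.continuous_d t).continuousAt (x := τ)
  have hY := (S.continuous_Y' t).continuousAt (x := τ)
  have hQ := (f.continuous_shift_Q t).continuousAt (x := τ)
  have hq := (f.continuous_shift_q t).continuousAt (x := τ)
  have h2 : ContinuousAt (fun τ => F.d2 (S.sq t τ)) τ :=
    ContinuousAt.comp (f := fun τ => S.sq t τ) (g := F.d2)
      (F.continuousOn_d2.continuousAt (isOpen_compl_singleton.mem_nhds h))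
      (S.continuous_sq t).continuousAt
  have h1 : ContinuousAt (fun τ => F.d1 (S.sq t τ)) τ := (S.hasDerivAt_d1 F h).continuousAt
  have hi1 : ContinuousAt (fun τ => ((inner ℝ (S.d t τ) (deriv S.X t) : ℝ) : ℂ)) τ := by fun_prop
  have hi2 : ContinuousAt (fun τ => ((inner ℝ (S.d t τ) (deriv S.Y (t + τ)) : ℝ) : ℂ)) τ := by
    fun_prop
  have hi3 : ContinuousAt (fun τ => ((inner ℝ (deriv S.X t) (deriv S.Y (t + τ)) : ℝ) : ℂ)) τ := by
    fun_prop
  have ht := (Complex.continuous_ofReal.comp (S.continuous_sqt t)).continuousAt (x := τ)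
  have hτ := (Complex.continuous_ofReal.comp (S.continuous_sqτ t)).continuousAt (x := τ)
  have htτ := (Complex.continuous_ofReal.comp (S.continuous_sqtτ t)).continuousAt (x := τ)
  unfold reg hyper partst kert ker
  simp only [Function.comp_def] at ht hτ htτ
  fun_prop

theorem integral_reg {t a b : ℝ} (hab : a ≤ b) (h : ∀ τ ∈ Set.Icc a b, S.sq t τ ≠ 0) :
    IntegrableOn (S.reg F f t) (Set.Ioc a b) ∧
      ∫ τ in Set.Ioc a b, S.reg F f t τ = S.prim F f t b - S.prim F f t a := by
  have hc : ContinuousOn (S.reg F f t) (Set.Icc a b) :=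
    fun τ hτ => (S.continuousAt_reg F f (h τ hτ)).continuousWithinAt
  have hi : IntervalIntegrable (S.reg F f t) volume a b := by
    apply ContinuousOn.intervalIntegrable; rwa [Set.uIcc_of_le hab]
  refine ⟨(intervalIntegrable_iff_integrableOn_Ioc_of_le hab).1 hi, ?_⟩
  rw [← intervalIntegral.integral_of_le hab]
  refine intervalIntegral.integral_eq_sub_of_hasDerivAt (fun τ hτ => ?_) hi
  rw [Set.uIcc_of_le hab] at hτ
  exact S.hasDerivAt_prim F f (h τ hτ)

/-- It is enough to treat the regularized integrand. -/
theorem finitePart_of_reg {t : ℝ} {c : ℂ}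
    (h : Tendsto (fun r : ℝ => (∫ τ in (-π)..π,
      Set.indicator {τ | r < ‖S.d t τ‖} (S.reg F f t) τ) - c / r) (𝓝[>] 0) (𝓝 0))
    (hint : ∀ᶠ r : ℝ in 𝓝[>] 0, IntervalIntegrable
      (Set.indicator {τ | r < ‖S.d t τ‖} (S.reg F f t)) volume (-π) π) :
    Tendsto (fun r : ℝ => (∫ τ in (-π)..π, Set.indicator {τ | r < ‖S.d t τ‖}
      (fun τ => S.hyper F t τ * f.Q (t + τ)) τ) - c / r) (𝓝[>] 0) (𝓝 (deriv (S.pot F f) t)) := by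
  rw [(S.hasDerivAt_pot F f t).deriv]
  -- The hypersingular integrand is `reg - partst`. The part `partst` is integrable, and minus its
  -- integral is the derivative of the potential.
  have h2 := h.sub (S.tendsto_cut t (S.intervalIntegrable_partst F f t))
  rw [zero_sub] at h2
  refine h2.congr' ?_
  filter_upwards [hint] with r hr
  have hp : IntervalIntegrable (Set.indicator {τ | r < ‖S.d t τ‖} (S.partst F f t)) volume (-π) π := by
    have hS := (isOpen_lt continuous_const (S.continuous_d t).norm).measurableSet
      (s := {τ | r < ‖S.d t τ‖})
    have := S.intervalIntegrable_partst F f t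
    rw [intervalIntegrable_iff] at this ⊢
    exact this.indicator hS
  have e : (fun τ => Set.indicator {τ | r < ‖S.d t τ‖} (fun τ => S.hyper F t τ * f.Q (t + τ)) τ)
      = fun τ => Set.indicator {τ | r < ‖S.d t τ‖} (S.reg F f t) τ
        - Set.indicator {τ | r < ‖S.d t τ‖} (S.partst F f t) τ := by
    funext τ
    by_cases hτ : τ ∈ {τ | r < ‖S.d t τ‖}
    · simp only [Set.indicator_of_mem hτ, reg]; ring
    · simp only [Set.indicator_of_notMem hτ, sub_zero]
  rw [e, intervalIntegral.integral_sub hr hp]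
  ring

/-- Disjoint curves: the finite part is an ordinary integral. -/
theorem finitePart_of_disjoint {t δ : ℝ} (hδ : 0 < δ) (h : ∀ τ, δ ≤ ‖S.d t τ‖) :
    Tendsto (fun r : ℝ => (∫ τ in (-π)..π, Set.indicator {τ | r < ‖S.d t τ‖}
      (fun τ => S.hyper F t τ * f.Q (t + τ)) τ) - (0 : ℂ) / r) (𝓝[>] 0)
      (𝓝 (deriv (S.pot F f) t)) := by
  have hπ : -π ≤ π := by linarith [pi_pos]
  obtain ⟨h1, h2⟩ := S.integral_reg F f hπ (t := t)
    (fun τ _ => (pow_pos (hδ.trans_le (h τ)) 2).ne')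
  have e : ∀ᶠ r : ℝ in 𝓝[>] 0,
      Set.indicator {τ | r < ‖S.d t τ‖} (S.reg F f t) = S.reg F f t := by
    filter_upwards [nhdsWithin_le_nhds (Iio_mem_nhds hδ)] with r hr
    exact Set.indicator_eq_self.2 fun τ _ => lt_of_lt_of_le hr (h τ)
  refine S.finitePart_of_reg F f ?_ ?_
  -- For `r < δ` nothing is cut off, and the exact derivative integrates to zero over a full period.
  · refine tendsto_const_nhds.congr' ?_
    filter_upwards [e] with r hr
    rw [hr, intervalIntegral.integral_of_le hπ, h2, S.prim_ends]; simp
  · filter_upwards [e] with r hr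
    rw [hr]
    exact (intervalIntegrable_iff_integrableOn_Ioc_of_le hπ).2 h1

/-! ### Boundary values at the two cut points. -/

/-- The divided difference of the curve. -/
def chordSlope (t τ : ℝ) : Plane := dslope (fun τ => S.Y (t + τ)) 0 τ

/-- The boundary value of the primitive, divided by its singular factor. -/
def edge (t τ : ℝ) : ℂ :=
  ((2 * inner ℝ (S.chordSlope t τ) (deriv S.Y (t + τ)) : ℝ) * f.Q (t + τ)
    - f.Q t * (2 * inner ℝ (S.chordSlope t τ) (deriv S.Y (t + τ) - deriv S.X t) : ℝ))
    / (‖S.chordSlope t τ‖ : ℝ)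

variable {S}

theorem differentiableAt_chordSlope (t : ℝ) : DifferentiableAt ℝ (S.chordSlope t) 0 :=
  (hasDerivAt_dslope (S.hasDerivAt_Y t) (S.hasDerivAt_Y' t 0)).differentiableAt

theorem chordSlope_zero (t : ℝ) : S.chordSlope t 0 = deriv S.Y t := by
  rw [chordSlope, dslope_same, (S.hasDerivAt_Y t 0).deriv, add_zero]

/-- Continuity would not suffice: `edge` is multiplied by a factor of order `1/r`, so its first
order term matters. The norm in the denominator is differentiable because the slope at `0` is the
nonzero velocity. -/
theorem differentiableAt_edge {t : ℝ} (hreg : deriv S.Y t ≠ 0) :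
    DifferentiableAt ℝ (S.edge f t) 0 := by
  have h1 := differentiableAt_chordSlope (S := S) t
  have h2 := (S.hasDerivAt_Y' t 0).differentiableAt
  have h3 := (f.hasDerivAt_shift t 0).differentiableAt
  have h0 : S.chordSlope t 0 ≠ 0 := by rwa [chordSlope_zero]
  have h4 : DifferentiableAt ℝ (fun τ => ((‖S.chordSlope t τ‖ : ℝ) : ℂ)) 0 :=
    Complex.ofRealCLM.differentiableAt.comp _ (h1.norm ℝ h0)
  have h5 : DifferentiableAt ℝ (fun τ =>
      ((2 * inner ℝ (S.chordSlope t τ) (deriv S.Y (t + τ)) : ℝ) : ℂ)) 0 :=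
    Complex.ofRealCLM.differentiableAt.comp _ ((h1.inner ℝ h2).const_mul 2)
  have h6 : DifferentiableAt ℝ (fun τ =>
      ((2 * inner ℝ (S.chordSlope t τ) (deriv S.Y (t + τ) - deriv S.X t) : ℝ) : ℂ)) 0 :=
    Complex.ofRealCLM.differentiableAt.comp _ ((h1.inner ℝ (h2.sub_const _)).const_mul 2)
  refine ((h5.mul h3).sub (h6.const_mul (f.Q t))).mul (h4.inv ?_)
  simpa using h0

theorem d_eq_smul (hXY : S.X = S.Y) (t τ : ℝ) : S.d t τ = τ • S.chordSlope t τ := by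
  have := sub_smul_dslope (fun τ => S.Y (t + τ)) 0 τ
  rw [sub_zero] at this
  rw [chordSlope, this, d, hXY, add_zero]

theorem norm_d_eq (hXY : S.X = S.Y) (t τ : ℝ) : ‖S.d t τ‖ = |τ| * ‖S.chordSlope t τ‖ := by
  rw [d_eq_smul hXY, norm_smul, Real.norm_eq_abs]

/-- The primitive at a point of the curve at distance `r`. -/
theorem prim_eq (hXY : S.X = S.Y) {t τ r ε : ℝ} (hr : 0 < r) (hτ : S.sq t τ = r ^ 2)
    (hε : ε * |τ| = τ) :
    S.prim F f t τ = F.d1 (r ^ 2) * (r * ε * S.edge f t τ) - f.q t * F.val (r ^ 2) := by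
  have hd : ‖S.d t τ‖ = r := by
    rw [sq] at hτ
    exact (pow_left_inj₀ (norm_nonneg _) hr.le two_ne_zero).1 hτ
  rw [norm_d_eq hXY] at hd
  have hv : ‖S.chordSlope t τ‖ ≠ 0 := fun h => by rw [h, mul_zero] at hd; exact hr.ne hd
  have h1 : S.sqτ t τ = τ * (2 * inner ℝ (S.chordSlope t τ) (deriv S.Y (t + τ))) := by
    rw [sqτ, d_eq_smul hXY, real_inner_smul_left]; ring
  have h2 : S.sqt t τ = τ * (2 * inner ℝ (S.chordSlope t τ) (deriv S.Y (t + τ) - deriv S.X t)) := by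
    rw [sqt, d_eq_smul hXY, real_inner_smul_left]; ring
  -- Here `ε` is the sign of `τ`: the chord has length `r = |τ|·|slope|`, so `rε` is `τ` times the
  -- length of the slope.
  have h3 : (r : ℂ) * ε = τ * (‖S.chordSlope t τ‖ : ℝ) := by
    have : r * ε = τ * ‖S.chordSlope t τ‖ := by
      linear_combination (-ε) * hd + ‖S.chordSlope t τ‖ * hε
    exact_mod_cast this
  have hv' : ((‖S.chordSlope t τ‖ : ℝ) : ℂ) ≠ 0 := by exact_mod_cast hv
  rw [prim, ker, h1, h2, hτ, h3, edge]
  push_cast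
  field_simp

theorem norm_slope_pos (hXY : S.X = S.Y) {t τ : ℝ} (h : τ ∈ puncPeriod) :
    0 < ‖S.chordSlope t τ‖ := by
  have := S.norm_d_pos (t := t) h
  rw [norm_d_eq hXY] at this
  exact pos_of_mul_pos_right this (abs_nonneg _)

theorem sqτ_eq (hXY : S.X = S.Y) (t τ : ℝ) :
    S.sqτ t τ = τ * (2 * inner ℝ (S.chordSlope t τ) (deriv S.Y (t + τ))) := by
  rw [sqτ, d_eq_smul hXY, real_inner_smul_left]; ring

theorem eventually_slope_pos {t : ℝ} (hreg : deriv S.Y t ≠ 0) :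
    ∀ᶠ τ in 𝓝 0, 0 < 2 * inner ℝ (S.chordSlope t τ) (deriv S.Y (t + τ)) := by
  have hc : ContinuousAt (fun τ => 2 * inner ℝ (S.chordSlope t τ) (deriv S.Y (t + τ))) 0 :=
    (((differentiableAt_chordSlope (S := S) t).inner ℝ
      (S.hasDerivAt_Y' t 0).differentiableAt).const_mul 2).continuousAt
  refine hc.eventually (lt_mem_nhds ?_)
  simp only [chordSlope_zero, add_zero, real_inner_self_eq_norm_sq]
  have := norm_pos_iff.2 hreg
  positivity

/-- The part of the curve farther than `r` from a point, for small `r`. -/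
theorem exists_cut (hXY : S.X = S.Y) {t : ℝ} (hreg : deriv S.Y t ≠ 0) :
    ∃ r₀ > 0, ∀ r, 0 < r → r < r₀ → ∃ a ∈ Set.Ioo 0 π, ∃ b ∈ Set.Ioo 0 π,
      S.sq t (-a) = r ^ 2 ∧ S.sq t b = r ^ 2 ∧
      ∀ τ ∈ Set.Icc (-π) π, r < ‖S.d t τ‖ ↔ τ < -a ∨ b < τ := by
  have hz : S.sq t 0 = 0 := by rw [sq, d_eq_smul hXY]; simp
  have hpos := eventually_slope_pos (S := S) hreg
  have hc : ∀ τ, |τ| ≤ π → (S.c * |τ|) ^ 2 ≤ S.sq t τ := fun τ h =>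
    pow_le_pow_left₀ (mul_nonneg S.c_pos.le (abs_nonneg _)) (S.chord_ge t τ h) 2
  obtain ⟨r₁, r₁0, h₁⟩ := exists_cut_point (g := fun τ => S.sq t τ) (S.hasDerivAt_sq t) hz S.c_pos
    (fun τ hτ => by
      have := hc τ (by rw [abs_of_pos hτ.1]; exact hτ.2)
      rwa [abs_of_pos hτ.1] at this)
    (by
      filter_upwards [nhdsWithin_le_nhds hpos, self_mem_nhdsWithin] with τ h1 h2
      rw [sqτ_eq hXY]; exact mul_pos h2 h1)
  -- The cut point on the left comes from the same lemma applied to the reflected parameter.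
  obtain ⟨r₂, r₂0, h₂⟩ := exists_cut_point (g := fun τ => S.sq t (-τ)) (g' := fun τ => -S.sqτ t (-τ))
    (fun τ => by
      have := (S.hasDerivAt_sq t (-τ)).scomp τ (hasDerivAt_neg τ)
      rw [neg_one_smul] at this
      exact this)
    (by simpa using hz) S.c_pos
    (fun τ hτ => by
      have := hc (-τ) (by rw [abs_neg, abs_of_pos hτ.1]; exact hτ.2)
      rwa [abs_neg, abs_of_pos hτ.1] at this)
    (by
      have hneg : Tendsto (fun τ : ℝ => -τ) (𝓝[>] 0) (𝓝 0) := by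
        have := (continuous_neg (G := ℝ)).tendsto 0
        rw [neg_zero] at this
        exact this.mono_left nhdsWithin_le_nhds
      filter_upwards [hneg.eventually hpos, self_mem_nhdsWithin] with τ h1 h2
      rw [sqτ_eq hXY, ← neg_mul, neg_neg]; exact mul_pos h2 h1)
  refine ⟨min r₁ r₂, lt_min r₁0 r₂0, fun r r0 hr => ?_⟩
  obtain ⟨b, hb, hbr, hb'⟩ := h₁ r r0 (hr.trans_le (min_le_left _ _))
  obtain ⟨a, ha, har, ha'⟩ := h₂ r r0 (hr.trans_le (min_le_right _ _))
  refine ⟨a, ha, b, hb, har, hbr, fun τ hτ => ?_⟩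
  have e : r < ‖S.d t τ‖ ↔ r ^ 2 < S.sq t τ := by
    rw [sq]; exact (pow_lt_pow_iff_left₀ r0.le (norm_nonneg _) two_ne_zero).symm
  rw [e]
  rcases le_total 0 τ with h | h
  · rw [hb' τ ⟨h, hτ.2⟩]
    have : ¬ τ < -a := by have := ha.1; linarith
    tauto
  · have h3 := ha' (-τ) ⟨by linarith, by linarith [hτ.1]⟩
    rw [neg_neg] at h3
    rw [h3]
    have : ¬ b < τ := by have := hb.1; linarith
    have h4 : a < -τ ↔ τ < -a := by constructor <;> intro h <;> linarith
    tauto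

theorem integral_cut {t r a b : ℝ} (ha : a ∈ Set.Ioo 0 π)
    (hb : b ∈ Set.Ioo 0 π) (h : ∀ τ ∈ Set.Icc (-π) π, r < ‖S.d t τ‖ ↔ τ < -a ∨ b < τ) :
    IntervalIntegrable (Set.indicator {τ | r < ‖S.d t τ‖} (S.reg F f t)) volume (-π) π ∧
    ∫ τ in (-π)..π, Set.indicator {τ | r < ‖S.d t τ‖} (S.reg F f t) τ
      = S.prim F f t (-a) - S.prim F f t b := by
  have hπ : -π ≤ π := by linarith [pi_pos]
  have ha0 := ha.1
  have ha1 := ha.2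
  have hb0 := hb.1
  have hb1 := hb.2
  obtain ⟨i1, v1⟩ := S.integral_reg F f (t := t) (a := -π) (b := -a) (by linarith)
    (fun τ hτ => (S.sq_pos ⟨⟨hτ.1, by linarith [hτ.2]⟩,
      by have := hτ.2; simp only [Set.mem_singleton_iff]; linarith⟩).ne')
  obtain ⟨i2, v2⟩ := S.integral_reg F f (t := t) (a := b) (b := π) hb1.le
    (fun τ hτ => (S.sq_pos ⟨⟨by linarith [hτ.1], hτ.2⟩,
      by have := hτ.1; simp only [Set.mem_singleton_iff]; linarith⟩).ne')
  have hset : Set.Ioc (-π) π ∩ {τ | r < ‖S.d t τ‖} = Set.Ioo (-π) (-a) ∪ Set.Ioc b π := by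
    ext τ
    constructor
    · rintro ⟨h1, h2⟩
      rcases (h τ ⟨h1.1.le, h1.2⟩).1 h2 with h3 | h3
      · exact Or.inl ⟨h1.1, h3⟩
      · exact Or.inr ⟨h3, h1.2⟩
    · rintro (⟨h1, h2⟩ | ⟨h1, h2⟩)
      · exact ⟨⟨h1, by linarith⟩, (h τ ⟨h1.le, by linarith⟩).2 (Or.inl h2)⟩
      · exact ⟨⟨by linarith, h2⟩, (h τ ⟨by linarith, h2⟩).2 (Or.inr h1)⟩
  have hS : MeasurableSet {τ | r < ‖S.d t τ‖} :=
    (isOpen_lt continuous_const (S.continuous_d t).norm).measurableSet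
  have hdisj : Disjoint (Set.Ioo (-π) (-a)) (Set.Ioc b π) := by
    rw [Set.disjoint_left]
    intro τ h1 h2
    linarith [h1.2, h2.1]
  have i1' : IntegrableOn (S.reg F f t) (Set.Ioo (-π) (-a)) := i1.mono_set Set.Ioo_subset_Ioc_self
  constructor
  · rw [intervalIntegrable_iff_integrableOn_Ioc_of_le hπ, IntegrableOn, integrable_indicator_iff hS,
      IntegrableOn, Measure.restrict_restrict hS, Set.inter_comm, hset]
    exact i1'.union i2
  -- The contributions at `±π` agree by periodicity, leaving only the values at the two inner cut
  -- points.
  · rw [intervalIntegral.integral_of_le hπ, setIntegral_indicator hS, hset,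
      setIntegral_union hdisj measurableSet_Ioc i1' i2, ← integral_Ioc_eq_integral_Ioo, v1, v2,
      S.prim_ends]
    ring

/-- First order expansion of `edge` at a point of the curve at distance `r`. -/
theorem tendsto_edge {t : ℝ} (hXY : S.X = S.Y) (hreg : deriv S.Y t ≠ 0) {s : ℝ → ℝ} {ε : ℝ}
    (hs : ∀ᶠ r in 𝓝[>] 0, s r ∈ puncPeriod ∧ ‖S.d t (s r)‖ = r ∧ ε * |s r| = s r) :
    Tendsto (fun r : ℝ => (S.edge f t (s r) - S.edge f t 0) / r) (𝓝[>] 0)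
        (𝓝 (ε * deriv (S.edge f t) 0 / (‖deriv S.Y t‖ : ℝ))) ∧
      Tendsto (fun r : ℝ => S.edge f t (s r)) (𝓝[>] 0) (𝓝 (S.edge f t 0)) := by
  have h0 : Tendsto s (𝓝[>] 0) (𝓝 0) := by
    have hr : Tendsto (fun r : ℝ => r / S.c) (𝓝[>] 0) (𝓝 0) := by
      have := ((continuous_id (X := ℝ)).div_const S.c).tendsto 0
      simp only [id, zero_div] at this
      exact this.mono_left nhdsWithin_le_nhds
    refine squeeze_zero_norm' ?_ hr
    filter_upwards [hs] with r ⟨h1, h2, _⟩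
    have := S.chord_ge t (s r) (abs_le.2 h1.1)
    rw [← d, h2] at this
    rw [Real.norm_eq_abs, le_div_iff₀ S.c_pos, mul_comm]
    exact this
  have h1 : Tendsto s (𝓝[>] 0) (𝓝[≠] 0) :=
    tendsto_nhdsWithin_iff.2 ⟨h0, hs.mono fun r hr => hr.1.2⟩
  have hd := (differentiableAt_edge (S := S) f hreg)
  have h2 := (hasDerivAt_iff_tendsto_slope.1 hd.hasDerivAt).comp h1
  have h3 : Tendsto (fun r => ‖S.chordSlope t (s r)‖) (𝓝[>] 0) (𝓝 ‖deriv S.Y t‖) := by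
    rw [← chordSlope_zero]
    exact ((differentiableAt_chordSlope (S := S) t).continuousAt.norm.tendsto).comp h0
  refine ⟨?_, hd.continuousAt.tendsto.comp h0⟩
  have hn : ((‖deriv S.Y t‖ : ℝ) : ℂ) ≠ 0 := by simpa using hreg
  -- The difference quotient in `s r` is rescaled by `s r / r = ε / |slope|`, which tends to `ε /
  -- |Y'(t)|`.
  have h4 := (h2.const_mul (ε : ℂ)).div ((Complex.continuous_ofReal.tendsto _).comp h3) hn
  refine h4.congr' ?_
  filter_upwards [hs, self_mem_nhdsWithin] with r ⟨h5, h6, h7⟩ hr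
  have hv := norm_slope_pos hXY (t := t) h5
  rw [norm_d_eq hXY] at h6
  have hs0 : ((s r : ℝ) : ℂ) ≠ 0 := by exact_mod_cast h5.2
  have hv' : ((‖S.chordSlope t (s r)‖ : ℝ) : ℂ) ≠ 0 := by exact_mod_cast hv.ne'
  have hr' : (r : ℂ) ≠ 0 := by exact_mod_cast (ne_of_gt hr)
  have h8 : (s r : ℂ) * (‖S.chordSlope t (s r)‖ : ℝ) = ε * r := by
    have : s r * ‖S.chordSlope t (s r)‖ = ε * r := by
      linear_combination ε * h6 - ‖S.chordSlope t (s r)‖ * h7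
    exact_mod_cast this
  simp only [Function.comp_apply, slope_def_module, sub_zero, Complex.real_smul, Pi.div_apply]
  push_cast
  rw [div_eq_div_iff hv' hr']
  field_simp
  linear_combination (-(S.edge f t (s r) - S.edge f t 0)) * h8

/-- `F'(ρ) = A(0)/ρ + O(ρ^(-1/4))`; at `ρ = r²` the error in `r²F'` is `O(r^(3/2))`. The extra
division by `r` is affordable, so the pole coefficient is exact up to a vanishing remainder. -/
theorem tendsto_d1 : ∃ C : ℝ, ∀ r : ℝ, 0 < r → r ≤ 1 →
    ‖((r : ℂ) ^ 2 * F.d1 (r ^ 2) - F.A 0) / r‖ ≤ C * r ^ (1 / 2 : ℝ) := by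
  obtain ⟨C, C0, hC⟩ := F.exists_bound 1
  refine ⟨C, fun r r0 r1 => ?_⟩
  obtain ⟨-, -, -, h⟩ := hC (r ^ 2) (by positivity) (pow_le_one₀ r0.le r1)
  rw [norm_div, Complex.norm_real, Real.norm_of_nonneg r0.le, div_le_iff₀ r0]
  push_cast at h
  refine h.trans_eq ?_
  have e : r ^ 2 * (r ^ 2) ^ (-(1 / 4) : ℝ) = r ^ (1 / 2 : ℝ) * r := by
    rw [← Real.rpow_natCast r 2, ← Real.rpow_mul r0.le, ← Real.rpow_add r0, ← Real.rpow_add_one r0.ne']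
    norm_num
  rw [e, mul_assoc]

/-- Coinciding curves: existence and value of the finite part. -/
theorem finitePart_of_eq (hXY : S.X = S.Y) {t : ℝ} (hreg : deriv S.Y t ≠ 0) :
    Tendsto (fun r : ℝ => (∫ τ in (-π)..π, Set.indicator {τ | r < ‖S.d t τ‖}
      (fun τ => S.hyper F t τ * f.Q (t + τ)) τ) - (-2 * F.A 0 * S.edge f t 0) / r) (𝓝[>] 0)
      (𝓝 (deriv (S.pot F f) t)) := by
  obtain ⟨r₀, r₀0, hr₀⟩ := exists_cut hXY hreg
  have hex : ∀ r, ∃ a b : ℝ, 0 < r → r < r₀ → a ∈ Set.Ioo 0 π ∧ b ∈ Set.Ioo 0 π ∧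
      S.sq t (-a) = r ^ 2 ∧ S.sq t b = r ^ 2 ∧
      ∀ τ ∈ Set.Icc (-π) π, r < ‖S.d t τ‖ ↔ τ < -a ∨ b < τ := by
    intro r
    by_cases h : 0 < r ∧ r < r₀
    · obtain ⟨a, ha, b, hb, h'⟩ := hr₀ r h.1 h.2
      exact ⟨a, b, fun _ _ => ⟨ha, hb, h'⟩⟩
    · exact ⟨0, 0, fun h1 h2 => absurd ⟨h1, h2⟩ h⟩
  choose a b hab using hex
  have hev : ∀ᶠ r : ℝ in 𝓝[>] 0, 0 < r ∧ r < r₀ := by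
    filter_upwards [self_mem_nhdsWithin, nhdsWithin_le_nhds (Iio_mem_nhds r₀0)] with r h1 h2
    exact ⟨h1, h2⟩
  have hnorm : ∀ {r τ : ℝ}, 0 < r → S.sq t τ = r ^ 2 → ‖S.d t τ‖ = r := fun hr h =>
    (pow_left_inj₀ (norm_nonneg _) hr.le two_ne_zero).1 h
  obtain ⟨A1, A2⟩ := tendsto_edge f hXY hreg (s := fun r => -a r) (ε := -1) (by
    filter_upwards [hev] with r hr
    obtain ⟨h1, h2, h3, h4, -⟩ := hab r hr.1 hr.2
    refine ⟨⟨⟨by linarith [h1.2], by linarith [h1.1, pi_pos]⟩, ?_⟩, hnorm hr.1 h3, ?_⟩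
    · simpa using h1.1.ne'
    · rw [abs_neg, abs_of_pos h1.1]; ring)
  obtain ⟨B1, B2⟩ := tendsto_edge f hXY hreg (s := b) (ε := 1) (by
    filter_upwards [hev] with r hr
    obtain ⟨h1, h2, h3, h4, -⟩ := hab r hr.1 hr.2
    refine ⟨⟨⟨by linarith [h2.1, pi_pos], h2.2.le⟩, ?_⟩, hnorm hr.1 h4, ?_⟩
    · simpa using h2.1.ne'
    · rw [abs_of_pos h2.1]; ring)
  refine S.finitePart_of_reg F f ?_ ?_
  · have hD : Tendsto (fun r : ℝ => ((r : ℂ) ^ 2 * F.d1 (r ^ 2) - F.A 0) / r) (𝓝[>] 0) (𝓝 0) := by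
      obtain ⟨C, hC⟩ := tendsto_d1 F
      have hr : Tendsto (fun r : ℝ => C * r ^ (1 / 2 : ℝ)) (𝓝[>] 0) (𝓝 0) := by
        have hc : Continuous fun r : ℝ => C * r ^ (1 / 2 : ℝ) :=
          continuous_const.mul (continuous_id.rpow_const fun _ => Or.inr (by norm_num))
        have := hc.tendsto 0
        rw [Real.zero_rpow (by norm_num), mul_zero] at this
        exact this.mono_left nhdsWithin_le_nhds
      refine squeeze_zero_norm' ?_ hr
      filter_upwards [self_mem_nhdsWithin, nhdsWithin_le_nhds (Iic_mem_nhds one_pos)] with r h1 h2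
      exact hC r h1 h2
    -- The difference of boundary values is `-rF'(r²)` times the sum of `edge` at the two cut
    -- points, the terms `q(t)F(r²)` having cancelled. Replacing `r²F'(r²)` by `A(0)` and `edge` by
    -- its value at `0` produces the pole; the linear terms of `edge` carry the opposite signs `ε =
    -- ∓1` and cancel in the limit.
    have key := ((hD.mul (A2.add B2)).add ((A1.add B1).const_mul (F.A 0))).neg
    have hz : -(0 * (S.edge f t 0 + S.edge f t 0) + F.A 0 *
        (((-1 : ℝ) : ℂ) * deriv (S.edge f t) 0 / (‖deriv S.Y t‖ : ℝ)
          + ((1 : ℝ) : ℂ) * deriv (S.edge f t) 0 / (‖deriv S.Y t‖ : ℝ))) = 0 := by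
      push_cast; ring
    rw [hz] at key
    refine key.congr' ?_
    filter_upwards [hev] with r hr
    obtain ⟨h1, h2, h3, h4, h5⟩ := hab r hr.1 hr.2
    rw [(integral_cut F f h1 h2 h5).2, prim_eq F f hXY hr.1 h3 (ε := -1)
      (by rw [abs_neg, abs_of_pos h1.1]; ring), prim_eq F f hXY hr.1 h4 (ε := 1)
      (by rw [abs_of_pos h2.1]; ring)]
    have hr' : (r : ℂ) ≠ 0 := by exact_mod_cast hr.1.ne'
    push_cast
    field_simp
    ring
  · filter_upwards [hev] with r hr
    obtain ⟨h1, h2, -, -, h5⟩ := hab r hr.1 hr.2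
    exact (integral_cut F f h1 h2 h5).1

end ChordPair

end Poro

namespace Poro

open MeasureTheory Real

/-! ### Boundaries as pairs of curves -/

/-- The mean velocity between two parameters. -/
def meanVel (X : ℝ → Plane) (t τ : ℝ) : Plane := ∫ θ in (0 : ℝ)..1, deriv X (t + θ * τ)

theorem continuous_meanVel {X : ℝ → Plane} (h : ContDiff ℝ ∞ X) :
    Continuous fun z : ℝ × ℝ => meanVel X z.1 z.2 := by
  unfold meanVel
  have hc := (contDiff_deriv h).continuous
  apply intervalIntegral.continuous_parametric_intervalIntegral_of_continuous'
  simp only [Function.uncurry_def]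
  fun_prop

theorem smul_meanVel {X : ℝ → Plane} (h : ContDiff ℝ ∞ X) (t τ : ℝ) :
    τ • meanVel X t τ = X (t + τ) - X t := by
  have hc := (contDiff_deriv h).continuous
  have := intervalIntegral.integral_unitInterval_deriv_eq_sub (𝕜 := ℝ) (f := X) (f' := deriv X)
    (z₀ := t) (z₁ := τ) (by fun_prop) (fun s _ => hasDerivAt_of_smooth h _)
  simpa [meanVel] using this

theorem periodic_pair {X : ℝ → Plane} (hp : Function.Periodic X (2 * π)) (t : ℝ) :
    ∃ s ∈ Set.Icc 0 (2 * π), ∀ τ, X (t + τ) = X (s + τ) ∧ deriv X (t + τ) = deriv X (s + τ) := by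
  obtain ⟨s, hs, -⟩ := hp.exists_mem_Ico₀ (by positivity) t
  obtain ⟨n, hn⟩ : ∃ n : ℤ, toIcoMod (show 0 < 2 * π by positivity) 0 t = t - n • (2 * π) := ⟨_, rfl⟩
  refine ⟨toIcoMod (show 0 < 2 * π by positivity) 0 t, ?_, fun τ => ?_⟩
  · have := toIcoMod_mem_Ico (show 0 < 2 * π by positivity) 0 t
    rw [zero_add] at this
    exact ⟨this.1, this.2.le⟩
  · have e : t + τ = (toIcoMod (show 0 < 2 * π by positivity) 0 t + τ) + n * (2 * π) := by
      rw [hn, zsmul_eq_mul]; ring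
    rw [e]
    exact ⟨(hp.int_mul n) _, ((periodic_deriv hp).int_mul n) _⟩

namespace SmoothBoundary

variable {Ω : Set Plane} {ι : Type*} (Γ : SmoothBoundary Ω ι)

theorem chord_ne (i : ι) {t τ : ℝ} (hτ : |τ| ≤ π) (h0 : τ ≠ 0) :
    Γ.curve i (t + τ) ≠ Γ.curve i t := by
  intro h
  obtain ⟨-, n, hn⟩ := Γ.simple _ _ _ _ h
  have hn' : τ = n * (2 * π) := by linarith
  have hn0 : n ≠ 0 := by rintro rfl; simp at hn'; exact h0 hn'
  have h1 : (1 : ℝ) ≤ |(n : ℝ)| := by exact_mod_cast Int.one_le_abs hn0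
  rw [hn', abs_mul, abs_of_pos (show 0 < 2 * π by positivity)] at hτ
  nlinarith [pi_pos]

/-- The chord is `τ` times the mean velocity, which vanishes nowhere for `|τ| ≤ π`: by regularity at
`τ = 0`, by injectivity modulo `2π` elsewhere. Compactness, with periodicity in `t`, gives a
positive minimum. -/
theorem exists_chord_self (i : ι) : ∃ c : ℝ, 0 < c ∧ ∀ t τ, |τ| ≤ π →
    c * |τ| ≤ ‖Γ.curve i (t + τ) - Γ.curve i t‖ := by
  have hs := Γ.smooth i
  have hne : ∀ t τ, |τ| ≤ π → meanVel (Γ.curve i) t τ ≠ 0 := by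
    intro t τ hτ h
    rcases eq_or_ne τ 0 with rfl | h0
    · have : meanVel (Γ.curve i) t 0 = deriv (Γ.curve i) t := by simp [meanVel]
      exact Γ.regular i t (this ▸ h)
    · have := smul_meanVel hs t τ
      rw [h, smul_zero] at this
      exact Γ.chord_ne i hτ h0 (sub_eq_zero.1 this.symm)
  obtain ⟨c, c0, hc⟩ := (isCompact_Icc.prod isCompact_Icc).exists_forall_le'
    (s := Set.Icc 0 (2 * π) ×ˢ Set.Icc (-π) π) (continuous_meanVel hs).norm.continuousOn
    (a := 0) (fun z hz => norm_pos_iff.2 (hne z.1 z.2 (abs_le.2 (Set.mem_prod.1 hz).2)))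
  refine ⟨c, c0, fun t τ hτ => ?_⟩
  obtain ⟨s, hs', e⟩ := periodic_pair (Γ.periodic i) t
  have e0 := (e 0).1
  rw [add_zero, add_zero] at e0
  rw [(e τ).1, e0, ← smul_meanVel hs, norm_smul, Real.norm_eq_abs, mul_comm]
  have : c ≤ ‖meanVel (Γ.curve i) s τ‖ := hc (s, τ) (Set.mk_mem_prod hs' (abs_le.1 hτ))
  gcongr

theorem exists_chord_ne {i j : ι} (hij : i ≠ j) : ∃ δ : ℝ, 0 < δ ∧ ∀ t s,
    δ ≤ ‖Γ.curve j s - Γ.curve i t‖ := by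
  obtain ⟨c, c0, hc⟩ := (isCompact_Icc.prod isCompact_Icc).exists_forall_le'
    (s := Set.Icc 0 (2 * π) ×ˢ Set.Icc 0 (2 * π))
    (f := fun z : ℝ × ℝ => ‖Γ.curve j z.2 - Γ.curve i z.1‖)
    (((Γ.smooth j).continuous.comp continuous_snd).sub
      ((Γ.smooth i).continuous.comp continuous_fst)).norm.continuousOn (a := 0)
    (fun z _ => norm_pos_iff.2 (sub_ne_zero.2 fun h => hij (Γ.simple _ _ _ _ h).1.symm))
  refine ⟨c, c0, fun t s => ?_⟩
  obtain ⟨t', ht, e⟩ := periodic_pair (Γ.periodic i) t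
  obtain ⟨s', hs, e'⟩ := periodic_pair (Γ.periodic j) s
  have e0 := (e 0).1
  have e1 := (e' 0).1
  rw [add_zero, add_zero] at e0 e1
  rw [e0, e1]
  exact hc (t', s') (Set.mk_mem_prod ht hs)

/-- For disjoint components the chord is at least some `δ`, so both bounds are trivial, the factor
`1/π` accounting for `|τ| ≤ π`. Thus one structure covers equal and distinct components. -/
theorem exists_chord_const (i j : ι) : ∃ z : ℝ × ℝ, 0 < z.1 ∧ 0 ≤ z.2 ∧
    (∀ t τ, |τ| ≤ π → z.1 * |τ| ≤ ‖Γ.curve j (t + τ) - Γ.curve i t‖) ∧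
    ∀ t τ, |τ| ≤ π → ‖deriv (Γ.curve j) (t + τ) - deriv (Γ.curve i) t‖
      ≤ z.2 * ‖Γ.curve j (t + τ) - Γ.curve i t‖ := by
  rcases eq_or_ne i j with rfl | hij
  · obtain ⟨c, c0, hc⟩ := Γ.exists_chord_self i
    obtain ⟨N, N0, hN⟩ := exists_bound_of_periodic
      (contDiff_deriv (contDiff_deriv (Γ.smooth i))).continuous
      (periodic_deriv (periodic_deriv (Γ.periodic i)))
    refine ⟨(c, N / c), c0, by positivity, hc, fun t τ hτ => ?_⟩
    have := convex_univ.norm_image_sub_le_of_norm_hasDerivWithin_le (f := deriv (Γ.curve i))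
      (fun x _ => (hasDerivAt_of_smooth (contDiff_deriv (Γ.smooth i)) x).hasDerivWithinAt)
      (fun x _ => hN x) (Set.mem_univ t) (Set.mem_univ (t + τ))
    rw [add_sub_cancel_left, Real.norm_eq_abs] at this
    calc _ ≤ N * |τ| := this
      _ = N / c * (c * |τ|) := by field_simp
      _ ≤ _ := by have := hc t τ hτ; gcongr
  · obtain ⟨δ, δ0, hδ⟩ := Γ.exists_chord_ne hij
    obtain ⟨M, M0, hM⟩ := exists_bound_of_periodic
      (contDiff_deriv (Γ.smooth i)).continuous (periodic_deriv (Γ.periodic i))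
    obtain ⟨N, N0, hN⟩ := exists_bound_of_periodic
      (contDiff_deriv (Γ.smooth j)).continuous (periodic_deriv (Γ.periodic j))
    refine ⟨(δ / π, (N + M) / δ), by positivity, by positivity, fun t τ hτ => ?_, fun t τ _ => ?_⟩
    · calc δ / π * |τ| ≤ δ / π * π := by gcongr
        _ = δ := by field_simp
        _ ≤ _ := hδ t (t + τ)
    · calc _ ≤ N + M := (norm_sub_le _ _).trans (add_le_add (hN _) (hM _))
        _ = (N + M) / δ * δ := by field_simp
        _ ≤ _ := by have := hδ t (t + τ); gcongr

/-- The pair formed by two components of the boundary. -/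
def pair (i j : ι) : ChordPair where
  X := Γ.curve i
  Y := Γ.curve j
  hX := Γ.smooth i
  hY := Γ.smooth j
  pX := Γ.periodic i
  pY := Γ.periodic j
  c := (Γ.exists_chord_const i j).choose.1
  C := (Γ.exists_chord_const i j).choose.2
  c_pos := (Γ.exists_chord_const i j).choose_spec.1
  C_nonneg := (Γ.exists_chord_const i j).choose_spec.2.1
  chord_ge := (Γ.exists_chord_const i j).choose_spec.2.2.1
  deriv_le := (Γ.exists_chord_const i j).choose_spec.2.2.2

variable {Γ} {p : Plane → ℂ}

/-- A function of class `C^{1,a}` on a component of the boundary. -/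
def IsC1Holder.density (hp : Γ.IsC1Holder p) (j : ι) : Density where
  Q := fun t => p (Γ.curve j t)
  q := deriv fun t => p (Γ.curve j t)
  hQ := fun t => (hp.1 j t).hasDerivAt
  pQ := fun t => congrArg p (Γ.periodic j t)
  pq := fun t => deriv_periodic (fun t => congrArg p (Γ.periodic j t)) t
  a := hp.2.choose_spec.choose
  H := hp.2.choose
  a_pos := by exact_mod_cast hp.2.choose_spec.choose_spec.1
  H_nonneg := NNReal.coe_nonneg _
  holder := fun s t => by
    have := (hp.2.choose_spec.choose_spec.2 j).dist_le s t
    rwa [dist_eq_norm, Real.dist_eq] at this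

variable (Γ)

theorem mem_frontier (i : ι) (t : ℝ) : Γ.curve i t ∈ frontier Ω := by
  rw [← Γ.range_eq]; exact Set.mem_iUnion.2 ⟨i, t, rfl⟩

theorem exists_param {x : Plane} (hx : x ∈ frontier Ω) : ∃ i t, Γ.curve i t = x := by
  rw [← Γ.range_eq] at hx
  obtain ⟨i, t, h⟩ := Set.mem_iUnion.1 hx
  exact ⟨i, t, h⟩

theorem speed_ne (i : ι) (t : ℝ) : ((‖deriv (Γ.curve i) t‖ : ℝ) : ℂ) ≠ 0 := by
  simpa using Γ.regular i t

theorem d_eq (i j : ι) (t τ : ℝ) : (Γ.pair i j).d t τ = Γ.curve j (t + τ) - Γ.curve i t := rfl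

theorem sq_eq (i j : ι) (t τ : ℝ) :
    (Γ.pair i j).sq t τ = ‖Γ.curve i t - Γ.curve j (t + τ)‖ ^ 2 := by
  rw [ChordPair.sq, d_eq, norm_sub_rev]

theorem ne_of_mem {i j : ι} {t τ : ℝ} (h : τ ∈ puncPeriod) : Γ.curve i t ≠ Γ.curve j (t + τ) := by
  intro h'
  have := (Γ.pair i j).norm_d_pos (t := t) h
  rw [d_eq, h', sub_self, norm_zero] at this
  exact this.false

/-- The arc length integral over a period centred at any parameter. -/
theorem integral_eq_shift [Fintype ι] (g : Plane → ℂ) (t : ℝ) :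
    Γ.integral g = ∑ j, ∫ τ in (-π)..π,
      g (Γ.curve j (t + τ)) * ((‖deriv (Γ.curve j) (t + τ)‖ : ℝ) : ℂ) := by
  rw [integral]
  refine Finset.sum_congr rfl fun j _ => ?_
  set h : ℝ → ℂ := fun s => g (Γ.curve j s) * ((‖deriv (Γ.curve j) s‖ : ℝ) : ℂ) with hh
  have hp : Function.Periodic h (2 * π) := fun s => by
    simp only [hh]
    rw [Γ.periodic j, periodic_deriv (Γ.periodic j)]
  have h1 := hp.intervalIntegral_add_eq 0 (t + -π)
  have h2 := intervalIntegral.integral_comp_add_left h (a := -π) (b := π) t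
  rw [zero_add] at h1
  rw [show t + -π + 2 * π = t + π by ring] at h1
  exact h1.trans h2.symm

theorem ds_mul_speed (f : Plane → ℂ) (j : ι) (s : ℝ) :
    Γ.ds f (Γ.curve j s) * ((‖deriv (Γ.curve j) s‖ : ℝ) : ℂ) = deriv (fun s => f (Γ.curve j s)) s := by
  rw [ds_curve, div_mul_cancel₀ _ (Γ.speed_ne j s)]

theorem rot_normal (i : ι) (t : ℝ) :
    rot (Γ.normal (Γ.curve i t)) = (‖deriv (Γ.curve i) t‖)⁻¹ • deriv (Γ.curve i) t := by
  rw [normal_curve, normalOf, rot]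
  ext k
  fin_cases k <;> simp

variable (P : Medium) (k₁ k₂ : ℂ)

theorem kerN42_eq (h1 : k₁ ≠ 0) (h2 : k₂ ≠ 0) {x y : Plane} (h : x ≠ y) :
    SmoothBoundary.kerN42 P k₁ k₂ x y = (P.prof2 k₁ k₂).val (‖x - y‖ ^ 2) := by
  rw [kerN42, Medium.profD_val h1 h2 h, P.profG_val h1 h2 h, Medium.prof2, LogProfile.lin_val,
    Medium.cD]
  ring

/-- The speed in the arc length measure cancels the one in `dp/ds`, so the density is the plain
parameter derivative of `p`. -/
theorem op_kerN42 [Fintype ι] (h1 : k₁ ≠ 0) (h2 : k₂ ≠ 0) (hp : Γ.IsC1Holder p) (i : ι) (t : ℝ) :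
    Γ.op (SmoothBoundary.kerN42 P k₁ k₂) (Γ.ds p) (Γ.curve i t)
      = ∑ j, (Γ.pair i j).pot (P.prof2 k₁ k₂) (hp.density j) t := by
  rw [op, Γ.integral_eq_shift _ t]
  refine Finset.sum_congr rfl fun j _ => ?_
  refine intervalIntegral.integral_congr_ae ?_
  filter_upwards [ae_mem_puncPeriod] with τ h3 h4
  rw [kerN42_eq P k₁ k₂ h1 h2 (Γ.ne_of_mem (h3 h4)), mul_assoc, Γ.ds_mul_speed, Γ.sq_eq]
  rfl

/-- For a kernel without leading singularity, integration by parts produces no further term. -/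
theorem _root_.Poro.ChordPair.pot_eq_of_zero (S : ChordPair) (F : LogProfile) (f : Density)
    (hF : F.A 0 = 0) (t : ℝ) :
    S.pot F f t = -∫ τ in (-π)..π, S.ker F t τ * f.Q (t + τ) := by
  have hint : IntervalIntegrable (fun τ => S.ker F t τ * f.Q (t + τ)) volume (-π) π := by
    obtain ⟨D, D0, hD⟩ := S.exists_chord_bound
    obtain ⟨C, C0, hC⟩ := F.exists_bound_of_zero hF (D ^ 2)
    obtain ⟨M, M0, hM⟩ := exists_bound_of_periodic (contDiff_deriv S.hY).continuous
      (periodic_deriv S.pY)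
    obtain ⟨N, N0, hN⟩ := exists_bound_of_periodic f.continuous_Q f.pQ
    have c0 := S.c_pos
    refine intervalIntegrable_of_bound
      ((S.continuousOn_ker F t).mul (f.continuous_shift_Q t).continuousOn) (fun τ h => ?_)
      ((intervalIntegrable_abs_rpow (b := -(1 / 2)) (by norm_num)).const_mul
        (C * S.c ^ (-(1 / 2) : ℝ) * (2 * (D * M)) * N))
    have hd := S.norm_d_pos (t := t) h
    have b1 := (hC (S.sq t τ) (S.sq_pos h) (pow_le_pow_left₀ hd.le (hD t τ) 2)).1
    have e1 : ‖((S.sqτ t τ : ℝ) : ℂ)‖ ≤ 2 * (D * M) := by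
      rw [Complex.norm_real, Real.norm_eq_abs, ChordPair.sqτ, abs_mul, abs_two]
      gcongr
      exact (abs_real_inner_le_norm _ _).trans (mul_le_mul (hD t τ) (hM _) (norm_nonneg _) D0)
    rw [norm_mul, ChordPair.ker, norm_mul]
    calc _ ≤ C * (S.c ^ (-(1 / 2) : ℝ) * |τ| ^ (-(1 / 2) : ℝ)) * (2 * (D * M)) * N := by
          refine mul_le_mul (mul_le_mul (b1.trans ?_) e1 (norm_nonneg _) (by positivity)) (hN _)
            (norm_nonneg _) (by positivity)
          have := S.rpow_le (t := t) h
          gcongr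
      _ = _ := by ring
  -- With `F.A 0 = 0` the profile is continuous through the singular point, so the boundary terms
  -- cancel without subtracting `Q(t)`.
  have hc : Continuous (fun τ => F.val (S.sq t τ) * f.Q (t + τ)) := by
    refine Continuous.mul ?_ (f.continuous_shift_Q t)
    exact (F.continuousAt_val_zero hF).comp_continuous (S.continuous_sq t) fun τ => pow_two_nonneg ‖S.d t τ‖
  have key := integral_eq_of_hasDerivAt_off_countable
    (fun τ => F.val (S.sq t τ) * f.Q (t + τ))
    (fun τ => S.ker F t τ * f.Q (t + τ) + F.val (S.sq t τ) * f.q (t + τ)) (s := {0})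
    (Set.countable_singleton 0) hc.continuousOn
    (fun τ hτ => by
      rw [min_eq_left (by linarith [pi_pos]), max_eq_right (by linarith [pi_pos])] at hτ
      have h1 := S.hasDerivAt_val F (t := t) (S.sq_pos ⟨Set.Ioo_subset_Icc_self hτ.1, hτ.2⟩).ne'
      exact h1.mul (f.hasDerivAt_shift t τ))
    (hint.add (S.intervalIntegrable_pot F f t))
  rw [intervalIntegral.integral_add hint
    (S.intervalIntegrable_pot F f t), S.sq_ends, periodic_ends f.pQ, sub_self] at key
  rw [ChordPair.pot]
  linear_combination key

theorem rotA_mulVec (n d : Plane) :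
    cvec d ⬝ᵥ rotA.mulVec (cvec n) = ((inner ℝ d (rot n) : ℝ) : ℂ) := by
  simp [cvec, rotA, rot, Matrix.mulVec, dotProduct, Fin.sum_univ_two, PiLp.inner_apply]
  ring

theorem kerN43_eq (h1 : k₁ ≠ 0) (h2 : k₂ ≠ 0) {x y : Plane} (h : x ≠ y) :
    Γ.kerN43 P k₁ k₂ x y = P.cD k₁ k₂ * (2 * (Medium.profD k₁ k₂).d1 (‖x - y‖ ^ 2)
      * ((inner ℝ (x - y) (rot (Γ.normal y)) : ℝ) : ℂ)) := by
  have e : grad (fun z => helmholtz k₁ z y - helmholtz k₂ z y) x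
      = (2 * (Medium.profD k₁ k₂).d1 (‖x - y‖ ^ 2)) • cvec (x - y) :=
    funext fun i => Medium.grad_eq h1 h2 h i
  rw [kerN43, e, smul_dotProduct, rotA_mulVec, smul_eq_mul, Medium.cD]

/-- `Aν_y` is the unit tangent at `y`, so the kernel times the speed is `-cD ∂_s` of the profile of
`γ_{k₁} - γ_{k₂}`. Integration by parts moves the derivative onto `p`. -/
theorem op_kerN43 [Fintype ι] (h1 : k₁ ≠ 0) (h2 : k₂ ≠ 0) (hp : Γ.IsC1Holder p) (i : ι) (t : ℝ) :
    Γ.op (Γ.kerN43 P k₁ k₂) p (Γ.curve i t)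
      = P.cD k₁ k₂ * ∑ j, (Γ.pair i j).pot (Medium.profD k₁ k₂) (hp.density j) t := by
  rw [op, Γ.integral_eq_shift _ t, Finset.mul_sum]
  refine Finset.sum_congr rfl fun j _ => ?_
  rw [ChordPair.pot_eq_of_zero _ _ _ (Medium.profD_A_zero k₁ k₂), ← intervalIntegral.integral_neg,
    ← intervalIntegral.integral_const_mul]
  refine intervalIntegral.integral_congr_ae ?_
  filter_upwards [ae_mem_puncPeriod] with τ h3 h4
  have hs := Γ.speed_ne j (t + τ)
  rw [Γ.kerN43_eq P k₁ k₂ h1 h2 (Γ.ne_of_mem (h3 h4)), ChordPair.ker, Γ.sq_eq, Γ.rot_normal,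
    ChordPair.sqτ, real_inner_smul_right, d_eq, ← neg_sub (Γ.curve j (t + τ)), inner_neg_left]
  change _ = P.cD k₁ k₂ * -(_ * ((2 * inner ℝ (Γ.curve j (t + τ) - Γ.curve i t)
    (deriv (Γ.curve j) (t + τ)) : ℝ) : ℂ) * p (Γ.curve j (t + τ)))
  rw [neg_sub]
  push_cast
  field_simp

end SmoothBoundary

end Poro

namespace Poro

open MeasureTheory Real

/-! ### Weakly singular kernels -/

/-- The pairs of distinct points of a set. -/
def offDiag (S : Set Plane) : Set (Plane × Plane) := {z | z.1 ∈ S ∧ z.2 ∈ S ∧ z.1 ≠ z.2}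

/-- Kernels bounded by a multiple of `|x - y|^{-1/2}`. -/
def IsHalfSingular (S : Set Plane) (k : Plane → Plane → ℂ) : Prop :=
  ContinuousOn (fun z : Plane × Plane => k z.1 z.2) (offDiag S) ∧
    ∃ C : ℝ, 0 ≤ C ∧ ∀ x ∈ S, ∀ y ∈ S, x ≠ y → ‖k x y‖ ≤ C * (‖x - y‖ ^ 2) ^ (-(1 / 4) : ℝ)

/-- Bounded continuous kernels. -/
def IsBoundedKernel (S : Set Plane) (g : Plane → Plane → ℂ) : Prop :=
  ContinuousOn (fun z : Plane × Plane => g z.1 z.2) (offDiag S) ∧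
    ∃ M : ℝ, 0 ≤ M ∧ ∀ x ∈ S, ∀ y ∈ S, ‖g x y‖ ≤ M

namespace IsHalfSingular

variable {S : Set Plane} {k l g : Plane → Plane → ℂ}

theorem congr (hk : IsHalfSingular S k) (h : ∀ x ∈ S, ∀ y ∈ S, x ≠ y → l x y = k x y) :
    IsHalfSingular S l := by
  obtain ⟨h1, C, C0, hC⟩ := hk
  refine ⟨h1.congr fun z hz => h _ hz.1 _ hz.2.1 hz.2.2, C, C0, fun x hx y hy hxy => ?_⟩
  rw [h x hx y hy hxy]
  exact hC x hx y hy hxy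

theorem add (hk : IsHalfSingular S k) (hl : IsHalfSingular S l) :
    IsHalfSingular S fun x y => k x y + l x y := by
  obtain ⟨h1, C, C0, hC⟩ := hk
  obtain ⟨h2, D, D0, hD⟩ := hl
  refine ⟨h1.add h2, C + D, by positivity, fun x hx y hy hxy => ?_⟩
  rw [add_mul]
  exact (norm_add_le _ _).trans (add_le_add (hC x hx y hy hxy) (hD x hx y hy hxy))

theorem mul (hk : IsHalfSingular S k) (hg : IsBoundedKernel S g) :
    IsHalfSingular S fun x y => k x y * g x y := by
  obtain ⟨h1, C, C0, hC⟩ := hk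
  obtain ⟨h2, M, M0, hM⟩ := hg
  refine ⟨h1.mul h2, C * M, by positivity, fun x hx y hy hxy => ?_⟩
  rw [norm_mul, mul_right_comm]
  exact mul_le_mul (hC x hx y hy hxy) (hM x hx y hy) (norm_nonneg _) (by positivity)

theorem const_mul (hk : IsHalfSingular S k) (a : ℂ) : IsHalfSingular S fun x y => a * k x y := by
  have : IsBoundedKernel S fun _ _ => a :=
    ⟨continuousOn_const, ‖a‖, norm_nonneg a, fun _ _ _ _ => le_rfl⟩
  exact (hk.mul this).congr fun x _ y _ _ => mul_comm _ _

theorem isWeaklySingular (hk : IsHalfSingular S k) : IsWeaklySingular S k := by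
  obtain ⟨h1, C, C0, hC⟩ := hk
  refine ⟨h1, C, 1 / 2, by norm_num, by norm_num, fun x hx y hy hxy => ?_⟩
  have := hC x hx y hy hxy
  rw [← Real.rpow_natCast, ← Real.rpow_mul (norm_nonneg _), ← dist_eq_norm] at this
  norm_num at this ⊢
  exact this

end IsHalfSingular

theorem continuousOn_normSq (S : Set Plane) :
    ContinuousOn (fun z : Plane × Plane => ‖z.1 - z.2‖ ^ 2) (offDiag S) := by
  fun_prop

theorem mapsTo_normSq (S : Set Plane) :
    Set.MapsTo (fun z : Plane × Plane => ‖z.1 - z.2‖ ^ 2) (offDiag S) {0}ᶜ :=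
  fun _ hz => LogProfile.sq_ne hz.2.2

theorem exists_norm_bound {S : Set Plane} (hS : Bornology.IsBounded S) :
    ∃ D : ℝ, 0 ≤ D ∧ ∀ x ∈ S, ∀ y ∈ S, ‖x - y‖ ≤ D := by
  obtain ⟨D, hD⟩ := Metric.isBounded_iff.1 hS
  refine ⟨max D 0, le_max_right _ _, fun x hx y hy => ?_⟩
  rw [← dist_eq_norm]
  exact (hD hx hy).trans (le_max_left _ _)

theorem norm_coord_le (d : Plane) (i : Fin 2) : ‖((d i : ℝ) : ℂ)‖ ≤ ‖d‖ := by
  rw [Complex.norm_real]; exact PiLp.norm_apply_le d i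

namespace LogProfile

variable (F : LogProfile) {S : Set Plane}

theorem normSq_pos {x y : Plane} (h : x ≠ y) : 0 < ‖x - y‖ ^ 2 :=
  pow_pos (norm_pos_iff.2 (sub_ne_zero.2 h)) 2

theorem isHalfSingular_val (hS : Bornology.IsBounded S) :
    IsHalfSingular S fun x y => F.val (‖x - y‖ ^ 2) := by
  obtain ⟨D, D0, hD⟩ := exists_norm_bound hS
  obtain ⟨C, C0, hC⟩ := F.exists_bound (D ^ 2)
  refine ⟨F.continuousOn_val.comp (continuousOn_normSq S) (mapsTo_normSq S), C, C0,
    fun x hx y hy hxy => ?_⟩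
  exact (hC _ (normSq_pos hxy) (pow_le_pow_left₀ (norm_nonneg _) (hD x hx y hy) 2)).1

theorem isHalfSingular_d1 (hF : F.A 0 = 0) (hS : Bornology.IsBounded S) :
    IsHalfSingular S fun x y => F.d1 (‖x - y‖ ^ 2) := by
  obtain ⟨D, D0, hD⟩ := exists_norm_bound hS
  obtain ⟨C, C0, hC⟩ := F.exists_bound_of_zero hF (D ^ 2)
  refine ⟨F.continuousOn_d1.comp (continuousOn_normSq S) (mapsTo_normSq S), C, C0,
    fun x hx y hy hxy => ?_⟩
  exact (hC _ (normSq_pos hxy) (pow_le_pow_left₀ (norm_nonneg _) (hD x hx y hy) 2)).1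

theorem continuous_coord (i : Fin 2) :
    Continuous fun z : Plane × Plane => (((z.1 - z.2) i : ℝ) : ℂ) :=
  Complex.continuous_ofReal.comp
    ((EuclideanSpace.proj i : Plane →L[ℝ] ℝ).continuous.comp (continuous_fst.sub continuous_snd))

/-- The two coordinates multiplying `F''` supply the factor `|x-y|²` with which `F''` is only as
singular as the logarithm. -/
theorem isHalfSingular_hess (hF : F.A 0 = 0) (hS : Bornology.IsBounded S) (i j : Fin 2) :
    IsHalfSingular S fun x y => F.hess (x - y) i j := by
  obtain ⟨D, D0, hD⟩ := exists_norm_bound hS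
  obtain ⟨C, C0, hC⟩ := F.exists_bound_of_zero hF (D ^ 2)
  have h2 := F.continuousOn_d2.comp (continuousOn_normSq S) (mapsTo_normSq S)
  have h1 := F.continuousOn_d1.comp (continuousOn_normSq S) (mapsTo_normSq S)
  refine ⟨?_, 6 * C, by positivity, fun x hx y hy hxy => ?_⟩
  · exact (((continuousOn_const.mul h2).mul (continuous_coord i).continuousOn).mul
      (continuous_coord j).continuousOn).add ((continuousOn_const.mul h1).mul continuousOn_const)
  · obtain ⟨b1, b2⟩ := hC _ (normSq_pos hxy) (pow_le_pow_left₀ (norm_nonneg _) (hD x hx y hy) 2)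
    have hd : ‖(((1 : Matrix (Fin 2) (Fin 2) ℂ) i j))‖ ≤ 1 := by
      rw [Matrix.one_apply]; split_ifs <;> simp
    change ‖F.hess (x - y) i j‖ ≤ _
    generalize x - y = d at *
    rw [hess]
    refine (norm_add_le _ _).trans ?_
    simp only [norm_mul, Complex.norm_ofNat]
    have c1 := norm_coord_le d i
    have c2 := norm_coord_le d j
    calc _ ≤ 4 * ‖F.d2 (‖d‖ ^ 2)‖ * ‖d‖ * ‖d‖ + 2 * ‖F.d1 (‖d‖ ^ 2)‖ * 1 := by gcongr
      _ = 4 * (‖d‖ ^ 2 * ‖F.d2 (‖d‖ ^ 2)‖) + 2 * ‖F.d1 (‖d‖ ^ 2)‖ := by ring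
      _ ≤ 4 * (C * (‖d‖ ^ 2) ^ (-(1 / 4) : ℝ)) + 2 * (C * (‖d‖ ^ 2) ^ (-(1 / 4) : ℝ)) := by gcongr
      _ = _ := by ring

end LogProfile

namespace SmoothBoundary

variable {Ω : Set Plane} {ι : Type*} (Γ : SmoothBoundary Ω ι)

theorem norm_normalOf_le (v : Plane) : ‖normalOf v‖ ≤ 1 := by
  have h : ‖(!₂[v 1, -v 0] : Plane)‖ = ‖v‖ := by
    rw [EuclideanSpace.norm_eq, EuclideanSpace.norm_eq]
    simp [Fin.sum_univ_two, add_comm]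
  rw [normalOf, norm_smul, h, norm_inv, norm_norm]
  exact inv_mul_le_one

theorem norm_normal_le {x : Plane} (hx : x ∈ frontier Ω) : ‖Γ.normal x‖ ≤ 1 := by
  obtain ⟨i, t, rfl⟩ := Γ.exists_param hx
  rw [normal_curve]
  exact norm_normalOf_le _

/-- The unit normal is continuous on the boundary. -/
theorem continuousOn_normal [Finite ι] : ContinuousOn Γ.normal (frontier Ω) := by
  -- The finite index set is made discrete so that the disjoint union of the parameter intervals
  -- becomes a compact space.
  let _ : TopologicalSpace ι := ⊥
  have : DiscreteTopology ι := ⟨rfl⟩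
  let φ : ι × Set.Icc (0 : ℝ) (2 * π) → frontier Ω :=
    fun z => ⟨Γ.curve z.1 z.2, Γ.mem_frontier z.1 z.2⟩
  have hφ : Continuous φ := by
    refine Continuous.subtype_mk ?_ _
    refine continuous_prod_of_discrete_left.2 fun i => ?_
    exact (Γ.smooth i).continuous.comp continuous_subtype_val
  have hsurj : Function.Surjective φ := by
    rintro ⟨x, hx⟩
    obtain ⟨i, t, rfl⟩ := Γ.exists_param hx
    obtain ⟨s, hs, e⟩ := periodic_pair (Γ.periodic i) t
    refine ⟨(i, ⟨s, hs⟩), Subtype.ext ?_⟩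
    have := (e 0).1
    rw [add_zero, add_zero] at this
    exact this.symm
  -- A continuous surjection from a compact space onto a Hausdorff space is a quotient map, so
  -- continuity of the normal may be tested on the parameters.
  have hq := hφ.isClosedMap.isQuotientMap hφ hsurj
  rw [continuousOn_iff_continuous_domRestrict, hq.continuous_iff]
  refine continuous_prod_of_discrete_left.2 fun i => ?_
  have e : (fun s : Set.Icc (0 : ℝ) (2 * π) => ((frontier Ω).domRestrict Γ.normal ∘ φ) (i, s))
      = fun s : Set.Icc (0 : ℝ) (2 * π) => normalOf (deriv (Γ.curve i) (s : ℝ)) := funext fun s => Γ.normal_curve i s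
  rw [e]
  have hc : Continuous fun s : ℝ => normalOf (deriv (Γ.curve i) s) := by
    have h1 := (contDiff_deriv (Γ.smooth i)).continuous
    refine Continuous.smul (h1.norm.inv₀ fun s => norm_ne_zero_iff.2 (Γ.regular i s)) ?_
    have hk : ∀ k, Continuous fun s => deriv (Γ.curve i) s k := fun k =>
      (EuclideanSpace.proj k : Plane →L[ℝ] ℝ).continuous.comp h1
    refine (PiLp.continuous_toLp 2 _).comp (continuous_pi fun k => ?_)
    fin_cases k
    · exact hk 1
    · exact (hk 0).neg
  exact hc.comp continuous_subtype_val

theorem continuousOn_normal_coord [Finite ι] (i : Fin 2) :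
    ContinuousOn (fun x => ((Γ.normal x i : ℝ) : ℂ)) (frontier Ω) :=
  (Complex.continuous_ofReal.comp (EuclideanSpace.proj i : Plane →L[ℝ] ℝ).continuous).comp_continuousOn
    Γ.continuousOn_normal

theorem isBoundedKernel_left [Finite ι] (i : Fin 2) :
    IsBoundedKernel (frontier Ω) fun x _ => ((Γ.normal x i : ℝ) : ℂ) :=
  ⟨(Γ.continuousOn_normal_coord i).comp continuousOn_fst fun _ hz => hz.1, 1, zero_le_one,
    fun _ hx _ _ => (norm_coord_le _ i).trans (Γ.norm_normal_le hx)⟩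

theorem isBoundedKernel_right [Finite ι] (i : Fin 2) :
    IsBoundedKernel (frontier Ω) fun _ y => ((Γ.normal y i : ℝ) : ℂ) :=
  ⟨(Γ.continuousOn_normal_coord i).comp continuousOn_snd fun _ hz => hz.2.1, 1, zero_le_one,
    fun _ _ _ hy => (norm_coord_le _ i).trans (Γ.norm_normal_le hy)⟩

theorem isBoundedKernel_sub {S : Set Plane} (hS : Bornology.IsBounded S) (i : Fin 2) :
    IsBoundedKernel S fun x y => (((x - y) i : ℝ) : ℂ) := by
  obtain ⟨D, D0, hD⟩ := exists_norm_bound hS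
  exact ⟨(LogProfile.continuous_coord i).continuousOn, D, D0,
    fun x hx y hy => (norm_coord_le _ i).trans (hD x hx y hy)⟩

variable (P : Medium) {k₁ k₂ : ℂ}

theorem isHalfSingular_kerN42 (h1 : k₁ ≠ 0) (h2 : k₂ ≠ 0) {S : Set Plane}
    (hS : Bornology.IsBounded S) : IsHalfSingular S (SmoothBoundary.kerN42 P k₁ k₂) :=
  ((P.prof2 k₁ k₂).isHalfSingular_val hS).congr fun _ _ _ _ hxy => kerN42_eq P k₁ k₂ h1 h2 hxy

theorem isHalfSingular_kerN43 [Finite ι] (h1 : k₁ ≠ 0) (h2 : k₂ ≠ 0)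
    (hS : Bornology.IsBounded (frontier Ω)) :
    IsHalfSingular (frontier Ω) (Γ.kerN43 P k₁ k₂) := by
  have hd := (Medium.profD k₁ k₂).isHalfSingular_d1 (Medium.profD_A_zero k₁ k₂) hS
  have e0 := ((hd.mul (isBoundedKernel_sub hS 1)).mul (Γ.isBoundedKernel_right 0)).const_mul
    (P.cD k₁ k₂ * 2)
  have e1 := ((hd.mul (isBoundedKernel_sub hS 0)).mul (Γ.isBoundedKernel_right 1)).const_mul
    (-(P.cD k₁ k₂ * 2))
  refine (e0.add e1).congr fun x _ y _ hxy => ?_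
  rw [Γ.kerN43_eq P k₁ k₂ h1 h2 hxy]
  simp [rot, PiLp.inner_apply, Fin.sum_univ_two]
  ring

theorem isHalfSingular_helmholtz {k : ℂ} (hk : k ≠ 0) {S : Set Plane}
    (hS : Bornology.IsBounded S) : IsHalfSingular S (helmholtz k) :=
  ((helmProfile k).isHalfSingular_val hS).congr fun _ _ _ _ hxy => helmholtz_eq_profile hk hxy

theorem isHalfSingular_E11 (h1 : k₁ ≠ 0) (h2 : k₂ ≠ 0) (hne : k₁ ^ 2 ≠ k₂ ^ 2) {S : Set Plane}
    (hS : Bornology.IsBounded S) (i j : Fin 2) :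
    IsHalfSingular S fun x y => P.E11 k₁ k₂ x y i j := by
  have hv := ((helmProfile P.ks).isHalfSingular_val hS).const_mul
    (1 / P.mu * (1 : Matrix (Fin 2) (Fin 2) ℂ) i j)
  have hh := ((P.profPhi k₁ k₂).isHalfSingular_hess (P.profPhi_A_zero k₁ k₂ hne) hS i j).const_mul
    (1 / (P.rhoEff * P.omega ^ 2))
  refine (hv.add hh).congr fun x _ y _ hxy => ?_
  rw [P.E11_eq h1 h2 hxy]
  ring

theorem isHalfSingular_kerN41 [Finite ι] (h1 : k₁ ≠ 0) (h2 : k₂ ≠ 0) (hne : k₁ ^ 2 ≠ k₂ ^ 2)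
    (hS : Bornology.IsBounded (frontier Ω)) :
    IsHalfSingular (frontier Ω) (Γ.kerN41 P k₁ k₂) := by
  have hE := fun i j => (((isHalfSingular_E11 P h1 h2 hne hS i j).mul
    (Γ.isBoundedKernel_left i)).mul (Γ.isBoundedKernel_right j)).const_mul
    (Complex.I * P.omega * P.beta ^ 2)
  have hH := ((isHalfSingular_helmholtz h1 hS).const_mul
      (2 * P.cD k₁ k₂ * k₁ ^ 2 - P.C4 k₁ k₂ * (P.kp ^ 2 - k₁ ^ 2) * k₁ ^ 2)).add
    ((isHalfSingular_helmholtz h2 hS).const_mul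
      (-(2 * P.cD k₁ k₂ * k₂ ^ 2) + P.C4 k₁ k₂ * (P.kp ^ 2 - k₂ ^ 2) * k₂ ^ 2))
  have hN := fun i => (hH.mul (Γ.isBoundedKernel_left i)).mul (Γ.isBoundedKernel_right i)
  refine (((((hE 0 0).add (hE 0 1)).add (hE 1 0)).add (hE 1 1)).add ((hN 0).add (hN 1))).congr
    fun x _ y _ _ => ?_
  simp only [kerN41, normalDot, cvec, Matrix.mulVec, dotProduct, Fin.sum_univ_two, Medium.cD]
  ring

end SmoothBoundary

end Poro

/-! ### Assembly of the regularized formula. -/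

namespace Poro

open MeasureTheory Real

theorem ChordPair.pot_lin (S : ChordPair) (a b : ℂ) (F G : LogProfile) (f : Density) (t : ℝ) :
    S.pot (.lin a F b G) f t = a * S.pot F f t + b * S.pot G f t := by
  rw [pot, pot, pot, ← intervalIntegral.integral_const_mul, ← intervalIntegral.integral_const_mul,
    ← intervalIntegral.integral_add ((S.intervalIntegrable_pot F f t).const_mul a)
      ((S.intervalIntegrable_pot G f t).const_mul b)]
  simp only [LogProfile.lin_val]
  congr 1; funext τ; ring

/-- Away from the singular point the hypersingular integrand is integrable. -/
theorem ChordPair.intervalIntegrable_cut_hyper (S : ChordPair) (F : LogProfile) (f : Density)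
    (t : ℝ) {r : ℝ} (hr : 0 < r) : IntervalIntegrable (Set.indicator {τ | r < ‖S.d t τ‖}
      (fun τ => S.hyper F t τ * f.Q (t + τ))) volume (-π) π := by
  have hπ : -π ≤ π := by linarith [pi_pos]
  have hS : MeasurableSet {τ | r < ‖S.d t τ‖} :=
    (isOpen_lt continuous_const (S.continuous_d t).norm).measurableSet
  -- The closed condition `r ≤ |d|` is used for compactness; `reg` is continuous there because the
  -- chord stays away from zero.
  have hK : IsCompact (Set.Icc (-π) π ∩ {τ | r ≤ ‖S.d t τ‖}) :=
    isCompact_Icc.inter_right (isClosed_le continuous_const (S.continuous_d t).norm)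
  have hne : ∀ τ, r ≤ ‖S.d t τ‖ → S.sq t τ ≠ 0 := fun τ h => (pow_pos (hr.trans_le h) 2).ne'
  have hreg : IntegrableOn (S.reg F f t) (Set.Icc (-π) π ∩ {τ | r ≤ ‖S.d t τ‖}) :=
    ContinuousOn.integrableOn_compact hK fun τ hτ =>
      (S.continuousAt_reg F f (hne τ hτ.2)).continuousWithinAt
  have hsub : {τ | r < ‖S.d t τ‖} ∩ Set.Ioc (-π) π ⊆ Set.Icc (-π) π ∩ {τ | r ≤ ‖S.d t τ‖} :=
    fun τ hτ => ⟨Set.Ioc_subset_Icc_self hτ.2, (show r < ‖S.d t τ‖ from hτ.1).le⟩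
  have hp := (intervalIntegrable_iff_integrableOn_Ioc_of_le hπ).1 (S.intervalIntegrable_partst F f t)
  rw [intervalIntegrable_iff_integrableOn_Ioc_of_le hπ, IntegrableOn, integrable_indicator_iff hS,
    IntegrableOn, Measure.restrict_restrict hS]
  have := (hreg.mono_set hsub).sub (hp.mono_set Set.inter_subset_right)
  refine this.congr (Eventually.of_forall fun τ => ?_)
  simp only [Pi.sub_apply, ChordPair.reg]
  ring

namespace SmoothBoundary

variable {Ω : Set Plane} {ι : Type*} (Γ : SmoothBoundary Ω ι)

/-- Existence of the finite part of the hypersingular integral over a component. -/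
theorem exists_finitePart (F : LogProfile) (f : Density) (i j : ι) (t : ℝ) :
    ∃ c : ℂ, Tendsto (fun r : ℝ => (∫ τ in (-π)..π, Set.indicator {τ | r < ‖(Γ.pair i j).d t τ‖}
      (fun τ => (Γ.pair i j).hyper F t τ * f.Q (t + τ)) τ) - c / r) (𝓝[>] 0)
      (𝓝 (deriv ((Γ.pair i j).pot F f) t)) := by
  rcases eq_or_ne i j with rfl | hij
  · exact ⟨_, ChordPair.finitePart_of_eq F f rfl (Γ.regular i t)⟩
  · obtain ⟨δ, δ0, hδ⟩ := Γ.exists_chord_ne hij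
    exact ⟨_, (Γ.pair i j).finitePart_of_disjoint F f δ0 fun τ => hδ t (t + τ)⟩

/-- A weakly singular kernel gives an integrable function on each component. -/
theorem intervalIntegrable_weak {k : Plane → Plane → ℂ} (hk : IsHalfSingular (frontier Ω) k)
    (f : Density) (i j : ι) (t : ℝ) :
    IntervalIntegrable (fun τ => k (Γ.curve i t) (Γ.curve j (t + τ)) * f.Q (t + τ)
      * ((‖deriv (Γ.curve j) (t + τ)‖ : ℝ) : ℂ)) volume (-π) π := by
  obtain ⟨hc, C, C0, hC⟩ := hk
  obtain ⟨M, M0, hM⟩ := exists_bound_of_periodic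
    (contDiff_deriv (Γ.smooth j)).continuous (periodic_deriv (Γ.periodic j))
  obtain ⟨N, N0, hN⟩ := exists_bound_of_periodic f.continuous_Q f.pQ
  have hs := (Γ.pair i j).c_pos
  refine intervalIntegrable_of_bound ?_ (fun τ h => ?_)
    ((intervalIntegrable_abs_rpow (b := -(1 / 2)) (by norm_num)).const_mul
      (C * (Γ.pair i j).c ^ (-(1 / 2) : ℝ) * N * M))
  · refine (ContinuousOn.mul ?_ (f.continuous_shift_Q t).continuousOn).mul
      (Complex.continuous_ofReal.comp ((Γ.pair i j).continuous_Y' t).norm).continuousOn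
    have hm : ContinuousOn (fun τ => (Γ.curve i t, Γ.curve j (t + τ))) puncPeriod :=
      (continuous_const.prodMk
        ((Γ.smooth j).continuous.comp (continuous_const.add continuous_id))).continuousOn
    exact hc.comp hm fun τ hτ => ⟨Γ.mem_frontier _ _, Γ.mem_frontier _ _, Γ.ne_of_mem hτ⟩
  · have b := hC _ (Γ.mem_frontier i t) _ (Γ.mem_frontier j (t + τ)) (Γ.ne_of_mem h)
    rw [← Γ.sq_eq] at b
    have e : ‖((‖deriv (Γ.curve j) (t + τ)‖ : ℝ) : ℂ)‖ ≤ M := by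
      rw [Complex.norm_real, norm_norm]; exact hM _
    rw [norm_mul, norm_mul]
    calc _ ≤ C * ((Γ.pair i j).c ^ (-(1 / 2) : ℝ) * |τ| ^ (-(1 / 2) : ℝ)) * N * M := by
          refine mul_le_mul (mul_le_mul (b.trans ?_) (hN _) (norm_nonneg _) (by positivity)) e
            (norm_nonneg _) (by positivity)
          have := (Γ.pair i j).rpow_le (t := t) h
          gcongr
      _ = _ := by ring

variable (P : Medium) {k₁ k₂ : ℂ} {p : Plane → ℂ}

/-- The (2,2) kernel on a component, in terms of the weakly singular and hypersingular parts. -/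
theorem kernel_mul_speed (h1 : k₁ ≠ 0) (h2 : k₂ ≠ 0) (hne : k₁ ^ 2 ≠ k₂ ^ 2)
    (hp : Γ.IsC1Holder p) (i j : ι) (t τ : ℝ) (h : Γ.curve i t ≠ Γ.curve j (t + τ)) :
    (P.hyperKernel k₁ k₂ (Γ.normal (Γ.curve i t)) (Γ.normal (Γ.curve j (t + τ))) (Γ.curve i t)
        (Γ.curve j (t + τ))).toBlocks₂₂ () () * p (Γ.curve j (t + τ))
        * ((‖deriv (Γ.curve j) (t + τ)‖ : ℝ) : ℂ)
      = Γ.kerN41 P k₁ k₂ (Γ.curve i t) (Γ.curve j (t + τ)) * (hp.density j).Q (t + τ)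
          * ((‖deriv (Γ.curve j) (t + τ)‖ : ℝ) : ℂ)
        + ((‖deriv (Γ.curve i) t‖ : ℝ) : ℂ)⁻¹
          * ((Γ.pair i j).hyper (P.profTot k₁ k₂) t τ * (hp.density j).Q (t + τ)) := by
  have hs := Γ.speed_ne j (t + τ)
  have hQ : (hp.density j).Q (t + τ) = p (Γ.curve j (t + τ)) := rfl
  -- The turned normals are unit tangents. The arc length factor at `y` cancels one normalization;
  -- the remaining `1/|X'(t)|` is the one belonging to `d/ds`.
  have hform : (P.profTot k₁ k₂).hessForm (Γ.curve i t - Γ.curve j (t + τ))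
      (rot (Γ.normal (Γ.curve i t))) (rot (Γ.normal (Γ.curve j (t + τ))))
        * ((‖deriv (Γ.curve j) (t + τ)‖ : ℝ) : ℂ)
      = ((‖deriv (Γ.curve i) t‖ : ℝ) : ℂ)⁻¹ * (Γ.pair i j).hyper (P.profTot k₁ k₂) t τ := by
    rw [LogProfile.hessForm, ChordPair.hyper, Γ.sq_eq, Γ.rot_normal, Γ.rot_normal, d_eq,
      ← neg_sub (Γ.curve j (t + τ)) (Γ.curve i t), norm_neg]
    change _ = _ * (4 * _ * ((inner ℝ _ (deriv (Γ.curve i) t) : ℝ) : ℂ)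
      * ((inner ℝ _ (deriv (Γ.curve j) (t + τ)) : ℝ) : ℂ)
        + 2 * _ * ((inner ℝ (deriv (Γ.curve i) t) (deriv (Γ.curve j) (t + τ)) : ℝ) : ℂ))
    simp only [inner_neg_left, real_inner_smul_right, real_inner_smul_left]
    push_cast
    field_simp
  have hk : (P.hyperKernel k₁ k₂ (Γ.normal (Γ.curve i t)) (Γ.normal (Γ.curve j (t + τ)))
      (Γ.curve i t) (Γ.curve j (t + τ))).toBlocks₂₂ () ()
      = Γ.kerN41 P k₁ k₂ (Γ.curve i t) (Γ.curve j (t + τ))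
        + (P.profTot k₁ k₂).hessForm (Γ.curve i t - Γ.curve j (t + τ))
          (rot (Γ.normal (Γ.curve i t))) (rot (Γ.normal (Γ.curve j (t + τ)))) :=
    P.hyperKernel_split h1 h2 hne _ _ h
  rw [hk, hQ]
  linear_combination p (Γ.curve j (t + τ)) * hform

variable [Fintype ι]

theorem hasDerivAt_pots (F : LogProfile) (hp : Γ.IsC1Holder p) (i : ι) (t : ℝ) :
    HasDerivAt (fun t => ∑ j, (Γ.pair i j).pot F (hp.density j) t)
      (∑ j, deriv ((Γ.pair i j).pot F (hp.density j)) t) t :=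
  HasDerivAt.fun_sum fun j _ => ((Γ.pair i j).hasDerivAt_pot F (hp.density j) t).differentiableAt.hasDerivAt

/-- The difference `γ_{k₁} - γ_{k₂}` enters the hypersingular profile twice with coefficient `cD`:
one copy belongs to `N₄²`, the other to `N₄³`. -/
theorem deriv_profTot (F : Density) (S : ChordPair) (t : ℝ) :
    deriv (S.pot (P.profTot k₁ k₂) F) t
      = deriv (S.pot (P.prof2 k₁ k₂) F) t + P.cD k₁ k₂ * deriv (S.pot (Medium.profD k₁ k₂) F) t := by
  have e : S.pot (P.profTot k₁ k₂) F
      = fun t => S.pot (P.prof2 k₁ k₂) F t + P.cD k₁ k₂ * S.pot (Medium.profD k₁ k₂) F t := by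
    funext t
    rw [Medium.profTot, Medium.prof2, ChordPair.pot_lin, ChordPair.pot_lin]
    ring
  have h1 := (S.hasDerivAt_pot (P.prof2 k₁ k₂) F t).differentiableAt.hasDerivAt
  have h2 := (S.hasDerivAt_pot (Medium.profD k₁ k₂) F t).differentiableAt.hasDerivAt
  rw [e]
  exact (h1.add (h2.const_mul _)).deriv

theorem diffAlong_kerN42 (h1 : k₁ ≠ 0) (h2 : k₂ ≠ 0) (hp : Γ.IsC1Holder p) :
    Γ.DiffAlong (Γ.op (SmoothBoundary.kerN42 P k₁ k₂) (Γ.ds p)) := by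
  intro i t
  rw [funext (Γ.op_kerN42 P k₁ k₂ h1 h2 hp i)]
  exact (Γ.hasDerivAt_pots _ hp i t).differentiableAt

theorem diffAlong_kerN43 (h1 : k₁ ≠ 0) (h2 : k₂ ≠ 0) (hp : Γ.IsC1Holder p) :
    Γ.DiffAlong (Γ.op (Γ.kerN43 P k₁ k₂) p) := by
  intro i t
  rw [funext (Γ.op_kerN43 P k₁ k₂ h1 h2 hp i)]
  exact ((Γ.hasDerivAt_pots _ hp i t).const_mul _).differentiableAt

/-- The tangential derivatives combine to those of the hypersingular profile. -/
theorem ds_add_ds (h1 : k₁ ≠ 0) (h2 : k₂ ≠ 0) (hp : Γ.IsC1Holder p) (i : ι) (t : ℝ) :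
    Γ.ds (Γ.op (SmoothBoundary.kerN42 P k₁ k₂) (Γ.ds p)) (Γ.curve i t)
      + Γ.ds (Γ.op (Γ.kerN43 P k₁ k₂) p) (Γ.curve i t)
      = ((‖deriv (Γ.curve i) t‖ : ℝ) : ℂ)⁻¹
        * ∑ j, deriv ((Γ.pair i j).pot (P.profTot k₁ k₂) (hp.density j)) t := by
  rw [ds_curve, ds_curve, funext (Γ.op_kerN42 P k₁ k₂ h1 h2 hp i),
    funext (Γ.op_kerN43 P k₁ k₂ h1 h2 hp i), (Γ.hasDerivAt_pots _ hp i t).deriv,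
    ((Γ.hasDerivAt_pots _ hp i t).const_mul _).deriv]
  simp only [deriv_profTot, Finset.sum_add_distrib, ← Finset.mul_sum]
  ring

/-- The finite part defining `N₄ p`. -/
theorem hasN4Value (h1 : k₁ ≠ 0) (h2 : k₂ ≠ 0) (hne : k₁ ^ 2 ≠ k₂ ^ 2)
    (hb : Bornology.IsBounded (frontier Ω)) (hp : Γ.IsC1Holder p) (i : ι) (t : ℝ) :
    Γ.HasN4Value P k₁ k₂ p (Γ.curve i t)
      (Γ.op (Γ.kerN41 P k₁ k₂) p (Γ.curve i t)
        + Γ.ds (Γ.op (SmoothBoundary.kerN42 P k₁ k₂) (Γ.ds p)) (Γ.curve i t)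
        + Γ.ds (Γ.op (Γ.kerN43 P k₁ k₂) p) (Γ.curve i t)) := by
  rw [add_assoc, Γ.ds_add_ds P h1 h2 hp]
  choose c hc using fun j => Γ.exists_finitePart (P.profTot k₁ k₂) (hp.density j) i j t
  set σ : ℂ := ((‖deriv (Γ.curve i) t‖ : ℝ) : ℂ)⁻¹
  have hweak := fun j => Γ.intervalIntegrable_weak
    (Γ.isHalfSingular_kerN41 P h1 h2 hne hb) (hp.density j) i j t
  -- The pole coefficients add up over the components; the weakly singular part is integrable and
  -- contributes none.
  refine ⟨σ * ∑ j, c j, ?_⟩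
  have key := (tendsto_finsetSum Finset.univ fun j _ =>
    (Γ.pair i j).tendsto_cut t (hweak j)).add
    ((tendsto_finsetSum Finset.univ fun j _ => hc j).const_mul σ)
  have hop : Γ.op (Γ.kerN41 P k₁ k₂) p (Γ.curve i t) = ∑ j, ∫ τ in (-π)..π,
      Γ.kerN41 P k₁ k₂ (Γ.curve i t) (Γ.curve j (t + τ)) * (hp.density j).Q (t + τ)
        * ((‖deriv (Γ.curve j) (t + τ)‖ : ℝ) : ℂ) := Γ.integral_eq_shift _ t
  rw [hop]
  refine key.congr' ?_
  filter_upwards [self_mem_nhdsWithin] with r hr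
  have hr0 : 0 < r := hr
  rw [Γ.integral_eq_shift _ t, Finset.sum_sub_distrib, ← Finset.sum_div, mul_sub, ← add_sub_assoc,
    Finset.mul_sum, ← Finset.sum_add_distrib, mul_div_assoc]
  congr 1
  refine Finset.sum_congr rfl fun j _ => ?_
  have hi : IntervalIntegrable (Set.indicator {τ | r < ‖(Γ.pair i j).d t τ‖} fun τ =>
      Γ.kerN41 P k₁ k₂ (Γ.curve i t) (Γ.curve j (t + τ)) * (hp.density j).Q (t + τ)
        * ((‖deriv (Γ.curve j) (t + τ)‖ : ℝ) : ℂ)) volume (-π) π := by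
    have hS : MeasurableSet {τ | r < ‖(Γ.pair i j).d t τ‖} :=
      (isOpen_lt continuous_const ((Γ.pair i j).continuous_d t).norm).measurableSet
    have := hweak j
    rw [intervalIntegrable_iff] at this ⊢
    exact this.indicator hS
  rw [← intervalIntegral.integral_const_mul, ← intervalIntegral.integral_add hi
    (((Γ.pair i j).intervalIntegrable_cut_hyper _ _ t hr0).const_mul σ)]
  congr 1
  funext τ
  have hd : dist (Γ.curve i t) (Γ.curve j (t + τ)) = ‖(Γ.pair i j).d t τ‖ := by
    rw [dist_comm, dist_eq_norm]; rfl
  by_cases hτ : r < ‖(Γ.pair i j).d t τ‖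
  · have hne' : Γ.curve i t ≠ Γ.curve j (t + τ) := by
      intro h
      rw [← hd, h, dist_self] at hτ
      exact absurd hτ hr0.not_gt
    rw [Set.indicator_of_mem (show τ ∈ {τ | r < ‖(Γ.pair i j).d t τ‖} from hτ),
      Set.indicator_of_mem (show τ ∈ {τ | r < ‖(Γ.pair i j).d t τ‖} from hτ),
      Set.indicator_of_mem (show Γ.curve j (t + τ) ∈ {y | r < dist (Γ.curve i t) y} by
        rw [Set.mem_ofPred_eq, hd]; exact hτ)]
    exact (Γ.kernel_mul_speed P h1 h2 hne hp i j t τ hne').symm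
  · rw [Set.indicator_of_notMem (show τ ∉ {τ | r < ‖(Γ.pair i j).d t τ‖} from hτ),
      Set.indicator_of_notMem (show τ ∉ {τ | r < ‖(Γ.pair i j).d t τ‖} from hτ),
      Set.indicator_of_notMem (show Γ.curve j (t + τ) ∉ {y | r < dist (Γ.curve i t) y} by
        rw [Set.mem_ofPred_eq, hd]; exact hτ)]
    simp

end SmoothBoundary

end Poro

end

theorem mainTheorem6 {ι : Type*} [Fintype ι] (P : Poro.Medium) (k₁ k₂ : ℂ)
    (hk : P.IsWaveNumbers k₁ k₂) (hne : k₁ ^ 2 ≠ k₂ ^ 2)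
    (Ω : Set Poro.Plane) (hopen : IsOpen Ω) (hconn : IsConnected Ω)
    (hbdd : Bornology.IsBounded Ω) (Γ : Poro.SmoothBoundary Ω ι) :
    (Poro.IsWeaklySingular (frontier Ω) (Γ.kerN41 P k₁ k₂) ∧
      Poro.IsWeaklySingular (frontier Ω) (Poro.SmoothBoundary.kerN42 P k₁ k₂) ∧
      Poro.IsWeaklySingular (frontier Ω) (Γ.kerN43 P k₁ k₂)) ∧
    ∀ p : Poro.Plane → ℂ, Γ.IsC1Holder p →
      Γ.DiffAlong (Γ.op (Poro.SmoothBoundary.kerN42 P k₁ k₂) (Γ.ds p)) ∧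
      Γ.DiffAlong (Γ.op (Γ.kerN43 P k₁ k₂) p) ∧
      ∀ x ∈ frontier Ω,
        Γ.HasN4Value P k₁ k₂ p x
          (Γ.op (Γ.kerN41 P k₁ k₂) p x
            + Γ.ds (Γ.op (Poro.SmoothBoundary.kerN42 P k₁ k₂) (Γ.ds p)) x
            + Γ.ds (Γ.op (Γ.kerN43 P k₁ k₂) p) x) := by

  obtain ⟨h1, h2⟩ := hk.ne_zero
  have hb : Bornology.IsBounded (frontier Ω) := hbdd.closure.subset frontier_subset_closure
  refine ⟨⟨(Γ.isHalfSingular_kerN41 P h1 h2 hne hb).isWeaklySingular,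
    (Poro.SmoothBoundary.isHalfSingular_kerN42 P h1 h2 hb).isWeaklySingular,
    (Γ.isHalfSingular_kerN43 P h1 h2 hb).isWeaklySingular⟩, fun p hp =>
    ⟨Γ.diffAlong_kerN42 P h1 h2 hp, Γ.diffAlong_kerN43 P h1 h2 hp, fun x hx => ?_⟩⟩
  obtain ⟨i, t, rfl⟩ := Γ.exists_param hx
  exact Γ.hasN4Value P h1 h2 hne hb hp i t
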